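/- Let $\mathbb T^3=\mathbb R^3/\mathbb Z^3$, let $v_{in}\in L^2(\mathbb T^3;\mathbb R^3)$ be divergence-free, and for $\nu\in(0,1)$ let $f_\nu\in L^1(0,1;L^2(\mathbb T^3;\mathbb R^3))$ and let $v_\nu$ be a Leray--Hopf solution on $[0,1]\times\mathbb T^3$ of $$\partial_t v_\nu+v_\nu\cdot\nabla v_\nu+\nabla p_\nu=\nu\Delta v_\nu+f_\nu,\qquad \operatorname{div}v_\nu=0,\qquad v_\nu(0)=v_{in}.$$ That is: $v_\nu\in L^\infty(0,1;L^2)\cap L^2(0,1;H^1)\cap C_w([0,1];L^2)$ is divergence-free, $v_\nu(0)=v_{in}$, the equation holds in the weak sense (with some pressure $p_\nu\in L^1((0,1)\times\mathbb T^3)$) when tested with any $\psi\in C^\infty(\mathbb T^3;\mathbb R^3)$ and integrated over $[0,t]$, for every $t\in[0,1]$, and for every $t\in(0,1]$ $$\|v_\nu(t)\|_{L^2}^2+2\nu\int_0^t\|\nabla v_\nu\|_{L^2}^2\,dr\le\|v_{in}\|_{L^2}^2+2\int_0^t\langle f_\nu,v_\nu\rangle\,dr .$$ Assume that for some $\sigma>0$,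 $\alpha\in(0,1)$ and $q\in[1,2]$ $$\sup_{\nu\in(0,1)}\Big(\|v_\nu\|_{L^\infty(0,1;L^2)}+\|v_\nu\|_{L^q(0,1;H^\alpha)}+\|f_\nu\|_{L^{1+\sigma}(0,1;L^2)}\Big)<\infty .$$ With $\delta_hv(x)=v(x+h)-v(x)$, put for $\ell>0$, $t\in[0,1]$ $$S^\nu_\|(t,\ell)=\frac1{4\pi}\int_{\mathbb S^2}\int_{\mathbb T^3}(\delta_{\ell\hat n}v_\nu(t,x)\cdot\hat n)^3\,dx\,dS(\hat n),\qquad S^\nu_0(t,\ell)=\frac1{4\pi}\int_{\mathbb S^2}\int_{\mathbb T^3}|\delta_{\ell\hat n}v_\nu(t,x)|^2\,\delta_{\ell\hat n}v_\nu(t,x)\cdot\hat n\,dx\,dS(\hat n),$$ $$\varepsilon_\nu(t)=\tfrac12\|v_\nu(0)\|_{L^2}^2-\tfrac12\|v_\nu(t)\|_{L^2}^2+\int_0^t\langle f_\nu,v_\nu\rangle\,dr .$$ Then $\int_0^1\int_{\mathbb S^2}\int_{\mathbb T^3}|\delta_{\ell\hat n}v_\nu(r,x)|^3\,dx\,dS(\hat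 n)\,dr<\infty$ for all $\nu\in(0,1)$ and $\ell>0$, and for every $K$ with $0<K<\frac1{2-\alpha q}$, with $\ell_D=\nu^K$, and for every $p\in[1,\infty)$, $\kappa>0$ and $M>0$, $$\lim_{\ell_I\to0}\limsup_{\nu\to0}\sup_{\ell\in[\ell_D,\ell_I]}\sup_{\mathfrak t}\Big\langle\Big|\int_0^{\mathfrak t}\frac{S^\nu_\|(r,\ell)}{\ell}\,dr+\frac45\varepsilon_\nu(\mathfrak t)\Big|^p\Big\rangle=0,$$ $$\lim_{\ell_I\to0}\limsup_{\nu\to0}\sup_{\ell\in[\ell_D,\ell_I]}\sup_{\mathfrak t}\Big\langle\Big|\int_0^{\mathfrak t}\frac{S^\nu_0(r,\ell)}{\ell}\,dr+\frac43\varepsilon_\nu(\mathfrak t)\Big|^p\Big\rangle=0 .$$ Here $\mathfrak t$ ranges over all random times with values in $[0,1]$ (on arbitrary probability spaces) whose law has a density $\psi$ with respect to Lebesgue measure with $\|\psi\|_{L^{1+\kappa}(0,1)}\le M$, $\langle\cdot\rangle$ is the expectation, and suprema over empty sets are $0$. -/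

import Mathlib

open MeasureTheory Set Filter Topology
open scoped ENNReal ContDiff

noncomputable section

namespace Kolmogorov

/-- The vector space in which velocities take their values, with its Euclidean norm. -/
abbrev R3 : Type := EuclideanSpace ℝ (Fin 3)

/-- The flat torus `ℝ³ / ℤ³`; its `volume` is the Lebesgue measure, of total mass one. -/
abbrev T3 : Type := UnitAddTorus (Fin 3)

/-- The quotient map `ℝ³ → ℝ³ / ℤ³`. -/
def toTorus (h : R3) : T3 := fun i => (h i : UnitAddCircle)

/-- Lebesgue measure on the time interval `[0,1]`. -/
def timeMeasure : Measure ℝ := volume.restrict (Icc 0 1)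

/-! ### Calculus on the torus -/

/-- `C^∞` functions on the torus: the periodic lift to `ℝ³` is smooth. -/
def IsSmooth {F : Type*} [NormedAddCommGroup F] [NormedSpace ℝ F] (φ : T3 → F) : Prop :=
  ContDiff ℝ ∞ (fun y : R3 => φ (toTorus y))

/-- The partial derivative `∂_j φ`. -/
def partialDeriv {F : Type*} [NormedAddCommGroup F] [NormedSpace ℝ F]
    (j : Fin 3) (φ : T3 → F) (x : T3) : F :=
  deriv (fun s : ℝ => φ (x + toTorus (EuclideanSpace.single j s))) 0

/-- The Laplacian `Δ φ = ∑_j ∂_j ∂_j φ`. -/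
def laplace {F : Type*} [NormedAddCommGroup F] [NormedSpace ℝ F] (φ : T3 → F) (x : T3) : F :=
  ∑ j : Fin 3, partialDeriv j (partialDeriv j φ) x

/-- The divergence `∑_j ∂_j ψ_j` of a vector field. -/
def divergence (ψ : T3 → R3) (x : T3) : ℝ :=
  ∑ j : Fin 3, partialDeriv j (fun y => ψ y j) x

/-- `div u = 0` in the sense of distributions. -/
def IsDivFree (u : T3 → R3) : Prop :=
  ∀ φ : T3 → ℝ, IsSmooth φ → ∫ x, ∑ j : Fin 3, u x j * partialDeriv j φ x = 0

/-- `G j` is the weak partial derivative `∂_j u`, for each `j`. -/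
def HasWeakGradient (u : T3 → R3) (G : T3 → Fin 3 → R3) : Prop :=
  ∀ (j : Fin 3) (φ : T3 → ℝ), IsSmooth φ →
    ∫ x, partialDeriv j φ x • u x = - ∫ x, φ x • G x j

/-- The Sobolev norm `‖u‖_{H^α} = (∑_k (1 + |k|²)^α |û(k)|²)^{1/2}`, possibly infinite. -/
def sobolevNorm (α : ℝ) (u : T3 → R3) : ℝ≥0∞ :=
  (∑' k : Fin 3 → ℤ, ENNReal.ofReal ((1 + ∑ i : Fin 3, (k i : ℝ) ^ 2) ^ α) *
    ∑ i : Fin 3, ‖UnitAddTorus.mFourierCoeff (fun x => ((u x i : ℝ) : ℂ)) k‖ₑ ^ 2) ^ (1 / 2 : ℝ)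

/-! ### Leray–Hopf solutions -/

/-- `v` is a Leray–Hopf solution on `[0,1] × T³` of
`∂ₜ v + v · ∇v + ∇p = ν Δv + f`, `div v = 0`, `v(0) = vin`. -/
structure IsLerayHopf (ν : ℝ) (vin : T3 → R3) (f v : ℝ → T3 → R3) : Prop where
  vin_memLp : MemLp vin 2 volume
  vin_divFree : IsDivFree vin
  /- `f ∈ L¹(0,1; L²)` -/
  force_aesm : AEStronglyMeasurable (Function.uncurry f) (timeMeasure.prod volume)
  force_bound : eLpNorm (fun t => eLpNorm (f t) 2 volume) 1 timeMeasure < ⊤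
  /- `v ∈ L^∞(0,1; L²)`, defined as an element of `L²` at every time -/
  aesm : AEStronglyMeasurable (Function.uncurry v) (timeMeasure.prod volume)
  memLp : ∀ t ∈ Icc (0 : ℝ) 1, MemLp (v t) 2 volume
  bound : eLpNorm (fun t => eLpNorm (v t) 2 volume) ⊤ timeMeasure < ⊤
  /- `v ∈ C_w([0,1]; L²)` -/
  weak_cont : ∀ w : T3 → R3, MemLp w 2 volume →
    ContinuousOn (fun t => ∫ x, inner ℝ (v t x) (w x)) (Icc 0 1)
  divFree : ∀ t ∈ Icc (0 : ℝ) 1, IsDivFree (v t)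
  initial : v 0 =ᵐ[volume] vin
  /- `G r x j = ∂_j v(r,x)` and `p` is the pressure -/
  exists_gradient_pressure : ∃ (G : ℝ → T3 → Fin 3 → R3) (p : ℝ → T3 → ℝ),
    /- `v ∈ L²(0,1; H¹)` -/
    AEStronglyMeasurable (Function.uncurry G) (timeMeasure.prod volume) ∧
    (∀ᵐ r ∂timeMeasure, HasWeakGradient (v r) (G r)) ∧
    ∫⁻ r, (∫⁻ x, ∑ j : Fin 3, ‖G r x j‖ₑ ^ 2) ∂timeMeasure < ⊤ ∧
    Integrable (Function.uncurry p) (timeMeasure.prod volume) ∧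
    /- the weak form of the equation, with `-⟨∇p, ψ⟩ = ⟨p, div ψ⟩` -/
    (∀ t ∈ Icc (0 : ℝ) 1, ∀ ψ : T3 → R3, IsSmooth ψ →
      (∫ x, inner ℝ (v t x) (ψ x)) - ∫ x, inner ℝ (v 0 x) (ψ x) =
        ν * (∫ r in (0 : ℝ)..t, ∫ x, inner ℝ (v r x) (laplace ψ x))
        - (∫ r in (0 : ℝ)..t, ∫ x, inner ℝ (∑ j : Fin 3, v r x j • G r x j) (ψ x))
        + (∫ r in (0 : ℝ)..t, ∫ x, inner ℝ (f r x) (ψ x))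
        + ∫ r in (0 : ℝ)..t, ∫ x, p r x * divergence ψ x) ∧
    /- the energy inequality -/
    (∀ t ∈ Ioc (0 : ℝ) 1,
      (∫ x, ‖v t x‖ ^ 2) + 2 * ν * (∫ r in (0 : ℝ)..t, ∫ x, ∑ j : Fin 3, ‖G r x j‖ ^ 2) ≤
        (∫ x, ‖vin x‖ ^ 2) + 2 * ∫ r in (0 : ℝ)..t, ∫ x, inner ℝ (f r x) (v r x))

/-- The uniform bound
`sup_{0<ν<1} (‖v_ν‖_{L^∞(0,1;L²)} + ‖v_ν‖_{L^q(0,1;H^α)} + ‖f_ν‖_{L^{1+σ}(0,1;L²)}) < ∞`. -/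
def UniformBound (σ α q : ℝ) (f v : ℝ → ℝ → T3 → R3) : Prop :=
  ⨆ ν ∈ Ioo (0 : ℝ) 1,
    (eLpNorm (fun t => eLpNorm (v ν t) 2 volume) ⊤ timeMeasure
      + eLpNorm (fun t => sobolevNorm α (v ν t)) (ENNReal.ofReal q) timeMeasure
      + eLpNorm (fun t => eLpNorm (f ν t) 2 volume) (ENNReal.ofReal (1 + σ)) timeMeasure) < ⊤

/-! ### Structure functions and dissipation -/

/-- The unit sphere of `ℝ³`. -/
abbrev S2 : Type := Metric.sphere (0 : R3) 1

/-- The surface measure on the unit sphere, of total mass `4π`. -/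
def surfaceMeasure : Measure S2 := (volume : Measure R3).toSphere

/-- The increment `δ_h u(x) = u(x + h) - u(x)`. -/
def increment (h : R3) (u : T3 → R3) (x : T3) : R3 := u (x + toTorus h) - u x

/-- The averaged longitudinal structure function
`S_∥(ℓ) = (4π)⁻¹ ∫_{S²} ∫_{T³} (δ_{ℓn} u · n)³ dx dS(n)`. -/
def structLong (u : T3 → R3) (l : ℝ) : ℝ :=
  1 / (4 * Real.pi) * ∫ n : S2, (∫ x : T3,
    (inner ℝ (increment (l • (n : R3)) u x) (n : R3)) ^ 3) ∂surfaceMeasure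

/-- The averaged structure function
`S_0(ℓ) = (4π)⁻¹ ∫_{S²} ∫_{T³} |δ_{ℓn} u|² (δ_{ℓn} u · n) dx dS(n)`. -/
def structZero (u : T3 → R3) (l : ℝ) : ℝ :=
  1 / (4 * Real.pi) * ∫ n : S2, (∫ x : T3, ‖increment (l • (n : R3)) u x‖ ^ 2 *
    inner ℝ (increment (l • (n : R3)) u x) (n : R3)) ∂surfaceMeasure

/-- `ε(t) = ½ ‖v(0)‖² - ½ ‖v(t)‖² + ∫_0^t ⟨f, v⟩ dr`. -/
def dissipation (f v : ℝ → T3 → R3) (t : ℝ) : ℝ :=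
  1 / 2 * (∫ x, ‖v 0 x‖ ^ 2) - 1 / 2 * (∫ x, ‖v t x‖ ^ 2)
    + ∫ r in (0 : ℝ)..t, ∫ x, inner ℝ (f r x) (v r x)

/-! ### Random times -/

/-- A random time with values in `[0,1]`, on an arbitrary probability space, whose law has a
density `ψ` with respect to Lebesgue measure with `‖ψ‖_{L^{1+κ}(0,1)} ≤ M`. -/
structure RandomTime (κ M : ℝ) where
  Ω : Type*
  [mΩ : MeasurableSpace Ω]
  P : Measure Ω
  [isProb : IsProbabilityMeasure P]
  time : Ω → ℝ
  measurable_time : Measurable time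
  time_mem : ∀ w, time w ∈ Icc (0 : ℝ) 1
  exists_density : ∃ ψ : ℝ → ℝ≥0∞, Measurable ψ ∧
    P.map time = timeMeasure.withDensity ψ ∧
    eLpNorm ψ (ENNReal.ofReal (1 + κ)) timeMeasure ≤ ENNReal.ofReal M

/-- The ensemble average `⟨|F(𝔱)|^p⟩`, with values in `[0,∞]`. -/
def RandomTime.average {κ M : ℝ} (τ : RandomTime κ M) (p : ℝ) (F : ℝ → ℝ) : ℝ≥0∞ :=
  letI := τ.mΩ
  ∫⁻ w, ENNReal.ofReal (|F (τ.time w)| ^ p) ∂τ.P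

end Kolmogorov

end

open Kolmogorov

universe u

noncomputable section

namespace Kolmogorov

/-! ### The divergence theorem on the unit ball -/

/-! The engine is an exact energy balance at scale ℓ. The matrix kernel φ_ij(y) = (A - b|y|²)δ_ij +
b y_i y_j (`kernel`), cut off sharply to the unit ball and rescaled to radius ℓ, acts on the
velocity as the Fourier multiplier `symbol A b` evaluated at ℓk. Three properties dictate the form
of φ, each an instance of the divergence theorem on the ball. Contracted with a fully symmetric
tensor B, the sum of B_lij ∂_l φ_ij vanishes inside the ball, so the nonlinear term is carried by
the sphere |y| = ℓ and becomes the spherical average of (A - b)|δv|² δv·n + b(δv·n)³ (`symbol_flux`,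
`hasSum_fluxTerm`). The symbol maps ξ to a multiple of ξ, so the pressure drops out
(`symbol_orthogonal`, `pressure_cancel`). The integral of φ is Z δ_ij with Z = (4π/3)(A - 2b/5)
(`symbol_zero`). Taking A = b = 1 gives the longitudinal law with constant Z/π = 4/5, and A = 1, b =
0 the other law with 4/3.

At fixed ν the solution is in H¹ for almost every time, which justifies every manipulation: products
of components lie in L² (`tsum_coef_mul_sq_le`), and each Fourier mode is a primitive in time
(`vhat_eq`), so the balance can be written mode by mode (`integral_fluxTerm`) and then summed.
Comparison with Z times the energy yields `enorm_defect_le`: the defect in the law is bounded by the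
energy at times t and 0, the work of the force, each weighted by min(1, ℓ|k|), and a viscous term
weighted by the symbol itself.

These errors are small uniformly for ℓ in [ν^K, ℓ_I]. Interpolation between L^∞L² and L^q H^α bounds
v in L² H^s with s = αq/2, so the weighted energy is small in time average. The random time turns
this average into smallness at the time t, a density in L^{1+κ} being unable to concentrate. The
force is treated likewise through its L^{1+σ} bound, and the initial datum does not depend on ν. In
the viscous term the frequencies with ℓ|k| ≥ R are damped by the Riemann–Lebesgue lemma against the
energy bound on ν∫‖∇v‖², while the others contribute at most a constant times ν(R/ℓ)^{2-αq}, which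
tends to 0 exactly because K(2 - αq) < 1. The energy inequality serves only to bound ν∫‖∇v‖². -/

theorem norm_sphere_coe (n : S2) : ‖(n : R3)‖ = 1 := by
  simp

instance : IsFiniteMeasure surfaceMeasure := by
  unfold surfaceMeasure; infer_instance

/-- The homeomorphism of the punctured space with S² × (0,∞) carries volume to surface measure times
r² dr, and the origin is a null set. -/
theorem integral_polar {f : R3 → ℝ} (hf : Integrable f) :
    ∫ x, f x = ∫ r in Ioi (0 : ℝ), r ^ 2 * ∫ n : S2, f (r • (n : R3)) ∂surfaceMeasure := by
  have hd : Module.finrank ℝ R3 = 3 := by simp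
  have mp := (volume : Measure R3).measurePreserving_homeomorphUnitSphereProd
  rw [hd] at mp
  have emb := (homeomorphUnitSphereProd R3).measurableEmbedding
  have key : ∀ x : ({0}ᶜ : Set R3), f x =
      (fun p : S2 × Ioi (0 : ℝ) => f ((p.2 : ℝ) • (p.1 : R3))) (homeomorphUnitSphereProd R3 x) := by
    intro x
    have : ((homeomorphUnitSphereProd R3).symm (homeomorphUnitSphereProd R3 x) : R3) = x := by simp
    rw [homeomorphUnitSphereProd_symm_apply_coe] at this
    simp only [this]
  have hi : Integrable (fun p : S2 × Ioi (0 : ℝ) => f ((p.2 : ℝ) • (p.1 : R3)))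
      (surfaceMeasure.prod (Measure.volumeIoiPow 2)) := by
    have h1 : Integrable (fun x : ({0}ᶜ : Set R3) => f x) (Measure.comap Subtype.val volume) := by
      have := (integrableOn_iff_comap_subtypeVal (f := f) (μ := (volume : Measure R3))
        (s := ({0}ᶜ : Set R3)) (by measurability)).1 hf.integrableOn
      simpa [Function.comp_def] using this
    refine (mp.integrable_comp_emb emb).1 ?_
    refine h1.congr (ae_of_all _ fun x => ?_)
    exact key x
  calc ∫ x, f x = ∫ x : ({0}ᶜ : Set R3), f x ∂(Measure.comap Subtype.val volume) := by
        rw [integral_subtype_comap (measurableSet_singleton _).compl f, restrict_compl_singleton]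
    _ = ∫ p, f ((p.2 : ℝ) • (p.1 : R3)) ∂(surfaceMeasure.prod (Measure.volumeIoiPow 2)) := by
        refine Eq.trans (integral_congr_ae (ae_of_all _ key)) ?_
        exact mp.integral_comp emb (fun p : S2 × Ioi (0 : ℝ) => f ((p.2 : ℝ) • (p.1 : R3)))
    _ = ∫ r : Ioi (0 : ℝ), (∫ n : S2, f ((r : ℝ) • (n : R3)) ∂surfaceMeasure)
          ∂(Measure.volumeIoiPow 2) := integral_prod_symm _ hi
    _ = _ := by
        simp only [Measure.volumeIoiPow, ENNReal.ofReal]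
        rw [integral_withDensity_eq_integral_smul,
          integral_subtype_comap measurableSet_Ioi fun a : ℝ =>
            Real.toNNReal (a ^ 2) • (∫ n : S2, f (a • (n : R3)) ∂surfaceMeasure)]
        · refine setIntegral_congr_fun measurableSet_Ioi fun x hx => ?_
          simp only [NNReal.smul_def, Real.coe_toNNReal _ (pow_nonneg (le_of_lt hx) _),
            smul_eq_mul]
        · exact (measurable_subtype_coe.pow_const _).real_toNNReal

theorem continuous_sphere_integral {F : R3 → R3 → ℝ} (hF : Continuous (Function.uncurry F)) :
    Continuous fun r : ℝ => ∫ n : S2, F (n : R3) (r • (n : R3)) ∂surfaceMeasure := by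
  have : Continuous (Function.uncurry fun (r : ℝ) (n : S2) => F (n : R3) (r • (n : R3))) := by
    have h : Continuous fun p : ℝ × S2 => ((p.2 : R3), p.1 • (p.2 : R3)) := by fun_prop
    exact hF.comp h
  simpa using continuous_parametric_integral_of_continuous (μ := surfaceMeasure) this isCompact_univ

theorem setIntegral_ball_polar {f : R3 → ℝ} (hf : Continuous f) :
    ∫ x in Metric.ball (0 : R3) 1, f x =
      ∫ r in (0 : ℝ)..1, r ^ 2 * ∫ n : S2, f (r • (n : R3)) ∂surfaceMeasure := by
  have hi : Integrable ((Metric.ball (0 : R3) 1).indicator f) := by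
    rw [integrable_indicator_iff measurableSet_ball]
    exact (hf.continuousOn.integrableOn_compact (isCompact_closedBall 0 1)).mono_set
      Metric.ball_subset_closedBall
  rw [← integral_indicator measurableSet_ball, integral_polar hi,
    intervalIntegral.integral_of_le zero_le_one, integral_Ioc_eq_integral_Ioo,
    ← Ioi_inter_Iio, ← setIntegral_indicator measurableSet_Iio]
  refine setIntegral_congr_fun measurableSet_Ioi fun r (hr : 0 < r) => ?_
  have hm : ∀ n : S2, r • (n : R3) ∈ Metric.ball (0 : R3) 1 ↔ r < 1 := fun n => by
    simp [norm_smul, abs_of_pos hr]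
  by_cases h : r < 1
  · simp [indicator, hm, h]
  · simp [indicator, hm, h]

/-- The profile is constant for r < a, so the singularity of the norm at the origin is invisible;
elsewhere this is the chain rule. -/
theorem hasFDerivAt_radial {k θ : ℝ → ℝ} (hk : ∀ r, HasDerivAt k (θ r) r) {a : ℝ} (ha : 0 < a)
    (hθ : ∀ r ≤ a, θ r = 0) (y : R3) :
    HasFDerivAt (fun y : R3 => k ‖y‖) ((θ ‖y‖ * ‖y‖⁻¹) • innerSL ℝ y) y := by
  by_cases hy : ‖y‖ < a
  · have hc : ∀ r ∈ Iio a, k r = k 0 := by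
      have hd : ∀ r ∈ Iio a, HasDerivAt k 0 r := fun r hr => by
        have := hk r; rwa [hθ r (le_of_lt hr)] at this
      intro r hr
      exact (isOpen_Iio).is_const_of_deriv_eq_zero isPreconnected_Iio
        (fun x hx => (hd x hx).differentiableAt.differentiableWithinAt)
        (fun x hx => (hd x hx).deriv) hr ha
    have he : (fun y : R3 => k ‖y‖) =ᶠ[𝓝 y] fun _ => k 0 := by
      filter_upwards [continuous_norm.continuousAt.eventually (Iio_mem_nhds hy)] with z hz
      exact hc _ hz
    rw [hθ _ hy.le, zero_mul, zero_smul]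
    exact (hasFDerivAt_const (k 0) y).congr_of_eventuallyEq he
  · have hy0 : y ≠ 0 := by
      rintro rfl; simp at hy; linarith
    have h1 : HasFDerivAt (fun y : R3 => ‖y‖) (‖y‖⁻¹ • innerSL ℝ y) y := by
      have h2 := ((hasStrictFDerivAt_norm_sq y).hasFDerivAt).sqrt (by positivity)
      simp only [Real.sqrt_sq (norm_nonneg _)] at h2
      have h3 : (1 / (2 * ‖y‖)) • (2 : ℕ) • innerSL ℝ y = ‖y‖⁻¹ • innerSL ℝ y := by
        rw [← Nat.cast_smul_eq_nsmul ℝ, smul_smul]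
        congr 1
        push_cast
        field_simp
      rwa [h3] at h2
    have := (hk ‖y‖).comp_hasFDerivAt y h1
    rw [mul_smul]
    exact this

/-- The sharp ball is reached through radial cutoffs. Testing ∂_e g against k(|y|) in polar
coordinates gives ∫ θ (P - r²A) dr = 0 for every test function θ = k' on (0,∞), where P(r)
integrates ∂_e g over the ball of radius r and r²A(r) is the flux through its boundary. Hence P =
r²A almost everywhere, then for all r > 0 by continuity, and r = 1 is the claim. -/
theorem integral_ball_fderiv {g : R3 → ℝ} (hg : ContDiff ℝ 1 g) (e : R3) :
    ∫ y in Metric.ball (0 : R3) 1, fderiv ℝ g y e =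
      ∫ n : S2, inner ℝ (n : R3) e * g n ∂surfaceMeasure := by
  have hg' : Continuous fun y => fderiv ℝ g y e :=
    (hg.continuous_fderiv one_ne_zero).clm_apply continuous_const
  set A : ℝ → ℝ := fun r => ∫ n : S2, inner ℝ (n : R3) e * g (r • (n : R3)) ∂surfaceMeasure with hA
  set I : ℝ → ℝ := fun r => ∫ n : S2, fderiv ℝ g (r • (n : R3)) e ∂surfaceMeasure with hI
  have cA : Continuous A := continuous_sphere_integral (F := fun n y => inner ℝ n e * g y) (by
    have := hg.continuous
    fun_prop)
  have cI : Continuous I := continuous_sphere_integral (F := fun n y => fderiv ℝ g y e) (by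
    fun_prop)
  set P : ℝ → ℝ := fun r => ∫ s in (0 : ℝ)..r, s ^ 2 * I s with hP
  have cs : Continuous fun s => s ^ 2 * I s := by fun_prop
  have dP : ∀ r, HasDerivAt P (r ^ 2 * I r) r := fun r =>
    intervalIntegral.integral_hasDerivAt_right (cs.intervalIntegrable _ _)
      (cs.stronglyMeasurableAtFilter _ _) cs.continuousAt
  have cP : Continuous P := continuous_iff_continuousAt.2 fun r => (dP r).continuousAt
  have weak : ∀ θ : ℝ → ℝ, ContDiff ℝ ∞ θ → HasCompactSupport θ → tsupport θ ⊆ Ioi 0 →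
      ∫ r, θ r • (P r - r ^ 2 * A r) = 0 := by
    intro θ hθ hc hs
    obtain ⟨a, ha, hθa⟩ : ∃ a > 0, ∀ r ≤ a, θ r = 0 := by
      by_cases hne : (tsupport θ).Nonempty
      · obtain ⟨m, hm, hmin⟩ := hc.isCompact.exists_isMinOn hne continuousOn_id
        have hm0 : 0 < m := hs hm
        refine ⟨m / 2, by positivity, fun r hr => ?_⟩
        by_contra h
        have := hmin (subset_tsupport θ h)
        simp at this
        linarith
      · refine ⟨1, one_pos, fun r _ => ?_⟩
        by_contra h
        exact hne ⟨r, subset_tsupport θ h⟩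
    obtain ⟨R, hR0, hR⟩ : ∃ R > 0, ∀ r ≥ R, θ r = 0 := by
      obtain ⟨R, hR⟩ := hc.isCompact.isBounded.subset_closedBall 0
      refine ⟨|R| + 1, by positivity, fun r hr => ?_⟩
      by_contra h
      have := hR (subset_tsupport θ h)
      simp at this
      linarith [le_abs_self r, le_abs_self R]
    have cθ := hθ.continuous
    -- The primitive of θ is normalised to vanish beyond R, so that k(|y|) has compact support.
    set k : ℝ → ℝ := fun r => (∫ s in (0 : ℝ)..r, θ s) - ∫ s in (0 : ℝ)..R, θ s with hk
    have dk : ∀ r, HasDerivAt k (θ r) r := fun r =>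
      (intervalIntegral.integral_hasDerivAt_right (cθ.intervalIntegrable _ _)
        (cθ.stronglyMeasurableAtFilter _ _) cθ.continuousAt).sub_const _
    have ck : Continuous k := continuous_iff_continuousAt.2 fun r => (dk r).continuousAt
    have kR : ∀ r ≥ R, k r = 0 := fun r hr => by
      simp only [hk]
      rw [intervalIntegral.integral_interval_sub_left (cθ.intervalIntegrable _ _)
        (cθ.intervalIntegrable _ _), intervalIntegral.integral_of_le hr]
      exact setIntegral_eq_zero_of_forall_eq_zero fun x hx => hR x hx.1.le
    have df := hasFDerivAt_radial dk ha hθa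
    have dff : ∀ y : R3, fderiv ℝ (fun y : R3 => k ‖y‖) y e = θ ‖y‖ * ‖y‖⁻¹ * inner ℝ y e := by
      intro y; rw [(df y).fderiv]; simp
    have cff : Continuous fun y : R3 => θ ‖y‖ * ‖y‖⁻¹ * inner ℝ y e := by
      have hq : Continuous fun r : ℝ => θ r * r⁻¹ := by
        rw [continuous_iff_continuousAt]
        intro r
        by_cases hr : r < a
        · refine continuousAt_const.congr (f := fun _ => (0 : ℝ)) ?_
          filter_upwards [Iio_mem_nhds hr] with s hs
          rw [hθa s (le_of_lt hs), zero_mul]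
        · have : r ≠ 0 := by intro h; subst h; exact hr ha
          exact cθ.continuousAt.mul (continuousAt_inv₀ this)
      have := hq.comp (continuous_norm (E := R3))
      exact Continuous.mul this (by fun_prop)
    have hcs : ∀ u : R3 → ℝ, (∀ y, R ≤ ‖y‖ → u y = 0) → HasCompactSupport u := fun u hu =>
      HasCompactSupport.of_support_subset_isCompact (isCompact_closedBall (0 : R3) R) fun y hy => by
        by_contra h
        simp at h
        exact hy (hu y h.le)
    have i1 : Integrable fun y : R3 => θ ‖y‖ * ‖y‖⁻¹ * inner ℝ y e * g y :=
      (cff.mul hg.continuous).integrable_of_hasCompactSupport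
        (hcs _ fun y hy => by simp [hR _ hy])
    have i2 : Integrable fun y : R3 => k ‖y‖ * fderiv ℝ g y e :=
      ((ck.comp continuous_norm).mul hg').integrable_of_hasCompactSupport
        (hcs _ fun y hy => by simp [kR _ hy])
    have i3 : Integrable fun y : R3 => k ‖y‖ * g y :=
      ((ck.comp continuous_norm).mul hg.continuous).integrable_of_hasCompactSupport
        (hcs _ fun y hy => by simp [kR _ hy])
    have ibp := integral_mul_fderiv_eq_neg_fderiv_mul_of_integrable (μ := (volume : Measure R3))
      (f := fun y : R3 => k ‖y‖) (g := g) (v := e) (by simpa only [dff] using i1) i2 i3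
      (fun y _ => (df y).differentiableAt) (fun y _ => (hg.differentiable one_ne_zero) y)
    simp only [dff] at ibp
    rw [integral_polar i1, integral_polar i2] at ibp
    have e1 : ∫ r in Ioi (0 : ℝ), r ^ 2 * ∫ n : S2, k ‖r • (n : R3)‖ *
        fderiv ℝ g (r • (n : R3)) e ∂surfaceMeasure = ∫ r in (0 : ℝ)..R, k r * (r ^ 2 * I r) := by
      rw [intervalIntegral.integral_of_le hR0.le]
      refine (setIntegral_congr_fun measurableSet_Ioi fun r (hr : 0 < r) => ?_).trans
        (setIntegral_eq_of_subset_of_forall_sdiff_eq_zero measurableSet_Ioi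
          Ioc_subset_Ioi_self ?_)
      · simp only [norm_smul, Real.norm_eq_abs, abs_of_pos hr, norm_sphere_coe, mul_one, hI,
          integral_const_mul]
        ring
      · intro r hr
        rw [kR r (by by_contra h; exact hr.2 ⟨hr.1, by linarith⟩), zero_mul]
    have e2 : ∫ r in Ioi (0 : ℝ), r ^ 2 * ∫ n : S2, θ ‖r • (n : R3)‖ * ‖r • (n : R3)‖⁻¹ *
        inner ℝ (r • (n : R3)) e * g (r • (n : R3)) ∂surfaceMeasure =
        ∫ r in (0 : ℝ)..R, θ r * (r ^ 2 * A r) := by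
      rw [intervalIntegral.integral_of_le hR0.le]
      refine (setIntegral_congr_fun measurableSet_Ioi fun r (hr : 0 < r) => ?_).trans
        (setIntegral_eq_of_subset_of_forall_sdiff_eq_zero measurableSet_Ioi
          Ioc_subset_Ioi_self ?_)
      · have : ∀ n : S2, θ ‖r • (n : R3)‖ * ‖r • (n : R3)‖⁻¹ *
            inner ℝ (r • (n : R3)) e * g (r • (n : R3)) =
            θ r * (inner ℝ (n : R3) e * g (r • (n : R3))) := by
          intro n
          simp only [norm_smul, Real.norm_eq_abs, abs_of_pos hr, norm_sphere_coe, mul_one,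
            real_inner_smul_left]
          field_simp
        simp only [this, hA, integral_const_mul]
        ring
      · intro r hr
        rw [hR r (by by_contra h; exact hr.2 ⟨hr.1, by linarith⟩), zero_mul]
    rw [e1, e2] at ibp
    -- A second integration by parts, in r, moves the derivative from P back to k; the boundary
    -- terms vanish since k(R) = 0 and P(0) = 0.
    have ibp2 := intervalIntegral.integral_mul_deriv_eq_deriv_mul (a := 0) (b := R)
      (fun x _ => dk x) (fun x _ => dP x) (cθ.intervalIntegrable _ _) (cs.intervalIntegrable _ _)
    rw [kR R le_rfl, show P 0 = 0 by simp [hP]] at ibp2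
    rw [ibp2] at ibp
    have e3 : ∫ r, θ r • (P r - r ^ 2 * A r) = ∫ r in (0 : ℝ)..R, θ r • (P r - r ^ 2 * A r) := by
      rw [intervalIntegral.integral_of_le hR0.le, ← setIntegral_univ,
        setIntegral_eq_of_subset_of_forall_sdiff_eq_zero MeasurableSet.univ (subset_univ (Ioc 0 R))]
      intro r hr
      have : θ r = 0 := by
        by_cases h : r ≤ a
        · exact hθa r h
        · refine hR r (by by_contra h'; exact hr.2 ⟨by linarith, by linarith⟩)
      rw [this, zero_smul]
    rw [e3]
    simp only [smul_eq_mul, mul_sub]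
    rw [intervalIntegral.integral_sub ((by fun_prop : Continuous fun r => θ r * P r).intervalIntegrable _ _)
      ((by fun_prop : Continuous fun r => θ r * (r ^ 2 * A r)).intervalIntegrable _ _)]
    linarith
  have hae := isOpen_Ioi.ae_eq_zero_of_integral_contDiff_smul_eq_zero (μ := (volume : Measure ℝ))
    (f := fun r => P r - r ^ 2 * A r) (U := Ioi (0 : ℝ))
    ((by fun_prop : Continuous fun r => P r - r ^ 2 * A r).locallyIntegrable.locallyIntegrableOn _)
    weak
  have heq := Measure.eqOn_of_ae_eq (μ := (volume : Measure ℝ)) (s := Ioi (0 : ℝ))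
    (f := fun r => P r - r ^ 2 * A r) (g := fun _ => (0 : ℝ))
    ((ae_restrict_iff' measurableSet_Ioi).2 hae)
    (by fun_prop : Continuous fun r => P r - r ^ 2 * A r).continuousOn continuousOn_const
    (by rw [interior_Ioi]; exact subset_closure)
  have h1 := heq (show (1 : ℝ) ∈ Ioi (0 : ℝ) from mem_Ioi.2 one_pos)
  rw [setIntegral_ball_polar hg']
  simp only [one_pow, one_mul, sub_eq_zero, hA, one_smul, hP, hI] at h1
  exact h1

/-! ### The isotropic kernel and its symbol -/

/-- Divergence theorem on the unit ball, for vector fields given by their components. -/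
theorem integral_ball_divergence {F F' : Fin 3 → R3 → ℝ} (hF : ∀ l, ContDiff ℝ 1 (F l))
    (hF' : ∀ l y, HasDerivAt (fun s : ℝ => F l (y + s • EuclideanSpace.single l 1)) (F' l y) 0) :
    ∫ y in Metric.ball (0 : R3) 1, ∑ l, F' l y =
      ∫ n : S2, ∑ l, (n : R3) l * F l n ∂surfaceMeasure := by
  have h : ∀ l y, F' l y = fderiv ℝ (F l) y (EuclideanSpace.single l 1) := fun l y => by
    have h1 := (((hF l).differentiable one_ne_zero) y).hasFDerivAt.hasLineDerivAt
      (EuclideanSpace.single l 1)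
    exact (hF' l y).unique h1
  have hc : ∀ l, Continuous fun y => fderiv ℝ (F l) y (EuclideanSpace.single l 1) := fun l =>
    ((hF l).continuous_fderiv one_ne_zero).clm_apply continuous_const
  have hn : ∀ l, Continuous fun n : S2 => (n : R3) l * F l n := fun l => by
    have := (hF l).continuous
    fun_prop
  simp only [h]
  rw [integral_finsetSum _ fun l _ => ((hc l).continuousOn.integrableOn_compact
      (isCompact_closedBall 0 1)).mono_set Metric.ball_subset_closedBall,
    integral_finsetSum _ fun l _ => (hn l).integrable_of_hasCompactSupport
      (HasCompactSupport.of_compactSpace _)]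
  refine Finset.sum_congr rfl fun l _ => ?_
  rw [integral_ball_fderiv (hF l)]
  simp [EuclideanSpace.inner_single_right]

/-- The isotropic tensor `(A - b |y|²) δ_ij + b y_i y_j`. -/
def kernel (A b : ℝ) (i j : Fin 3) (y : R3) : ℝ :=
  (if i = j then A - b * ∑ m, y m ^ 2 else 0) + b * (y i * y j)

/-- The cosine transform of `kernel` restricted to the unit ball. -/
def symbol (A b : ℝ) (i j : Fin 3) (ξ : R3) : ℝ :=
  ∫ y in Metric.ball (0 : R3) 1, kernel A b i j y * Real.cos (2 * Real.pi * inner ℝ ξ y)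

/-- The value `symbol A b i i 0`. -/
def symbolMass (A b : ℝ) : ℝ := 4 * Real.pi / 3 * (A - 2 * b / 5)

theorem kernel_comm (A b : ℝ) (i j : Fin 3) (y : R3) : kernel A b i j y = kernel A b j i y := by
  simp only [kernel, eq_comm, mul_comm (y i)]

theorem symbol_comm (A b : ℝ) (i j : Fin 3) (ξ : R3) : symbol A b i j ξ = symbol A b j i ξ := by
  simp only [symbol, kernel_comm A b i j]

theorem contDiff_kernel (A b : ℝ) (i j : Fin 3) : ContDiff ℝ 1 (kernel A b i j) := by
  unfold kernel
  split_ifs <;> fun_prop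

theorem hasDerivAt_coord (y : R3) (l i : Fin 3) :
    HasDerivAt (fun s : ℝ => (y + s • EuclideanSpace.single l (1 : ℝ) : R3) i)
      (if i = l then 1 else 0) 0 := by
  simp only [PiLp.add_apply, PiLp.smul_apply, PiLp.single_apply, smul_eq_mul]
  simpa using ((hasDerivAt_id (0 : ℝ)).mul_const (if i = l then (1 : ℝ) else 0)).const_add (y i)

theorem hasDerivAt_sumsq (y : R3) (l : Fin 3) :
    HasDerivAt (fun s : ℝ => ∑ m, (y + s • EuclideanSpace.single l (1 : ℝ) : R3) m ^ 2)
      (2 * y l) 0 := by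
  have := HasDerivAt.fun_sum (u := Finset.univ) fun m _ => (hasDerivAt_coord y l m).fun_pow 2
  refine this.congr_deriv ?_
  simp

theorem hasDerivAt_kernel (A b : ℝ) (i j l : Fin 3) (y : R3) :
    HasDerivAt (fun s : ℝ => kernel A b i j (y + s • EuclideanSpace.single l (1 : ℝ)))
      ((if i = j then - (2 * b * y l) else 0) +
        b * ((if i = l then y j else 0) + (if j = l then y i else 0))) 0 := by
  unfold kernel
  refine HasDerivAt.fun_add ?_ ?_
  · split_ifs
    · exact (((hasDerivAt_sumsq y l).const_mul b).const_sub A).congr_deriv (by ring)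
    · exact hasDerivAt_const _ _
  · refine (((hasDerivAt_coord y l i).fun_mul (hasDerivAt_coord y l j)).const_mul b).congr_deriv ?_
    simp

theorem hasDerivAt_phase (ξ y : R3) (l : Fin 3) :
    HasDerivAt (fun s : ℝ => 2 * Real.pi * inner ℝ ξ (y + s • EuclideanSpace.single l (1 : ℝ)))
      (2 * Real.pi * ξ l) 0 := by
  simp only [inner_add_right, real_inner_smul_right, EuclideanSpace.inner_single_right]
  simpa using (((hasDerivAt_id (0 : ℝ)).mul_const (ξ l)).const_add (inner ℝ ξ y)).const_mul
    (2 * Real.pi)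

theorem hasDerivAt_sin_phase (ξ y : R3) (l : Fin 3) :
    HasDerivAt (fun s : ℝ =>
        Real.sin (2 * Real.pi * inner ℝ ξ (y + s • EuclideanSpace.single l (1 : ℝ))))
      (Real.cos (2 * Real.pi * inner ℝ ξ y) * (2 * Real.pi * ξ l)) 0 := by
  simpa using (hasDerivAt_phase ξ y l).sin

theorem contDiff_sin_phase (ξ : R3) :
    ContDiff ℝ 1 fun y : R3 => Real.sin (2 * Real.pi * inner ℝ ξ y) :=
  (contDiff_const.mul (contDiff_const.inner ℝ contDiff_id)).sin

theorem kernel_sphere (A b : ℝ) (i j : Fin 3) (n : S2) :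
    kernel A b i j n = (if i = j then A - b else 0) + b * ((n : R3) i * (n : R3) j) := by
  have : ∑ m, (n : R3) m ^ 2 = 1 := by
    rw [← EuclideanSpace.real_norm_sq_eq, norm_sphere_coe, one_pow]
  simp [kernel, this]

theorem sum_sq_sphere (n : S2) : ∑ m, (n : R3) m ^ 2 = 1 := by
  rw [← EuclideanSpace.real_norm_sq_eq, norm_sphere_coe, one_pow]

theorem integrableOn_ball_of_continuous {g : R3 → ℝ} (hg : Continuous g) :
    IntegrableOn g (Metric.ball (0 : R3) 1) :=
  (hg.continuousOn.integrableOn_compact (isCompact_closedBall 0 1)).mono_set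
    Metric.ball_subset_closedBall

theorem continuous_kernel_mul_cos (A b : ℝ) (i j : Fin 3) (ξ : R3) :
    Continuous fun y => kernel A b i j y * Real.cos (2 * Real.pi * inner ℝ ξ y) := by
  have := (contDiff_kernel A b i j).continuous
  fun_prop

/-- The flux of the kernel against a symmetric tensor is carried by the sphere. -/
theorem symbol_flux (A b : ℝ) (B : Fin 3 → Fin 3 → Fin 3 → ℝ)
    (h1 : ∀ l i j, B l i j = B i l j) (h2 : ∀ l i j, B l i j = B l j i) (ξ : R3) :
    ∑ l, ∑ i, ∑ j, B l i j * (2 * Real.pi * ξ l * symbol A b i j ξ) =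
      ∫ n : S2, (∑ l, ∑ i, ∑ j, B l i j * ((n : R3) l * kernel A b i j n)) *
        Real.sin (2 * Real.pi * inner ℝ ξ (n : R3)) ∂surfaceMeasure := by
  -- The field is B_lij φ_ij(y) sin(2π ξ·y). The derivative of the sine produces the cosine
  -- transform, and the derivative of φ is shown to contribute nothing.
  have hd := integral_ball_divergence
    (F := fun l y => (∑ i, ∑ j, B l i j * kernel A b i j y) *
      Real.sin (2 * Real.pi * inner ℝ ξ y))
    (F' := fun l y => (∑ i, ∑ j, B l i j * ((if i = j then - (2 * b * y l) else 0) +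
        b * ((if i = l then y j else 0) + (if j = l then y i else 0)))) *
      Real.sin (2 * Real.pi * inner ℝ ξ y) + (∑ i, ∑ j, B l i j * kernel A b i j y) *
        (Real.cos (2 * Real.pi * inner ℝ ξ y) * (2 * Real.pi * ξ l)))
    (fun l => by
      have := contDiff_kernel A b
      have := contDiff_sin_phase ξ
      fun_prop)
    (fun l y => by
      have := (HasDerivAt.fun_sum (u := Finset.univ) fun i _ =>
        HasDerivAt.fun_sum (u := Finset.univ) fun j _ =>
          (hasDerivAt_kernel A b i j l y).const_mul (B l i j)).fun_mul (hasDerivAt_sin_phase ξ y l)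
      simpa using this)
  have e1 : ∀ y : R3, ∑ l, ((∑ i, ∑ j, B l i j * ((if i = j then - (2 * b * y l) else 0) +
        b * ((if i = l then y j else 0) + (if j = l then y i else 0)))) *
      Real.sin (2 * Real.pi * inner ℝ ξ y) + (∑ i, ∑ j, B l i j * kernel A b i j y) *
        (Real.cos (2 * Real.pi * inner ℝ ξ y) * (2 * Real.pi * ξ l))) =
      ∑ l, ∑ i, ∑ j, B l i j * (2 * Real.pi * ξ l *
        (kernel A b i j y * Real.cos (2 * Real.pi * inner ℝ ξ y))) := by
    intro y
    -- Full symmetry of B makes its three traces equal, and their coefficients are -2b, b and b.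
    have z : ∑ l, (∑ i, ∑ j, B l i j * ((if i = j then - (2 * b * y l) else 0) +
        b * ((if i = l then y j else 0) + (if j = l then y i else 0)))) = 0 := by
      have a1 := h1 0 1 0
      have a2 := h1 0 1 1
      have a3 := h1 0 2 0
      have a4 := h1 0 2 2
      have a5 := h1 1 2 1
      have a6 := h1 1 2 2
      have b1 := h2 0 0 1
      have b2 := h2 0 0 2
      have b3 := h2 1 0 1
      have b4 := h2 1 1 2
      have b5 := h2 2 0 2
      have b6 := h2 2 1 2
      simp [Fin.sum_univ_three]
      grind
    rw [Finset.sum_add_distrib, ← Finset.sum_mul, z, zero_mul, zero_add]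
    refine Finset.sum_congr rfl fun l _ => ?_
    rw [Finset.sum_mul]
    refine Finset.sum_congr rfl fun i _ => ?_
    rw [Finset.sum_mul]
    refine Finset.sum_congr rfl fun j _ => ?_
    ring
  simp only [e1] at hd
  have ii : ∀ l i j, IntegrableOn (fun y => B l i j * (2 * Real.pi * ξ l *
        (kernel A b i j y * Real.cos (2 * Real.pi * inner ℝ ξ y)))) (Metric.ball (0 : R3) 1) :=
    fun l i j => integrableOn_ball_of_continuous (by
      have := continuous_kernel_mul_cos A b i j ξ
      fun_prop)
  rw [integral_finsetSum _ fun l _ => integrable_finsetSum _ fun i _ =>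
    integrable_finsetSum _ fun j _ => ii l i j] at hd
  simp_rw [integral_finsetSum Finset.univ fun i _ =>
    integrable_finsetSum Finset.univ fun j _ => ii _ i j] at hd
  simp_rw [integral_finsetSum Finset.univ fun j _ => ii _ _ j, integral_const_mul] at hd
  refine hd.trans (integral_congr_ae (ae_of_all _ fun n => ?_))
  simp only [Finset.sum_mul, Finset.mul_sum]
  refine Finset.sum_congr rfl fun l _ => Finset.sum_congr rfl fun i _ =>
    Finset.sum_congr rfl fun j _ => ?_
  ring

/-- The symbol maps the direction `ξ` to itself. -/
theorem symbol_orthogonal (A b : ℝ) (ξ w : R3) (h : ∑ i, ξ i * w i = 0) :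
    ∑ i, ∑ j, symbol A b i j ξ * (ξ i * w j) = 0 := by
  -- Inside the ball ∂_l φ_lj = 2b y_j is the gradient of b|y|². The correction (b - A - b|y|²) w
  -- makes the field without its sine both divergence-free and tangent to the sphere. It does not
  -- change the transform, because ξ·w = 0.
  have hd := integral_ball_divergence
    (F := fun l y => (∑ j, w j * kernel A b l j y + (b - A - b * ∑ m, y m ^ 2) * w l) *
      Real.sin (2 * Real.pi * inner ℝ ξ y))
    (F' := fun l y => (∑ j, w j * ((if l = j then - (2 * b * y l) else 0) +
        b * (y j + (if j = l then y l else 0))) +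
          (0 - b * (2 * y l)) * w l) *
      Real.sin (2 * Real.pi * inner ℝ ξ y) +
        (∑ j, w j * kernel A b l j y + (b - A - b * ∑ m, y m ^ 2) * w l) *
        (Real.cos (2 * Real.pi * inner ℝ ξ y) * (2 * Real.pi * ξ l)))
    (fun l => by
      have := contDiff_kernel A b
      have := contDiff_sin_phase ξ
      fun_prop)
    (fun l y => by
      have := ((HasDerivAt.fun_sum (u := Finset.univ) fun j _ =>
          (hasDerivAt_kernel A b l j l y).const_mul (w j)).fun_add
          ((((hasDerivAt_sumsq y l).const_mul b).const_sub (b - A)).mul_const (w l))).fun_mul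
          (hasDerivAt_sin_phase ξ y l)
      simpa using this)
  have e1 : ∀ y : R3, ∑ l, ((∑ j, w j * ((if l = j then - (2 * b * y l) else 0) +
        b * (y j + (if j = l then y l else 0))) +
          (0 - b * (2 * y l)) * w l) *
      Real.sin (2 * Real.pi * inner ℝ ξ y) +
        (∑ j, w j * kernel A b l j y + (b - A - b * ∑ m, y m ^ 2) * w l) *
        (Real.cos (2 * Real.pi * inner ℝ ξ y) * (2 * Real.pi * ξ l))) =
      ∑ i, ∑ j, 2 * Real.pi * (ξ i * w j) *
        (kernel A b i j y * Real.cos (2 * Real.pi * inner ℝ ξ y)) := by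
    intro y
    generalize Real.sin (2 * Real.pi * inner ℝ ξ y) = S
    generalize Real.cos (2 * Real.pi * inner ℝ ξ y) = C
    simp [Fin.sum_univ_three] at h ⊢
    linear_combination (b - A - b * (y 0 ^ 2 + y 1 ^ 2 + y 2 ^ 2)) * C * 2 * Real.pi * h
  simp only [e1] at hd
  have e2 : ∀ n : S2, ∑ l, (n : R3) l * ((∑ j, w j * kernel A b l j n +
      (b - A - b * ∑ m, (n : R3) m ^ 2) * w l) * Real.sin (2 * Real.pi * inner ℝ ξ (n : R3))) = 0 := by
    intro n
    have hn := sum_sq_sphere n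
    generalize Real.sin (2 * Real.pi * inner ℝ ξ (n : R3)) = S
    simp only [kernel_sphere, hn]
    simp [Fin.sum_univ_three] at hn ⊢
    linear_combination (S * b * (w 0 * (n : R3) 0 + w 1 * (n : R3) 1 + w 2 * (n : R3) 2)) * hn
  simp only [e2, integral_zero] at hd
  have ii : ∀ i j, IntegrableOn (fun y => 2 * Real.pi * (ξ i * w j) *
        (kernel A b i j y * Real.cos (2 * Real.pi * inner ℝ ξ y))) (Metric.ball (0 : R3) 1) :=
    fun i j => integrableOn_ball_of_continuous (by
      have := continuous_kernel_mul_cos A b i j ξ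
      fun_prop)
  rw [integral_finsetSum _ fun i _ => integrable_finsetSum _ fun j _ => ii i j] at hd
  simp_rw [integral_finsetSum Finset.univ fun j _ => ii _ j, integral_const_mul] at hd
  have hp : (2 * Real.pi) ≠ 0 := by positivity
  refine (mul_right_injective₀ hp) ?_
  simp only [mul_zero, Finset.mul_sum]
  rw [← hd]
  refine Finset.sum_congr rfl fun i _ => Finset.sum_congr rfl fun j _ => ?_
  rw [symbol]
  ring

theorem volume_real_unitBall : (volume : Measure R3).real (Metric.ball 0 1) = 4 * Real.pi / 3 := by
  rw [measureReal_def, EuclideanSpace.volume_ball_fin_three, ENNReal.toReal_mul, ENNReal.toReal_ofReal (by positivity)]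
  simp
  ring

/-- The deviation of φ from its mean over the ball is the divergence of a cubic field tangent to the
unit sphere, so no moment of the ball has to be computed. -/
theorem symbol_zero (A b : ℝ) (i j : Fin 3) :
    symbol A b i j 0 = if i = j then symbolMass A b else 0 := by
  have hd := integral_ball_divergence
    (F := fun l y => b / 5 * ((y i * y j) * y l - y j * (if i = l then 1 else 0)
      - (if i = j then 1 else 0) * ((∑ m, y m ^ 2 - 1) * y l)))
    (F' := fun l y => b / 5 * ((((if i = l then 1 else 0) * y j + y i * (if j = l then 1 else 0)) * y l
      + (y i * y j) * 1) - (if j = l then 1 else 0) * (if i = l then 1 else 0) -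
      (if i = j then 1 else 0) * ((2 * y l) * y l + (∑ m, y m ^ 2 - 1) * 1)))
    (fun l => by fun_prop)
    (fun l y => by
      have := (((((hasDerivAt_coord y l i).fun_mul (hasDerivAt_coord y l j)).fun_mul
        (hasDerivAt_coord y l l)).fun_sub
        ((hasDerivAt_coord y l j).mul_const (if i = l then (1 : ℝ) else 0))).fun_sub
        ((((hasDerivAt_sumsq y l).sub_const 1).fun_mul (hasDerivAt_coord y l l)).const_mul
          (if i = j then (1 : ℝ) else 0))).const_mul (b / 5)
      simpa using this)
  have e1 : ∀ y : R3, ∑ l, b / 5 * ((((if i = l then 1 else 0) * y j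
      + y i * (if j = l then 1 else 0)) * y l
      + (y i * y j) * 1) - (if j = l then 1 else 0) * (if i = l then 1 else 0) -
      (if i = j then 1 else 0) * ((2 * y l) * y l + (∑ m, y m ^ 2 - 1) * 1)) =
      kernel A b i j y - if i = j then A - 2 * b / 5 else 0 := by
    intro y
    unfold kernel
    fin_cases i <;> fin_cases j <;> simp [Fin.sum_univ_three] <;> ring
  have e2 : ∀ n : S2, ∑ l, (n : R3) l * (b / 5 * (((n : R3) i * (n : R3) j) * (n : R3) l
      - (n : R3) j * (if i = l then 1 else 0)
      - (if i = j then 1 else 0) * ((∑ m, (n : R3) m ^ 2 - 1) * (n : R3) l))) = 0 := by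
    intro n
    have hn := sum_sq_sphere n
    have : ∑ l, (n : R3) l * (b / 5 * (((n : R3) i * (n : R3) j) * (n : R3) l
      - (n : R3) j * (if i = l then 1 else 0)
      - (if i = j then 1 else 0) * ((∑ m, (n : R3) m ^ 2 - 1) * (n : R3) l))) =
      b / 5 * ((n : R3) i * (n : R3) j * (∑ m, (n : R3) m ^ 2) - (n : R3) i * (n : R3) j) := by
      rw [hn]
      fin_cases i <;> fin_cases j <;> simp [Fin.sum_univ_three] at hn ⊢ <;> grind
    rw [this, hn]
    ring
  simp only [e1, e2, integral_zero] at hd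
  rw [integral_sub (integrableOn_ball_of_continuous (contDiff_kernel A b i j).continuous)
    (integrableOn_ball_of_continuous continuous_const), setIntegral_const, volume_real_unitBall]
    at hd
  have : symbol A b i j 0 = ∫ y in Metric.ball (0 : R3) 1, kernel A b i j y := by simp [symbol]
  rw [this, sub_eq_zero.1 hd]
  split_ifs <;> simp [symbolMass]

/-! ### Size of the symbol near the origin and at infinity. -/

/-- A bound for the kernel on the unit ball. -/
def kernelBound (A b : ℝ) : ℝ := |A| + 2 * |b|

theorem abs_coord_le {y : R3} (hy : ‖y‖ ≤ 1) (i : Fin 3) : |y i| ≤ 1 :=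
  (PiLp.norm_apply_le y i).trans hy

theorem abs_kernel_le (A b : ℝ) (i j : Fin 3) {y : R3} (hy : ‖y‖ ≤ 1) :
    |kernel A b i j y| ≤ kernelBound A b := by
  have hs : ∑ m, y m ^ 2 = ‖y‖ ^ 2 := (EuclideanSpace.real_norm_sq_eq y).symm
  have h1 : |b * ‖y‖ ^ 2| ≤ |b| := by
    rw [abs_mul, abs_pow, abs_norm]
    exact mul_le_of_le_one_right (abs_nonneg _) (pow_le_one₀ (norm_nonneg _) hy)
  have h2 : |b * (y i * y j)| ≤ |b| := by
    rw [abs_mul, abs_mul]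
    exact mul_le_of_le_one_right (abs_nonneg _)
      (mul_le_one₀ (abs_coord_le hy i) (abs_nonneg _) (abs_coord_le hy j))
  have h3 : |if i = j then A - b * ∑ m, y m ^ 2 else 0| ≤ |A| + |b| := by
    rw [hs]
    split_ifs
    · exact (abs_sub _ _).trans (by gcongr)
    · simp; positivity
  unfold kernel kernelBound
  exact (abs_add_le _ _).trans (by linarith)

theorem abs_setIntegral_ball_le {g : R3 → ℝ} {C : ℝ} (h : ∀ y, ‖y‖ ≤ 1 → |g y| ≤ C) :
    |∫ y in Metric.ball (0 : R3) 1, g y| ≤ C * (4 * Real.pi / 3) := by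
  rw [← volume_real_unitBall, ← Real.norm_eq_abs]
  refine norm_setIntegral_le_of_norm_le_const (μ := (volume : Measure R3))
    measure_ball_lt_top fun y hy => ?_
  exact h y (by simpa using (mem_ball_zero_iff.1 hy).le)

theorem kernelBound_nonneg (A b : ℝ) : 0 ≤ kernelBound A b := by
  unfold kernelBound; positivity

/-- A bound for `symbol`, and a Lipschitz-type constant at the origin. -/
def symbolBound (A b : ℝ) : ℝ := kernelBound A b * (2 * Real.pi) * (4 * Real.pi / 3)

/-- The difference |cos a - cos 0| is at most 2 and at most |a| ≤ 2π‖ξ‖; the factor 2π in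
`symbolBound` serves for both. -/
theorem abs_symbol_sub_zero_le (A b : ℝ) (i j : Fin 3) (ξ : R3) :
    |symbol A b i j ξ - if i = j then symbolMass A b else 0| ≤ symbolBound A b * min 1 ‖ξ‖ := by
  rw [← symbol_zero]
  unfold symbol
  rw [← integral_sub (integrableOn_ball_of_continuous (continuous_kernel_mul_cos ..))
    (integrableOn_ball_of_continuous (continuous_kernel_mul_cos ..))]
  have := abs_setIntegral_ball_le (C := kernelBound A b * (2 * Real.pi) * min 1 ‖ξ‖)
    (g := fun y => kernel A b i j y * Real.cos (2 * Real.pi * inner ℝ ξ y) -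
      kernel A b i j y * Real.cos (2 * Real.pi * inner ℝ 0 y)) ?_
  · refine this.trans (le_of_eq ?_)
    unfold symbolBound; ring
  · intro y hy
    rw [← mul_sub, abs_mul, mul_assoc (kernelBound A b)]
    refine mul_le_mul (abs_kernel_le A b i j hy) ?_ (abs_nonneg _) (kernelBound_nonneg A b)
    rw [mul_min_of_nonneg _ _ (by positivity)]
    refine le_min ?_ ?_
    · refine (abs_sub _ _).trans ?_
      have := Real.abs_cos_le_one (2 * Real.pi * inner ℝ ξ y)
      have := Real.abs_cos_le_one (2 * Real.pi * inner ℝ 0 y)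
      linarith [Real.two_le_pi]
    · refine (Real.abs_cos_sub_cos_le _ _).trans ?_
      rw [inner_zero_left, mul_zero, sub_zero, abs_mul, abs_of_pos (by positivity)]
      gcongr
      exact (abs_real_inner_le_norm ξ y).trans (mul_le_of_le_one_right (norm_nonneg _) hy)

theorem abs_symbol_le (A b : ℝ) (i j : Fin 3) (ξ : R3) :
    |symbol A b i j ξ| ≤ symbolBound A b := by
  refine (abs_setIntegral_ball_le (C := kernelBound A b) fun y hy => ?_).trans ?_
  · rw [abs_mul]
    exact (mul_le_of_le_one_right (abs_nonneg _) (Real.abs_cos_le_one _)).trans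
      (abs_kernel_le A b i j hy)
  · unfold symbolBound
    have := kernelBound_nonneg A b
    gcongr
    exact le_mul_of_one_le_right this (by linarith [Real.two_le_pi])

/-- Riemann–Lebesgue lemma for the symbol. -/
theorem tendsto_symbol (A b : ℝ) (i j : Fin 3) :
    Tendsto (symbol A b i j) (cocompact R3) (𝓝 0) := by
  -- The symbol is the real part of the Fourier transform of the kernel times the indicator of the
  -- ball. No rate of decay is needed later.
  have h := tendsto_integral_exp_inner_smul_cocompact (V := R3) (E := ℂ)
    (fun y => (Metric.ball (0 : R3) 1).indicator (fun y => ((kernel A b i j y : ℝ) : ℂ)) y)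
  have h2 := (Complex.continuous_re.tendsto 0).comp h
  simp only [Complex.zero_re] at h2
  refine h2.congr fun ξ => ?_
  have e : ∀ y : R3, Real.fourierChar (-inner ℝ y ξ) •
      (Metric.ball (0 : R3) 1).indicator (fun y => ((kernel A b i j y : ℝ) : ℂ)) y =
      (Metric.ball (0 : R3) 1).indicator (fun y => Real.fourierChar (-inner ℝ y ξ) •
        ((kernel A b i j y : ℝ) : ℂ)) y := fun y => by
    by_cases hy : y ∈ Metric.ball (0 : R3) 1 <;> simp [indicator, hy]
  simp only [Function.comp_apply, e]
  rw [integral_indicator measurableSet_ball]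
  have hc : Continuous fun y : R3 => Real.fourierChar (-inner ℝ y ξ) •
        ((kernel A b i j y : ℝ) : ℂ) := by
    have := (contDiff_kernel A b i j).continuous
    have := Real.continuous_fourierChar
    simp only [Circle.smul_def]
    fun_prop
  have hi : IntegrableOn (fun y : R3 => Real.fourierChar (-inner ℝ y ξ) •
        ((kernel A b i j y : ℝ) : ℂ)) (Metric.ball 0 1) :=
    (hc.continuousOn.integrableOn_compact (isCompact_closedBall 0 1)).mono_set
      Metric.ball_subset_closedBall
  have := (integral_re hi).symm
  simp only [RCLike.re_eq_complex_re] at this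
  rw [this, symbol]
  refine setIntegral_congr_fun measurableSet_ball fun y _ => ?_
  simp only [Circle.smul_def, Real.fourierChar_apply, smul_eq_mul, Complex.re_mul_ofReal,
    Complex.exp_ofReal_mul_I_re, real_inner_comm y ξ]
  rw [mul_neg, Real.cos_neg, mul_comm]

open scoped ComplexConjugate

open UnitAddTorus (mFourier mFourierCoeff)

/-! ### Fourier analysis on the torus -/

/-- Frequencies. -/
abbrev Z3 : Type := Fin 3 → ℤ

/-- Fourier coefficients of a real function on the torus. -/
def coef (a : T3 → ℝ) (k : Z3) : ℂ := mFourierCoeff (fun x => ((a x : ℝ) : ℂ)) k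

theorem measureSpace_circle_eq :
    (⟨AddCircle.haarAddCircle⟩ : MeasureSpace UnitAddCircle) = AddCircle.measureSpace 1 := by
  have : (AddCircle.measureSpace (1 : ℝ)).volume = AddCircle.haarAddCircle := by
    have := AddCircle.volume_eq_smul_haarAddCircle (T := (1 : ℝ))
    simpa using this
  exact congrArg (@MeasureSpace.mk UnitAddCircle inferInstance) this.symm

/-- The Fourier basis is built over the normalised Haar measure of the circle, the structure
functions over Lebesgue measure on ℝ/ℤ. At period 1 they coincide, and Parseval's identity is
transported along this equality. -/
theorem volume_torus_eq : (volume : Measure T3) =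
    @volume T3 (@MeasureSpace.pi (Fin 3) _ (fun _ => UnitAddCircle)
      fun _ => ⟨AddCircle.haarAddCircle⟩) := by
  have h := measureSpace_circle_eq
  have h2 : (volume : Measure UnitAddCircle) = AddCircle.haarAddCircle := by
    have := AddCircle.volume_eq_smul_haarAddCircle (T := (1 : ℝ))
    simpa using this
  change Measure.pi (fun _ => (volume : Measure UnitAddCircle)) =
    Measure.pi (fun _ => AddCircle.haarAddCircle)
  rw [h2]

instance : IsProbabilityMeasure (volume : Measure T3) := by
  constructor
  simp [volume_pi, Measure.pi_univ]

theorem mFourierCoeff_eq (f : T3 → ℂ) (k : Z3) :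
    mFourierCoeff f k = ∫ x : T3, mFourier (-k) x * f x := by
  rw [volume_torus_eq]; rfl

theorem hasSum_parseval {f g : T3 → ℂ} (hf : MemLp f 2 volume) (hg : MemLp g 2 volume) :
    HasSum (fun k : Z3 => conj (mFourierCoeff f k) * mFourierCoeff g k)
      (∫ x : T3, conj (f x) * g x) := by
  rw [volume_torus_eq] at hf hg ⊢
  have h := UnitAddTorus.hasSum_prod_mFourierCoeff (hf.toLp f) (hg.toLp g)
  have e : ∀ {f : T3 → ℂ} (hf : MemLp f 2 _) (k : Z3),
      mFourierCoeff (hf.toLp f) k = mFourierCoeff f k := fun hf k =>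
    integral_congr_ae (by filter_upwards [hf.coeFn_toLp] with x hx; rw [hx])
  simp only [e hf, e hg] at h
  convert h using 1
  refine integral_congr_ae ?_
  filter_upwards [hf.coeFn_toLp, hg.coeFn_toLp] with x h1 h2
  rw [h1, h2]

theorem mFourier_add_right (k : Z3) (x y : T3) :
    mFourier k (x + y) = mFourier k x * mFourier k y := by
  simp only [mFourier, ContinuousMap.coe_mk, Pi.add_apply, fourier_apply,
    smul_add, AddCircle.toCircle_add, Circle.coe_mul, Finset.prod_mul_distrib]

theorem mFourier_toTorus (k : Z3) (h : R3) :
    mFourier k (toTorus h) = Complex.exp (((2 * Real.pi * ∑ i, (k i : ℝ) * h i : ℝ) : ℂ) * Complex.I) := by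
  simp only [mFourier, ContinuousMap.coe_mk, toTorus, fourier_coe_apply]
  rw [← Complex.exp_sum]
  congr 1
  push_cast
  simp only [Finset.mul_sum, Finset.sum_mul]
  refine Finset.sum_congr rfl fun i _ => ?_
  simp
  ring

theorem norm_mFourier_apply (k : Z3) (x : T3) : ‖mFourier k x‖ = 1 := by
  simp only [mFourier, ContinuousMap.coe_mk, norm_prod, fourier_apply, Circle.norm_coe,
    Finset.prod_const_one]

theorem conj_mFourier (k : Z3) (x : T3) : conj (mFourier k x) = mFourier (-k) x :=
  UnitAddTorus.mFourier_neg.symm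

theorem aestronglyMeasurable_mFourier (k : Z3) :
    AEStronglyMeasurable (fun x : T3 => mFourier k x) volume :=
  (mFourier k).continuous.aestronglyMeasurable

theorem coef_eq (a : T3 → ℝ) (k : Z3) : coef a k = ∫ x, mFourier (-k) x * (a x : ℂ) :=
  mFourierCoeff_eq _ _

theorem conj_coef (a : T3 → ℝ) (k : Z3) : conj (coef a k) = coef a (-k) := by
  rw [coef_eq, coef_eq, ← integral_conj]
  simp [conj_mFourier]

theorem coef_congr {a b : T3 → ℝ} (h : a =ᵐ[volume] b) (k : Z3) : coef a k = coef b k := by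
  rw [coef_eq, coef_eq]
  refine integral_congr_ae ?_
  filter_upwards [h] with x hx
  rw [hx]

theorem integrable_ofReal {α : Type*} [MeasurableSpace α] {μ : Measure α} {a : α → ℝ}
    (ha : Integrable a μ) : Integrable (fun x => ((a x : ℝ) : ℂ)) μ := ha.ofReal

theorem memLp_ofReal {a : T3 → ℝ} {p : ℝ≥0∞} (ha : MemLp a p volume) :
    MemLp (fun x => ((a x : ℝ) : ℂ)) p volume := ha.ofReal

theorem integrable_mFourier_mul {f : T3 → ℂ} (hf : Integrable f) (k : Z3) :
    Integrable fun x => mFourier k x * f x :=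
  hf.bdd_mul (c := 1) (aestronglyMeasurable_mFourier k)
    (ae_of_all _ fun x => (norm_mFourier_apply k x).le)

theorem coef_sum {ι : Type*} (s : Finset ι) {a : ι → T3 → ℝ} (ha : ∀ i, Integrable (a i)) (k : Z3) :
    coef (fun x => ∑ i ∈ s, a i x) k = ∑ i ∈ s, coef (a i) k := by
  simp only [coef_eq]
  rw [← integral_finsetSum _ fun i _ => integrable_mFourier_mul (integrable_ofReal (ha i)) _]
  simp [Finset.mul_sum]

theorem norm_coef_le {a : T3 → ℝ} (k : Z3) : ‖coef a k‖ ≤ ∫ x, ‖a x‖ := by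
  rw [coef_eq]
  refine (norm_integral_le_integral_norm _).trans (le_of_eq ?_)
  simp [norm_mFourier_apply]

theorem hasSum_coef_mul_conj {a b : T3 → ℝ} (ha : MemLp a 2 volume) (hb : MemLp b 2 volume) :
    HasSum (fun k => coef a k * conj (coef b k)) ((∫ x, a x * b x : ℝ) : ℂ) := by
  have h := hasSum_parseval (memLp_ofReal hb) (memLp_ofReal ha)
  convert h using 1
  · funext k
    rw [mul_comm]
    rfl
  · refine integral_complex_ofReal.symm.trans ?_
    simp [mul_comm]

theorem coef_translate (a : T3 → ℝ) (y : T3) (k : Z3) :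
    coef (fun x => a (x + y)) k = mFourier k y * coef a k := by
  simp only [coef_eq]
  rw [← integral_add_right_eq_self (fun x => mFourier (-k) x * (a x : ℂ)) y, ← integral_const_mul]
  refine integral_congr_ae (ae_of_all _ fun x => ?_)
  simp only [mFourier_add_right]
  have : mFourier k y * mFourier (-k) y = 1 := by
    rw [← conj_mFourier, Complex.mul_conj, Complex.normSq_eq_norm_sq, norm_mFourier_apply]; simp
  linear_combination (- mFourier (-k) x * (a (x + y) : ℂ)) * this

theorem measurePreserving_translate (y : T3) :
    MeasurePreserving (fun x : T3 => x + y) volume volume :=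
  measurePreserving_add_right volume y

theorem memLp_translate {a : T3 → ℝ} {p : ℝ≥0∞} (ha : MemLp a p volume) (y : T3) :
    MemLp (fun x => a (x + y)) p volume :=
  ha.comp_measurePreserving (measurePreserving_translate y)

theorem hasSum_correlation {a b : T3 → ℝ} (ha : MemLp a 2 volume) (hb : MemLp b 2 volume) (y : T3) :
    HasSum (fun k => mFourier k y * (coef a k * conj (coef b k)))
      ((∫ x, a (x + y) * b x : ℝ) : ℂ) := by
  have h := hasSum_coef_mul_conj (memLp_translate ha y) hb
  simp only [coef_translate, mul_assoc] at h
  exact h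

/-- Parseval's identity for a and e_k b: since b is real, the m-th coefficient of e_k b is the
conjugate of `coef b (k - m)`. -/
theorem hasSum_convolution {a b : T3 → ℝ} (ha : MemLp a 2 volume) (hb : MemLp b 2 volume) (k : Z3) :
    HasSum (fun m => coef a m * coef b (k - m)) (coef (fun x => a x * b x) k) := by
  have hb' : MemLp (fun x => mFourier k x * (b x : ℂ)) 2 volume := by
    refine (memLp_ofReal hb).of_le ((aestronglyMeasurable_mFourier k).mul (memLp_ofReal hb).1)
      (ae_of_all _ fun x => ?_)
    rw [norm_mul, norm_mFourier_apply, one_mul]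
  have h := hasSum_parseval hb' (memLp_ofReal ha)
  have e : ∀ m, mFourierCoeff (fun x => mFourier k x * (b x : ℂ)) m = conj (coef b (k - m)) := by
    intro m
    rw [mFourierCoeff_eq, conj_coef, coef_eq]
    refine integral_congr_ae (ae_of_all _ fun x => ?_)
    dsimp only
    rw [← mul_assoc, ← UnitAddTorus.mFourier_add]
    congr 3
    abel
  simp only [e, Complex.conj_conj] at h
  convert h using 1
  · funext m
    rw [mul_comm]
    rfl
  rw [coef_eq]
  refine integral_congr_ae (ae_of_all _ fun x => ?_)
  simp only [map_mul, conj_mFourier, Complex.conj_ofReal, Complex.ofReal_mul]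
  ring

/-- Parseval's identity in `[0,∞]`. -/
theorem tsum_enorm_coef_sq {a : T3 → ℝ} (ha : MemLp a 2 volume) :
    ∑' k, ‖coef a k‖ₑ ^ 2 = ∫⁻ x, ‖a x‖ₑ ^ 2 := by
  have h := hasSum_coef_mul_conj ha ha
  have h1 : HasSum (fun k => ‖coef a k‖ ^ 2) (∫ x, a x * a x) := by
    have := (Complex.hasSum_iff _ _).1 h
    convert this.1 using 2
    · rw [Complex.mul_conj, Complex.normSq_eq_norm_sq, Complex.ofReal_re]
    · rfl
  have h2 := h1.summable.hasSum.unique h1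
  have e : ∀ k, ‖coef a k‖ₑ ^ 2 = ENNReal.ofReal (‖coef a k‖ ^ 2) := fun k => by
    rw [ENNReal.ofReal_pow (norm_nonneg _), ofReal_norm]
  simp only [e]
  rw [← ENNReal.ofReal_tsum_of_nonneg (fun k => by positivity) h1.summable, h1.tsum_eq]
  rw [ofReal_integral_eq_lintegral_ofReal (f := fun x => a x * a x) (ha.integrable_mul ha)
    (ae_of_all _ fun x => mul_self_nonneg _)]
  refine lintegral_congr fun x => ?_
  rw [← ofReal_norm, ← ENNReal.ofReal_pow (norm_nonneg _), Real.norm_eq_abs, sq_abs, sq]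

/-- Uniqueness of Fourier coefficients for integrable functions. -/
theorem ae_eq_zero_of_mFourierCoeff {f : T3 → ℂ} (hf : Integrable f)
    (h : ∀ k, mFourierCoeff f k = 0) : f =ᵐ[volume] 0 := by
  have hφ : ∀ φ : C(T3, ℂ), ∫ x, φ x * f x = 0 := by
    have hi : ∀ φ : C(T3, ℂ), Integrable fun x => φ x * f x := fun φ =>
      hf.bdd_mul (c := ‖φ‖) φ.continuous.aestronglyMeasurable
        (ae_of_all _ fun x => φ.norm_coe_le_norm x)
    have hcont : Continuous fun φ : C(T3, ℂ) => ∫ x, φ x * f x := by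
      refine LipschitzWith.continuous (K := Real.toNNReal (∫ x, ‖f x‖))
        (LipschitzWith.of_dist_le_mul fun φ ψ => ?_)
      rw [dist_eq_norm, ← integral_sub (hi φ) (hi ψ), dist_eq_norm]
      refine (norm_integral_le_integral_norm _).trans ?_
      rw [Real.coe_toNNReal _ (integral_nonneg fun _ => norm_nonneg _), ← integral_mul_const]
      refine integral_mono_of_nonneg (ae_of_all _ fun _ => norm_nonneg _)
        (hf.norm.mul_const _) (ae_of_all _ fun x => ?_)
      dsimp only
      rw [← sub_mul, norm_mul, mul_comm]
      gcongr
      exact (φ - ψ).norm_coe_le_norm x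
    -- The annihilator of f among continuous functions is a closed subspace containing all
    -- characters, hence everything by density of trigonometric polynomials.
    let S : Submodule ℂ C(T3, ℂ) :=
      { carrier := {φ | ∫ x, φ x * f x = 0}
        add_mem' := fun {φ ψ} h1 h2 => by
          simp only [mem_ofPred_eq, ContinuousMap.add_apply, add_mul] at h1 h2 ⊢
          rw [integral_add (hi φ) (hi ψ), h1, h2, add_zero]
        zero_mem' := by simp
        smul_mem' := fun c φ h1 => by
          simp only [mem_ofPred_eq, ContinuousMap.smul_apply, smul_eq_mul, mul_assoc] at h1 ⊢
          rw [integral_const_mul, h1, mul_zero] }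
    have hS : IsClosed (S : Set C(T3, ℂ)) := isClosed_eq hcont continuous_const
    have hspan : Submodule.span ℂ (range (mFourier (d := Fin 3))) ≤ S := by
      rw [Submodule.span_le]
      rintro _ ⟨k, rfl⟩
      have := h (-k)
      rw [mFourierCoeff_eq, neg_neg] at this
      exact this
    have htop := Submodule.topologicalClosure_minimal _ hspan hS
    rw [UnitAddTorus.span_mFourier_closure_eq_top] at htop
    exact fun φ => htop (Submodule.mem_top (x := φ))
  -- Integrals over closed sets determine f; thickened indicators approximate the indicator of a
  -- closed set by continuous functions.
  refine ae_eq_zero_of_forall_setIntegral_isClosed_eq_zero hf fun s hs => ?_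
  have hδ : ∀ n : ℕ, (0 : ℝ) < 1 / ((n : ℝ) + 1) := fun n => by positivity
  have ht := thickenedIndicator_tendsto_indicator_closure hδ
    tendsto_one_div_add_atTop_nhds_zero_nat s
  rw [hs.closure_eq] at ht
  have hlim : Tendsto (fun n : ℕ => ∫ x, ((thickenedIndicator (hδ n) s x : ℝ) : ℂ) * f x) atTop
      (𝓝 (∫ x, s.indicator f x)) := by
    refine tendsto_integral_of_dominated_convergence (fun x => ‖f x‖) (fun n => ?_) hf.norm
      (fun n => ae_of_all _ fun x => ?_) (ae_of_all _ fun x => ?_)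
    · have : Continuous fun x => ((thickenedIndicator (hδ n) s x : ℝ) : ℂ) :=
        Complex.continuous_ofReal.comp
          (NNReal.continuous_coe.comp (thickenedIndicator (hδ n) s).continuous)
      exact this.aestronglyMeasurable.mul hf.1
    · rw [norm_mul, Complex.norm_real, Real.norm_eq_abs, abs_of_nonneg (NNReal.coe_nonneg _)]
      exact mul_le_of_le_one_left (norm_nonneg _)
        (NNReal.coe_le_one.2 (thickenedIndicator_le_one (hδ n) s x))
    · have h1 := (tendsto_pi_nhds.1 ht) x
      have h2 : Tendsto (fun n : ℕ => ((thickenedIndicator (hδ n) s x : ℝ) : ℂ) * f x) atTop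
          (𝓝 ((((s.indicator (fun _ => (1 : NNReal)) x : NNReal) : ℝ) : ℂ) * f x)) :=
        ((Complex.continuous_ofReal.tendsto _).comp
          ((NNReal.continuous_coe.tendsto _).comp h1)).mul_const _
      convert h2 using 2
      by_cases hx : x ∈ s <;> simp [hx]
  have hz : ∀ n : ℕ, ∫ x, ((thickenedIndicator (hδ n) s x : ℝ) : ℂ) * f x = 0 := fun n =>
    hφ ⟨fun x => ((thickenedIndicator (hδ n) s x : ℝ) : ℂ), Complex.continuous_ofReal.comp
          (NNReal.continuous_coe.comp (thickenedIndicator (hδ n) s).continuous)⟩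
  simp only [hz] at hlim
  rw [← integral_indicator hs.measurableSet]
  exact (tendsto_nhds_unique hlim tendsto_const_nhds)

/-- Riesz–Fischer supplies an L² function with the same coefficients, and uniqueness for integrable
functions identifies it with a. This shows that a product, known at first only to be integrable,
lies in L². -/
theorem memLp_two_of_coef {a : T3 → ℝ} (ha : Integrable a)
    (h : ∑' k, ‖coef a k‖ₑ ^ 2 < ⊤) : MemLp a 2 volume := by
  have hs : Memℓp (fun k => coef a k) 2 := by
    refine memℓp_gen ?_
    have : Summable fun k => (ENNReal.toReal (‖coef a k‖ₑ ^ 2)) := ENNReal.summable_toReal h.ne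
    simpa using this
  let c : lp (fun _ : Z3 => ℂ) 2 := ⟨fun k => coef a k, hs⟩
  have hv := volume_torus_eq
  let W := (UnitAddTorus.mFourierBasis (d := Fin 3)).repr.symm c
  have hW : ∀ k, mFourierCoeff W k = coef a k := fun k => by
    rw [← UnitAddTorus.mFourierBasis_repr]
    simp [W, c]
  have hWm : MemLp (W : T3 → ℂ) 2 volume := by
    rw [volume_torus_eq]; exact Lp.memLp W
  have hWi : Integrable (W : T3 → ℂ) := hWm.integrable (by norm_num)
  have h0 := ae_eq_zero_of_mFourierCoeff (f := fun x => (a x : ℂ) - W x)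
    ((integrable_ofReal ha).sub hWi) (fun k => by
      have h1 : mFourierCoeff (fun x => (a x : ℂ) - W x) k = coef a k - mFourierCoeff W k := by
        rw [coef, mFourierCoeff_eq, mFourierCoeff_eq, mFourierCoeff_eq,
          ← integral_sub (integrable_mFourier_mul (integrable_ofReal ha) _) (integrable_mFourier_mul hWi _)]
        simp [mul_sub]
      rw [h1, hW, sub_self])
  have : MemLp (fun x => ((a x : ℝ) : ℂ)) 2 volume := by
    refine (memLp_congr_ae ?_).1 hWm
    filter_upwards [h0] with x hx
    simp only [Pi.zero_apply, sub_eq_zero] at hx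
    exact hx.symm
  simpa using this.re

/-! ### Products of Sobolev functions -/

theorem lintegral_mul_sq_le {α : Type*} [MeasurableSpace α] {μ : Measure α} {f g : α → ℝ≥0∞}
    (hf : AEMeasurable f μ) (hg : AEMeasurable g μ) :
    (∫⁻ x, f x * g x ∂μ) ^ 2 ≤ (∫⁻ x, f x ^ 2 ∂μ) * ∫⁻ x, g x ^ 2 ∂μ := by
  have h := ENNReal.lintegral_mul_le_Lp_mul_Lq μ Real.HolderConjugate.two_two hf hg
  have h2 := ENNReal.rpow_le_rpow h (z := 2) (by norm_num)
  rw [ENNReal.mul_rpow_of_nonneg _ _ (by norm_num), ← ENNReal.rpow_mul, ← ENNReal.rpow_mul] at h2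
  simpa using h2

theorem tsum_mul_sq_le {ι : Type*} (f g : ι → ℝ≥0∞) :
    (∑' i, f i * g i) ^ 2 ≤ (∑' i, f i ^ 2) * ∑' i, g i ^ 2 := by
  let _ : MeasurableSpace ι := ⊤
  have h := lintegral_mul_sq_le (μ := Measure.count) (f := f) (g := g)
    measurable_from_top.aemeasurable measurable_from_top.aemeasurable
  simpa only [lintegral_count] using h

/-- Young's inequality `ℓ¹ * ℓ² ⊆ ℓ²`. -/
theorem tsum_conv_sq_le (p q : Z3 → ℝ≥0∞) :
    ∑' k, (∑' m, p m * q (k - m)) ^ 2 ≤ (∑' m, p m) ^ 2 * ∑' k, q k ^ 2 := by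
  -- Cauchy–Schwarz with p written as √p · √p.
  have h : ∀ k, (∑' m, p m * q (k - m)) ^ 2 ≤ (∑' m, p m) * ∑' m, p m * q (k - m) ^ 2 := by
    intro k
    have := tsum_mul_sq_le (fun m => p m ^ (1 / 2 : ℝ)) (fun m => p m ^ (1 / 2 : ℝ) * q (k - m))
    have e : ∀ m, (p m ^ (1 / 2 : ℝ)) ^ 2 = p m := fun m => by
      rw [← ENNReal.rpow_natCast, ← ENNReal.rpow_mul]; simp
    simp only [← mul_assoc, ← sq, mul_pow, e] at this
    exact this
  calc ∑' k, (∑' m, p m * q (k - m)) ^ 2 ≤ ∑' k, (∑' m, p m) * ∑' m, p m * q (k - m) ^ 2 :=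
        ENNReal.tsum_le_tsum h
    _ = (∑' m, p m) * ∑' m, p m * ∑' k, q (k - m) ^ 2 := by
        rw [ENNReal.tsum_mul_left, ENNReal.tsum_comm]
        simp only [ENNReal.tsum_mul_left]
    _ = _ := by
        have : ∀ m, ∑' k, q (k - m) ^ 2 = ∑' k, q k ^ 2 := fun m =>
          (Equiv.subRight m).tsum_eq (fun k => q k ^ 2)
        simp only [this, ENNReal.tsum_mul_right]
        ring

/-- `1 + |k|²`. -/
def bracket (k : Z3) : ℝ := 1 + ∑ i, (k i : ℝ) ^ 2

theorem one_le_bracket (k : Z3) : 1 ≤ bracket k := by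
  unfold bracket
  have : 0 ≤ ∑ i, (k i : ℝ) ^ 2 := Finset.sum_nonneg fun i _ => sq_nonneg _
  linarith

theorem bracket_pos (k : Z3) : 0 < bracket k := lt_of_lt_of_le one_pos (one_le_bracket k)

/-- Convergence holds because the exponent 4 exceeds the rank 3 of the lattice. -/
theorem summable_bracket : Summable fun k : Z3 => (bracket k ^ 2)⁻¹ := by
  let L : Submodule ℤ (Fin 3 → ℝ) := Submodule.span ℤ (range (Pi.basisFun ℝ (Fin 3)))
  have hr : Module.finrank ℤ L = 3 := by
    rw [ZLattice.rank ℝ L]; simp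
  have hs := ZLattice.summable_norm_pow_inv L 4 (by rw [hr]; norm_num)
  have hm : ∀ k : Z3, (fun i => (k i : ℝ)) ∈ L := fun k => by
    rw [(Pi.basisFun ℝ (Fin 3)).mem_span_iff_repr_mem ℤ]
    intro i
    exact ⟨k i, by simp⟩
  let g : Z3 → L := fun k => ⟨fun i => (k i : ℝ), hm k⟩
  have hg : Function.Injective g := fun k m h => by
    funext i
    have := congrFun (congrArg Subtype.val h) i
    simpa [g] using this
  have hs2 := hs.comp_injective hg
  -- The summand added at k = 0 compensates the convention 0⁻¹ = 0, under which the lattice series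
  -- has no contribution there.
  refine (hs2.add (summable_of_hasFiniteSupport (f := fun k : Z3 => if k = 0 then (1 : ℝ) else 0)
    ((finite_singleton (0 : Z3)).subset fun k hk => by simpa using hk))).of_nonneg_of_le
    (fun k => by positivity) fun k => ?_
  by_cases hk : k = 0
  · simp [hk, bracket, g]
  · simp only [Function.comp_apply, hk, if_false, add_zero]
    have hpos : 0 < ‖g k‖ := by
      rw [norm_pos_iff]
      intro h
      exact hk (hg (by rw [h]; ext i; simp [g]))
    have hle : ‖g k‖ ^ 2 ≤ bracket k := by
      have h1 : ‖g k‖ ≤ √(∑ i, (k i : ℝ) ^ 2) := by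
        change ‖(fun i => (k i : ℝ))‖ ≤ _
        rw [pi_norm_le_iff_of_nonneg (Real.sqrt_nonneg _)]
        intro i
        rw [Real.norm_eq_abs]
        refine Real.abs_le_sqrt ?_
        exact Finset.single_le_sum (f := fun i => (k i : ℝ) ^ 2) (fun i _ => sq_nonneg _)
          (Finset.mem_univ i)
      have h2 : 0 ≤ ∑ i, (k i : ℝ) ^ 2 := Finset.sum_nonneg fun i _ => sq_nonneg _
      calc ‖g k‖ ^ 2 ≤ √(∑ i, (k i : ℝ) ^ 2) ^ 2 := by gcongr
        _ = ∑ i, (k i : ℝ) ^ 2 := Real.sq_sqrt h2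
        _ ≤ bracket k := by unfold bracket; linarith
    rw [inv_pow, show ‖g k‖ ^ 4 = (‖g k‖ ^ 2) ^ 2 by ring]
    gcongr

/-- The weight `1 + |k|²` in `[0,∞]`. -/
def wt (k : Z3) : ℝ≥0∞ := ENNReal.ofReal (bracket k)

theorem wt_ne_top (k : Z3) : wt k ≠ ⊤ := ENNReal.ofReal_ne_top

theorem one_le_wt (k : Z3) : 1 ≤ wt k := by
  rw [wt, ← ENNReal.ofReal_one]; exact ENNReal.ofReal_le_ofReal (one_le_bracket k)

/-- `∑ (1 + |k|²)⁻²`. -/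
def latticeSum : ℝ≥0∞ := ∑' k, ((wt k)⁻¹) ^ 2

theorem latticeSum_lt_top : latticeSum < ⊤ := by
  have : ∀ k, ((wt k)⁻¹) ^ 2 = ENNReal.ofReal ((bracket k ^ 2)⁻¹) := fun k => by
    rw [wt, ← ENNReal.ofReal_inv_of_pos (bracket_pos k), ← ENNReal.ofReal_pow
      (inv_nonneg.2 (bracket_pos k).le), inv_pow]
  unfold latticeSum
  simp only [this]
  exact summable_bracket.tsum_ofReal_lt_top

/-- The squared `H¹` norm of a real function, on the Fourier side. -/
def sobolevSq (a : T3 → ℝ) : ℝ≥0∞ := ∑' k, wt k * ‖coef a k‖ₑ ^ 2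

/-- The smaller weight is at most √s √t, and its own reciprocal absorbs it. In a convolution this
separates the pairs of frequencies according to which of the two is lower. -/
theorem le_of_sq_weights {s t : ℝ≥0∞} (hs0 : 1 ≤ s) (ht0 : 1 ≤ t) (hs : s ≠ ⊤) (ht : t ≠ ⊤) :
    1 ≤ s ^ (1 / 2 : ℝ) * t ^ (1 / 2 : ℝ) * (s⁻¹ + t⁻¹) := by
  rcases le_total s t with h | h
  · calc (1 : ℝ≥0∞) = s * s⁻¹ := (ENNReal.mul_inv_cancel (by positivity) hs).symm
      _ = s ^ (1 / 2 : ℝ) * s ^ (1 / 2 : ℝ) * s⁻¹ := by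
        rw [← ENNReal.rpow_add_of_nonneg _ _ (by norm_num) (by norm_num)]; norm_num
      _ ≤ _ := by gcongr; exact le_self_add
  · calc (1 : ℝ≥0∞) = t * t⁻¹ := (ENNReal.mul_inv_cancel (by positivity) ht).symm
      _ = t ^ (1 / 2 : ℝ) * t ^ (1 / 2 : ℝ) * t⁻¹ := by
        rw [← ENNReal.rpow_add_of_nonneg _ _ (by norm_num) (by norm_num)]; norm_num
      _ ≤ _ := by gcongr; exact le_add_self

/-- This is H¹·H¹ ⊂ L² in dimension three, on the Fourier side. Once the weights are split, the
low-frequency factor is in ℓ¹ by Cauchy–Schwarz against `latticeSum`, the other is in ℓ², and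
Young's inequality applies. -/
theorem tsum_coef_mul_sq_le {a b : T3 → ℝ} (ha : MemLp a 2 volume) (hb : MemLp b 2 volume) :
    ∑' k, ‖coef (fun x => a x * b x) k‖ₑ ^ 2 ≤
      4 * latticeSum * sobolevSq a * sobolevSq b := by
  set α : Z3 → ℝ≥0∞ := fun k => wt k ^ (1 / 2 : ℝ) * ‖coef a k‖ₑ with hα
  set β : Z3 → ℝ≥0∞ := fun k => wt k ^ (1 / 2 : ℝ) * ‖coef b k‖ₑ with hβ
  have half : ∀ x : ℝ≥0∞, (x ^ (1 / 2 : ℝ)) ^ 2 = x := fun x => by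
    rw [← ENNReal.rpow_natCast, ← ENNReal.rpow_mul]; simp
  have sα : ∑' k, α k ^ 2 = sobolevSq a := by simp only [hα, mul_pow, half]; rfl
  have sβ : ∑' k, β k ^ 2 = sobolevSq b := by simp only [hβ, mul_pow, half]; rfl
  have bd : ∀ k, ‖coef (fun x => a x * b x) k‖ₑ ≤
      (∑' m, ((wt m)⁻¹ * α m) * β (k - m)) + ∑' m, ((wt m)⁻¹ * β m) * α (k - m) := by
    intro k
    have h := hasSum_convolution ha hb k
    rw [← h.tsum_eq]
    refine (enorm_tsum_le_tsum_enorm).trans ?_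
    have e2 : ∑' m, ((wt m)⁻¹ * β m) * α (k - m) =
        ∑' m, ((wt (k - m))⁻¹ * β (k - m)) * α m := by
      rw [← (Equiv.subLeft k).tsum_eq]
      simp
    rw [e2, ← ENNReal.tsum_add]
    refine ENNReal.tsum_le_tsum fun m => ?_
    rw [enorm_mul]
    have := le_of_sq_weights (one_le_wt m) (one_le_wt (k - m)) (wt_ne_top _) (wt_ne_top _)
    calc ‖coef a m‖ₑ * ‖coef b (k - m)‖ₑ ≤ (wt m ^ (1 / 2 : ℝ) * wt (k - m) ^ (1 / 2 : ℝ) *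
          ((wt m)⁻¹ + (wt (k - m))⁻¹)) * (‖coef a m‖ₑ * ‖coef b (k - m)‖ₑ) :=
          le_mul_of_one_le_left' this
      _ = _ := by simp only [hα, hβ]; ring
  have sq2 : ∀ x y : ℝ≥0∞, (x + y) ^ 2 ≤ 2 * (x ^ 2 + y ^ 2) := fun x y => by
    have := ENNReal.rpow_add_le_mul_rpow_add_rpow x y (p := 2) (by norm_num)
    norm_num at this
    exact_mod_cast this
  have l1 : ∀ γ : Z3 → ℝ≥0∞, (∑' m, (wt m)⁻¹ * γ m) ^ 2 ≤ latticeSum * ∑' k, γ k ^ 2 := fun γ =>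
    tsum_mul_sq_le _ _
  calc ∑' k, ‖coef (fun x => a x * b x) k‖ₑ ^ 2
      ≤ ∑' k, 2 * ((∑' m, ((wt m)⁻¹ * α m) * β (k - m)) ^ 2 +
          (∑' m, ((wt m)⁻¹ * β m) * α (k - m)) ^ 2) :=
        ENNReal.tsum_le_tsum fun k => (pow_le_pow_left' (bd k) 2).trans (sq2 _ _)
    _ = 2 * (∑' k, (∑' m, ((wt m)⁻¹ * α m) * β (k - m)) ^ 2 +
          ∑' k, (∑' m, ((wt m)⁻¹ * β m) * α (k - m)) ^ 2) := by
        rw [ENNReal.tsum_mul_left, ENNReal.tsum_add]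
    _ ≤ 2 * (latticeSum * sobolevSq a * sobolevSq b + latticeSum * sobolevSq b * sobolevSq a) := by
        gcongr
        · refine (tsum_conv_sq_le _ _).trans ?_
          rw [sβ, ← sα]
          gcongr
          exact l1 α
        · refine (tsum_conv_sq_le _ _).trans ?_
          rw [sα, ← sβ]
          gcongr
          exact l1 β
    _ = _ := by ring

theorem memLp_mul_of_sobolevSq {a b : T3 → ℝ} (ha : MemLp a 2 volume) (hb : MemLp b 2 volume)
    (hA : sobolevSq a < ⊤) (hB : sobolevSq b < ⊤) : MemLp (fun x => a x * b x) 2 volume :=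
  memLp_two_of_coef (ha.integrable_mul hb) ((tsum_coef_mul_sq_le ha hb).trans_lt
    (ENNReal.mul_lt_top (ENNReal.mul_lt_top (ENNReal.mul_lt_top (by simp) latticeSum_lt_top) hA) hB))

/-! ### Trigonometric test functions -/

/-- The real trigonometric function `Re (c e^{2πi k·x})`. -/
def trig (k : Z3) (c : ℂ) (x : T3) : ℝ := (c * mFourier k x).re

theorem trig_toTorus (k : Z3) (c : ℂ) (y : R3) : trig k c (toTorus y) =
    (c * Complex.exp (((2 * Real.pi * ∑ i, (k i : ℝ) * y i : ℝ) : ℂ) * Complex.I)).re := by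
  rw [trig, mFourier_toTorus]

theorem isSmooth_trig (k : Z3) (c : ℂ) : IsSmooth (trig k c) := by
  unfold IsSmooth
  simp only [trig_toTorus]
  have h1 : ContDiff ℝ ∞ fun y : R3 => 2 * Real.pi * ∑ i, (k i : ℝ) * y i := by fun_prop
  have h2 : ContDiff ℝ ∞ fun y : R3 => ((2 * Real.pi * ∑ i, (k i : ℝ) * y i : ℝ) : ℂ) :=
    Complex.ofRealCLM.contDiff.comp h1
  exact Complex.reCLM.contDiff.comp (contDiff_const.mul ((h2.mul contDiff_const).cexp))

theorem single_eq_smul (i : Fin 3) (r : ℝ) :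
    (EuclideanSpace.single i r : R3) = r • EuclideanSpace.single i (1 : ℝ) := by
  ext m
  simp [PiLp.single_apply]

theorem isSmooth_trig_single (k : Z3) (c : ℂ) (i : Fin 3) :
    IsSmooth (fun x => EuclideanSpace.single i (trig k c x)) := by
  have h := isSmooth_trig k c
  unfold IsSmooth at h ⊢
  have e : (fun y : R3 => (EuclideanSpace.single i (trig k c (toTorus y)) : R3)) =
      fun y => trig k c (toTorus y) • EuclideanSpace.single i (1 : ℝ) := by
    funext y; exact single_eq_smul _ _
  rw [e]
  exact h.smul contDiff_const

theorem hasDerivAt_trig (j : Fin 3) (k : Z3) (c : ℂ) (x : T3) :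
    HasDerivAt (fun s : ℝ => trig k c (x + toTorus (EuclideanSpace.single j s)))
      (trig k (2 * Real.pi * Complex.I * k j * c) x) 0 := by
  have e : ∀ s : ℝ, trig k c (x + toTorus (EuclideanSpace.single j s)) =
      (c * mFourier k x * Complex.exp ((s : ℂ) * (2 * Real.pi * k j * Complex.I))).re := by
    intro s
    rw [trig, mFourier_add_right, mFourier_toTorus]
    have : ∑ i, (k i : ℝ) * (EuclideanSpace.single j s : R3) i = k j * s := by
      simp [PiLp.single_apply]
    have h2 : ((2 * Real.pi * (k j * s) : ℝ) : ℂ) * Complex.I =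
        (s : ℂ) * (2 * Real.pi * k j * Complex.I) := by push_cast; ring
    rw [this, h2, ← mul_assoc]
  simp only [e]
  have h1 : HasDerivAt (fun s : ℝ => (s : ℂ) * (2 * Real.pi * k j * Complex.I))
      (1 * (2 * Real.pi * k j * Complex.I)) 0 :=
    (Complex.ofRealCLM.hasDerivAt (x := (0 : ℝ))).mul_const _
  have h2 := (h1.cexp.const_mul (c * mFourier k x))
  have h3 := Complex.reCLM.hasFDerivAt.comp_hasDerivAt (0 : ℝ) h2
  refine h3.congr_deriv ?_
  simp only [Complex.ofReal_zero, zero_mul, Complex.exp_zero, one_mul, Complex.reCLM_apply, trig]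
  congr 1
  ring

theorem partialDeriv_trig (j : Fin 3) (k : Z3) (c : ℂ) :
    partialDeriv j (trig k c) = trig k (2 * Real.pi * Complex.I * k j * c) := by
  funext x
  exact (hasDerivAt_trig j k c x).deriv

theorem partialDeriv_trig_single (i j : Fin 3) (k : Z3) (c : ℂ) :
    partialDeriv j (fun x => EuclideanSpace.single i (trig k c x)) =
      fun x => EuclideanSpace.single i (trig k (2 * Real.pi * Complex.I * k j * c) x) := by
  funext x
  unfold partialDeriv
  rw [single_eq_smul i (trig k _ x)]
  have h := (hasDerivAt_trig j k c x).smul_const (EuclideanSpace.single i (1 : ℝ) : R3)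
  rw [← h.deriv]
  congr 1
  funext s
  exact single_eq_smul _ _

theorem laplace_trig_single (i : Fin 3) (k : Z3) (c : ℂ) :
    laplace (fun x => EuclideanSpace.single i (trig k c x)) =
      fun x => EuclideanSpace.single i
        (trig k (-(4 * Real.pi ^ 2 * ∑ j, (k j : ℝ) ^ 2 : ℝ) * c) x) := by
  funext x
  unfold laplace
  simp only [partialDeriv_trig_single]
  ext m
  simp only [WithLp.ofLp_sum, Finset.sum_apply, PiLp.single_apply]
  split_ifs
  · simp only [trig, ← Complex.re_sum, ← Finset.sum_mul]
    congr 2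
    push_cast
    rw [Finset.mul_sum, ← Finset.sum_neg_distrib, Finset.sum_mul]
    refine Finset.sum_congr rfl fun j _ => ?_
    linear_combination (4 * Real.pi ^ 2 * (k j : ℂ) ^ 2 * c) * Complex.I_sq
  · simp

theorem divergence_trig_single (i : Fin 3) (k : Z3) (c : ℂ) :
    divergence (fun x => EuclideanSpace.single i (trig k c x)) =
      trig k (2 * Real.pi * Complex.I * k i * c) := by
  funext x
  unfold divergence
  have : ∀ j, partialDeriv j (fun y => (EuclideanSpace.single i (trig k c y) : R3) j) x =
      if j = i then trig k (2 * Real.pi * Complex.I * k i * c) x else 0 := by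
    intro j
    simp only [PiLp.single_apply]
    split_ifs with h
    · subst h; exact congrFun (partialDeriv_trig j k c) x
    · simp [partialDeriv]
  rw [Finset.sum_congr rfl fun j _ => this j]
  simp

theorem continuous_trig (k : Z3) (c : ℂ) : Continuous (trig k c) :=
  Complex.continuous_re.comp (continuous_const.mul (mFourier k).continuous)

theorem abs_trig_le (k : Z3) (c : ℂ) (x : T3) : |trig k c x| ≤ ‖c‖ := by
  refine (Complex.abs_re_le_norm _).trans ?_
  rw [norm_mul, norm_mFourier_apply, mul_one]

theorem integral_trig_mul {a : T3 → ℝ} (ha : Integrable a) (k : Z3) (c : ℂ) :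
    ∫ x, trig (-k) c x * a x = (c * coef a k).re := by
  rw [coef_eq, ← integral_const_mul]
  have hi : Integrable fun x => c * (mFourier (-k) x * (a x : ℂ)) :=
    (integrable_mFourier_mul (integrable_ofReal ha) _).const_mul c
  have := integral_re hi
  simp only [RCLike.re_eq_complex_re] at this
  rw [← this]
  refine integral_congr_ae (ae_of_all _ fun x => ?_)
  dsimp only
  rw [← mul_assoc, Complex.re_mul_ofReal, trig]

/-- Test functions are real, so a complex coefficient z is recovered from the numbers Re(cz) with c
arbitrary. -/
theorem eq_of_forall_re_mul {z w : ℂ} (h : ∀ c : ℂ, (c * z).re = (c * w).re) : z = w := by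
  refine Complex.ext (by simpa using h 1) ?_
  simpa using h (-Complex.I)

/-! ### Fourier coefficients of a divergence-free Sobolev field -/

/-- Fourier coefficients of a vector field. -/
def vhat (u : T3 → R3) (k : Z3) (i : Fin 3) : ℂ := coef (fun x => u x i) k

/-- A divergence-free `H¹` field with its weak gradient. -/
structure IsSobolevField (u : T3 → R3) (G : T3 → Fin 3 → R3) : Prop where
  memLp : MemLp u 2 volume
  memLp_grad : ∀ j, MemLp (fun x => G x j) 2 volume
  weak : HasWeakGradient u G
  divFree : IsDivFree u

theorem memLp_coord {u : T3 → R3} {p : ℝ≥0∞} (hu : MemLp u p volume) (i : Fin 3) :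
    MemLp (fun x => u x i) p volume :=
  hu.of_le ((EuclideanSpace.proj (𝕜 := ℝ) i).continuous.comp_aestronglyMeasurable hu.1)
    (ae_of_all _ fun x => PiLp.norm_apply_le (u x) i)

theorem integrable_of_memLp_two {a : T3 → ℝ} (ha : MemLp a 2 volume) : Integrable a :=
  ha.integrable (by norm_num)

theorem integral_coord {α : Type*} [MeasurableSpace α] {μ : Measure α} {f : α → R3}
    (hf : Integrable f μ) (i : Fin 3) : (∫ x, f x ∂μ) i = ∫ x, f x i ∂μ :=
  ((EuclideanSpace.proj (𝕜 := ℝ) i).integral_comp_comm hf).symm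

theorem integrable_bdd_smul {f : T3 → R3} (hf : Integrable f) {φ : T3 → ℝ} (hφ : Continuous φ) {c : ℝ}
    (hc : ∀ x, |φ x| ≤ c) : Integrable fun x => φ x • f x :=
  hf.bdd_smul c hφ.aestronglyMeasurable (ae_of_all _ hc)

theorem sum_vhat_eq_zero {u : T3 → R3} (hu : MemLp u 2 volume) (hd : IsDivFree u) (k : Z3) :
    ∑ j, (k j : ℂ) * vhat u k j = 0 := by
  have hp : (2 * Real.pi * Complex.I : ℂ) ≠ 0 := by simp [Real.pi_ne_zero]
  refine eq_of_forall_re_mul fun c => ?_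
  -- The amplitude is chosen so that differentiation at frequency -k leaves exactly c k_j.
  have h := hd _ (isSmooth_trig (-k) (-(c / (2 * Real.pi * Complex.I))))
  have hi : ∀ j c, Integrable fun x => trig (-k) c x * u x j := fun j c =>
    (integrable_of_memLp_two (memLp_coord hu j)).bdd_mul (c := ‖c‖)
      (continuous_trig _ _).aestronglyMeasurable (ae_of_all _ fun x => abs_trig_le _ _ x)
  simp only [partialDeriv_trig, mul_comm (u _ _)] at h
  rw [integral_finsetSum _ fun j _ => hi j _] at h
  simp only [integral_trig_mul (integrable_of_memLp_two (memLp_coord hu _))] at h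
  rw [← Complex.re_sum] at h
  rw [mul_zero, Complex.zero_re, ← h, Finset.mul_sum]
  congr 1
  refine Finset.sum_congr rfl fun j _ => ?_
  simp only [Pi.neg_apply, Int.cast_neg, vhat]
  field_simp

theorem coef_grad {u : T3 → R3} {G : T3 → Fin 3 → R3} (h : IsSobolevField u G) (i j : Fin 3)
    (k : Z3) : coef (fun x => G x j i) k = 2 * Real.pi * Complex.I * k j * vhat u k i := by
  refine eq_of_forall_re_mul fun c => ?_
  have hu := h.memLp.integrable (by norm_num)
  have hG := (h.memLp_grad j).integrable (by norm_num)
  have h1 := congrArg (fun z : R3 => z i) (h.weak j _ (isSmooth_trig (-k) c))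
  simp only [partialDeriv_trig, PiLp.neg_apply] at h1
  rw [integral_coord (integrable_bdd_smul hu (continuous_trig _ _) (abs_trig_le _ _)),
    integral_coord (integrable_bdd_smul hG (continuous_trig _ _) (abs_trig_le _ _))] at h1
  simp only [PiLp.smul_apply, smul_eq_mul] at h1
  rw [integral_trig_mul (integrable_of_memLp_two (memLp_coord h.memLp i)),
    integral_trig_mul (integrable_of_memLp_two (memLp_coord (h.memLp_grad j) i))] at h1
  have h2 : (c * coef (fun x => G x j i) k).re =
      (-(2 * Real.pi * Complex.I * ((-k) j : ℤ) * c * coef (fun x => u x i) k)).re := by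
    rw [Complex.neg_re, h1, neg_neg]
  rw [h2]
  congr 1
  simp only [Pi.neg_apply, Int.cast_neg, vhat]
  ring

/-- The sum of the squared `H¹` norms of the components. -/
def fieldSobolevSq (u : T3 → R3) : ℝ≥0∞ := ∑ i, sobolevSq fun x => u x i

theorem sobolevSq_le {u : T3 → R3} {G : T3 → Fin 3 → R3} (h : IsSobolevField u G) (i : Fin 3) :
    sobolevSq (fun x => u x i) ≤ (∫⁻ x, ‖u x i‖ₑ ^ 2) + ∑ j, ∫⁻ x, ‖G x j i‖ₑ ^ 2 := by
  rw [← tsum_enorm_coef_sq (memLp_coord h.memLp i)]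
  simp only [← tsum_enorm_coef_sq (memLp_coord (h.memLp_grad _) i)]
  rw [← Summable.tsum_finsetSum fun _ _ => ENNReal.summable, ← ENNReal.tsum_add]
  refine ENNReal.tsum_le_tsum fun k => ?_
  simp only [coef_grad h, ← ofReal_norm, ← ENNReal.ofReal_pow (norm_nonneg _)]
  rw [← ENNReal.ofReal_sum_of_nonneg fun _ _ => by positivity,
    ← ENNReal.ofReal_add (by positivity) (Finset.sum_nonneg fun _ _ => by positivity), wt,
    ← ENNReal.ofReal_mul (bracket_pos k).le]
  refine ENNReal.ofReal_le_ofReal ?_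
  simp only [norm_mul, mul_pow, ← Finset.sum_mul, bracket, vhat]
  rw [add_mul, one_mul]
  gcongr with j _
  simp only [Complex.norm_ofNat, Complex.norm_real, Complex.norm_I, Complex.norm_intCast]
  rw [sq_abs, one_pow, mul_one, Real.norm_eq_abs, sq_abs]
  -- Each derivative carries a factor 2π, and (2π)² ≥ 1.
  refine le_mul_of_one_le_left (sq_nonneg _) ?_
  nlinarith [Real.two_le_pi]

theorem enorm_sq_eq_sum (z : R3) : ‖z‖ₑ ^ 2 = ∑ i, ‖z i‖ₑ ^ 2 := by
  simp only [← ofReal_norm, ← ENNReal.ofReal_pow (norm_nonneg _)]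
  rw [← ENNReal.ofReal_sum_of_nonneg fun _ _ => by positivity, EuclideanSpace.real_norm_sq_eq]
  simp

theorem lintegral_enorm_sq_eq_sum {u : T3 → R3} (hu : AEStronglyMeasurable u volume) :
    ∫⁻ x, ‖u x‖ₑ ^ 2 = ∑ i, ∫⁻ x, ‖u x i‖ₑ ^ 2 := by
  simp only [enorm_sq_eq_sum (u _)]
  exact lintegral_finsetSum' _ fun i _ => (((EuclideanSpace.proj (𝕜 := ℝ)
    i).continuous.comp_aestronglyMeasurable hu).enorm).pow_const 2

theorem fieldSobolevSq_le {u : T3 → R3} {G : T3 → Fin 3 → R3} (h : IsSobolevField u G) :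
    fieldSobolevSq u ≤ (∫⁻ x, ‖u x‖ₑ ^ 2) + ∫⁻ x, ∑ j, ‖G x j‖ₑ ^ 2 := by
  rw [lintegral_finsetSum' _ fun j _ => ((h.memLp_grad j).1.enorm).pow_const 2,
    lintegral_enorm_sq_eq_sum h.memLp.1]
  simp only [lintegral_enorm_sq_eq_sum (h.memLp_grad _).1]
  rw [Finset.sum_comm, ← Finset.sum_add_distrib]
  exact Finset.sum_le_sum fun i _ => sobolevSq_le h i

theorem lintegral_enorm_sq_lt_top {F : Type*} [NormedAddCommGroup F] {u : T3 → F}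
    (hu : MemLp u 2 volume) : ∫⁻ x, ‖u x‖ₑ ^ 2 < ⊤ := by
  have := lintegral_rpow_enorm_lt_top_of_eLpNorm_lt_top (by norm_num) (by norm_num) hu.2
  simpa using this

theorem fieldSobolevSq_lt_top {u : T3 → R3} {G : T3 → Fin 3 → R3} (h : IsSobolevField u G) :
    fieldSobolevSq u < ⊤ := by
  refine (fieldSobolevSq_le h).trans_lt ?_
  rw [lintegral_finsetSum' _ fun j _ => ((h.memLp_grad j).1.enorm).pow_const 2]
  exact ENNReal.add_lt_top.2 ⟨lintegral_enorm_sq_lt_top h.memLp,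
    ENNReal.sum_lt_top.2 fun j _ => lintegral_enorm_sq_lt_top (h.memLp_grad j)⟩

theorem sobolevSq_coord_le (u : T3 → R3) (i : Fin 3) :
    sobolevSq (fun x => u x i) ≤ fieldSobolevSq u :=
  Finset.single_le_sum (f := fun i => sobolevSq fun x => u x i) (fun _ _ => zero_le) (Finset.mem_univ i)

theorem memLp_mul_coord {u : T3 → R3} {G : T3 → Fin 3 → R3} (h : IsSobolevField u G) (l i : Fin 3) :
    MemLp (fun x => u x l * u x i) 2 volume :=
  memLp_mul_of_sobolevSq (memLp_coord h.memLp l) (memLp_coord h.memLp i)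
    ((sobolevSq_coord_le u l).trans_lt (fieldSobolevSq_lt_top h))
    ((sobolevSq_coord_le u i).trans_lt (fieldSobolevSq_lt_top h))

/-- The convection term in divergence form. -/
theorem coef_convection {u : T3 → R3} {G : T3 → Fin 3 → R3} (h : IsSobolevField u G) (i : Fin 3)
    (k : Z3) : coef (fun x => ∑ l, u x l * G x l i) k =
      2 * Real.pi * Complex.I * ∑ l, (k l : ℂ) * coef (fun x => u x l * u x i) k := by
  rw [coef_sum _ (a := fun l x => u x l * G x l i) fun l => (memLp_coord h.memLp l).integrable_mul (memLp_coord (h.memLp_grad l) i)]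
  have h1 : HasSum (fun m => ∑ l, vhat u (k - m) l * (2 * Real.pi * Complex.I * m l * vhat u m i))
      (∑ l, coef (fun x => u x l * G x l i) k) := by
    refine hasSum_sum fun l _ => ?_
    have := hasSum_convolution (memLp_coord (h.memLp_grad l) i) (memLp_coord h.memLp l) k
    simp only [coef_grad h] at this
    convert this using 1
    · funext m; rw [mul_comm]; rfl
    · simp only [mul_comm]
  have h2 : HasSum (fun m => ∑ l, (2 * Real.pi * Complex.I * k l) * (vhat u m i * vhat u (k - m) l))
      (∑ l, (2 * Real.pi * Complex.I * k l) * coef (fun x => u x l * u x i) k) := by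
    refine hasSum_sum fun l _ => HasSum.mul_left _ ?_
    have := hasSum_convolution (memLp_coord h.memLp i) (memLp_coord h.memLp l) k
    have e : (fun x => u x l * u x i) = fun x => u x i * u x l := by
      funext x; ring
    rw [e]
    exact this
  rw [Finset.mul_sum]
  simp only [← mul_assoc]
  refine h1.unique (h2.congr_fun fun m => ?_)
  -- Orthogonality of the velocity coefficient at k - m to k - m lets k replace m, which moves the
  -- derivative outside the product.
  have hd := sum_vhat_eq_zero h.memLp h.divFree (k - m)
  simp only [Pi.sub_apply, Int.cast_sub, sub_mul, Finset.sum_sub_distrib, sub_eq_zero] at hd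
  have e1 : ∑ l, vhat u (k - m) l * (2 * Real.pi * Complex.I * m l * vhat u m i) =
      2 * Real.pi * Complex.I * vhat u m i * ∑ l, (m l : ℂ) * vhat u (k - m) l := by
    rw [Finset.mul_sum]; exact Finset.sum_congr rfl fun l _ => by ring
  have e2 : ∑ l, (2 * Real.pi * Complex.I * k l) * (vhat u m i * vhat u (k - m) l) =
      2 * Real.pi * Complex.I * vhat u m i * ∑ l, (k l : ℂ) * vhat u (k - m) l := by
    rw [Finset.mul_sum]; exact Finset.sum_congr rfl fun l _ => by ring
  rw [e1, e2, hd]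

/-! ### Third order increments -/

/-- The symmetrised triple correlation on the Fourier side. -/
def tripleCoef (u : T3 → R3) (k : Z3) (l i j : Fin 3) : ℂ :=
  coef (fun x => u x l * u x i) k * conj (vhat u k j) +
  coef (fun x => u x l * u x j) k * conj (vhat u k i) +
  coef (fun x => u x i * u x j) k * conj (vhat u k l)

theorem tripleCoef_swap₁ (u : T3 → R3) (k : Z3) (l i j : Fin 3) :
    tripleCoef u k l i j = tripleCoef u k i l j := by
  simp only [tripleCoef, mul_comm (u _ i) (u _ l)]
  ring

theorem tripleCoef_swap₂ (u : T3 → R3) (k : Z3) (l i j : Fin 3) :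
    tripleCoef u k l i j = tripleCoef u k l j i := by
  simp only [tripleCoef, mul_comm (u _ j) (u _ i)]
  ring

/-- The frequency `k` as a vector of `ℝ³`. -/
def freq (k : Z3) : R3 := WithLp.toLp 2 fun i => (k i : ℝ)

theorem freq_apply (k : Z3) (i : Fin 3) : freq k i = k i := rfl

theorem inner_freq (k : Z3) (h : R3) : inner ℝ (freq k) h = ∑ i, (k i : ℝ) * h i := by
  simp [PiLp.inner_apply, freq_apply, mul_comm]

/-- When the triple product is expanded, the two pure cubes cancel by translation invariance. What
remains are correlations of a product of components with a third component; exchanging x and x + h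
conjugates the phase, and the difference of the two kinds retains only the sine. -/
theorem hasSum_increment {u : T3 → R3} {G : T3 → Fin 3 → R3} (hu : IsSobolevField u G)
    (l i j : Fin 3) (h : R3) :
    HasSum (fun k => 2 * Real.sin (2 * Real.pi * inner ℝ (freq k) h) * (tripleCoef u k l i j).im)
      (∫ x, increment h u x l * increment h u x i * increment h u x j) := by
  set y := toTorus h with hy
  have m1 := fun i => memLp_coord hu.memLp i
  have m2 := fun l i => memLp_mul_coord hu l i
  have m1' := fun i => memLp_translate (m1 i) y
  have m2' := fun l i => memLp_translate (m2 l i) y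
  have c1 := fun l i j => hasSum_correlation (m2 l i) (m1 j) y
  have c2 : ∀ l i j, HasSum (fun k => mFourier k (-y) * (coef (fun x => u x l * u x i) k *
      conj (vhat u k j))) ((∫ x, u x l * u x i * u (x + y) j : ℝ) : ℂ) := fun l i j => by
    have := hasSum_correlation (m2 l i) (m1 j) (-y)
    have e : ∫ x, u x l * u x i * u (x + y) j = ∫ x, u (x + -y) l * u (x + -y) i * u x j := by
      rw [← integral_add_right_eq_self (fun x => u (x + -y) l * u (x + -y) i * u x j) y]
      simp
    rw [e]
    exact this
  have J1 : ∀ l i j, Integrable fun x => u (x + y) l * u (x + y) i * u x j := fun l i j =>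
    (m2' l i).integrable_mul (m1 j)
  have J2 : ∀ l i j, Integrable fun x => u x l * u x i * u (x + y) j := fun l i j =>
    (m2 l i).integrable_mul (m1' j)
  have J3 : ∀ l i j, Integrable fun x => u x l * u x i * u x j := fun l i j =>
    (m2 l i).integrable_mul (m1 j)
  have J4 : ∀ l i j, Integrable fun x => u (x + y) l * u (x + y) i * u (x + y) j := fun l i j =>
    (m2' l i).integrable_mul (m1' j)
  have hexp : ∫ x, increment h u x l * increment h u x i * increment h u x j =
      (∫ x, u x l * u x i * u (x + y) j) + (∫ x, u x l * u x j * u (x + y) i) +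
      (∫ x, u x i * u x j * u (x + y) l) - ((∫ x, u (x + y) l * u (x + y) i * u x j) +
      (∫ x, u (x + y) l * u (x + y) j * u x i) + ∫ x, u (x + y) i * u (x + y) j * u x l) := by
    have ht : ∫ x, u (x + y) l * u (x + y) i * u (x + y) j = ∫ x, u x l * u x i * u x j :=
      integral_add_right_eq_self (fun x => u x l * u x i * u x j) y
    have e : ∀ x, increment h u x l * increment h u x i * increment h u x j =
        ((u x l * u x i * u (x + y) j + u x l * u x j * u (x + y) i + u x i * u x j * u (x + y) l)
        - (u (x + y) l * u (x + y) i * u x j + u (x + y) l * u (x + y) j * u x i +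
          u (x + y) i * u (x + y) j * u x l)) +
        (u (x + y) l * u (x + y) i * u (x + y) j - u x l * u x i * u x j) := fun x => by
      simp only [increment, PiLp.sub_apply, ← hy]
      ring
    simp only [e]
    rw [integral_add, integral_sub, integral_sub, integral_add, integral_add, integral_add,
      integral_add, ht, sub_self, add_zero]
    all_goals first
      | exact J1 _ _ _
      | exact J2 _ _ _
      | exact J3 _ _ _
      | exact J4 _ _ _
      | exact (J1 _ _ _).add (J1 _ _ _)
      | exact (J2 _ _ _).add (J2 _ _ _)
      | exact ((J1 _ _ _).add (J1 _ _ _)).add (J1 _ _ _)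
      | exact ((J2 _ _ _).add (J2 _ _ _)).add (J2 _ _ _)
      | exact (((J2 _ _ _).add (J2 _ _ _)).add (J2 _ _ _)).sub
          (((J1 _ _ _).add (J1 _ _ _)).add (J1 _ _ _))
      | exact (J4 _ _ _).sub (J3 _ _ _)
  have hs := (((c2 l i j).add (c2 l j i)).add (c2 i j l)).sub
    (((c1 l i j).add (c1 l j i)).add (c1 i j l))
  have hre := (Complex.hasSum_iff _ _).1 hs
  rw [hexp]
  convert hre.1 using 1
  · funext k
    have e1 : mFourier k (-y) = conj (mFourier k y) := by
      simp [mFourier, fourier_apply]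
    rw [e1, hy, mFourier_toTorus, inner_freq]
    have e2 : ∀ θ : ℝ, Complex.exp ((θ : ℂ) * Complex.I) = ⟨Real.cos θ, Real.sin θ⟩ := fun θ => by
      apply Complex.ext <;> simp [Complex.exp_ofReal_mul_I_re, Complex.exp_ofReal_mul_I_im]
    rw [e2]
    simp only [tripleCoef, vhat, Complex.sub_re, Complex.add_re, Complex.mul_re, Complex.add_im,
      Complex.mul_im, Complex.conj_re, Complex.conj_im]
    ring
  · simp

/-! ### The flux through the sphere -/

/-- `∫∫ (A - b) |δu|² δu·n + b (δu·n)³ dx dS(n) / 4π` with `δu` the increment by `l n`. -/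
def structGen (A b : ℝ) (u : T3 → R3) (l : ℝ) : ℝ :=
  1 / (4 * Real.pi) * ∫ n : S2, (∫ x : T3,
    ((A - b) * (‖increment (l • (n : R3)) u x‖ ^ 2 * inner ℝ (increment (l • (n : R3)) u x) (n : R3))
      + b * (inner ℝ (increment (l • (n : R3)) u x) (n : R3)) ^ 3)) ∂surfaceMeasure

theorem structGen_one_zero (u : T3 → R3) (l : ℝ) : structGen 1 0 u l = structZero u l := by
  simp [structGen, structZero]

theorem structGen_one_one (u : T3 → R3) (l : ℝ) : structGen 1 1 u l = structLong u l := by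
  simp [structGen, structLong]

/-- The contribution of the frequency `k` to the energy flux through scale `l`. -/
def fluxTerm (A b : ℝ) (u : T3 → R3) (l : ℝ) (k : Z3) : ℝ :=
  ∑ q, ∑ i, ∑ j, (tripleCoef u k q i j).im *
    (2 * Real.pi * k q * symbol A b i j (l • freq k))

/-- On the unit sphere the kernel reduces to (A - b)δ_ij + b n_i n_j. This identity selects the
parameters of the two structure functions. -/
theorem kernel_contract (A b : ℝ) (n : S2) (d : R3) :
    ∑ q, ∑ i, ∑ j, (n : R3) q * kernel A b i j n * (d q * d i * d j) =
      (A - b) * (‖d‖ ^ 2 * inner ℝ d (n : R3)) + b * (inner ℝ d (n : R3)) ^ 3 := by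
  simp only [kernel_sphere, EuclideanSpace.real_norm_sq_eq, PiLp.inner_apply]
  simp [Fin.sum_univ_three]
  ring

theorem summable_tripleCoef {u : T3 → R3} {G : T3 → Fin 3 → R3} (h : IsSobolevField u G)
    (l i j : Fin 3) : Summable fun k => ‖tripleCoef u k l i j‖ := by
  have c := fun l i j => (hasSum_coef_mul_conj (memLp_mul_coord h l i) (memLp_coord h.memLp j)).summable
  exact ((((c l i j).add (c l j i)).add (c i j l))).norm

theorem abs_sphere_coord_le (n : S2) (i : Fin 3) : |(n : R3) i| ≤ 1 :=
  abs_coord_le (norm_sphere_coe n).le i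

/-- The tensor `tripleCoef` was symmetrised precisely so that `symbol_flux` applies to it. -/
theorem fluxTerm_eq_integral (A b : ℝ) (u : T3 → R3) {l : ℝ} (hl : 0 < l) (k : Z3) :
    fluxTerm A b u l k = l⁻¹ * ∫ n : S2,
      (∑ q, ∑ i, ∑ j, (tripleCoef u k q i j).im * ((n : R3) q * kernel A b i j n)) *
        Real.sin (2 * Real.pi * inner ℝ (l • freq k) (n : R3)) ∂surfaceMeasure := by
  rw [← symbol_flux A b (fun q i j => (tripleCoef u k q i j).im)
    (fun q i j => by rw [tripleCoef_swap₁]) (fun q i j => by rw [tripleCoef_swap₂]), fluxTerm,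
    Finset.mul_sum]
  simp only [Finset.mul_sum]
  refine Finset.sum_congr rfl fun q _ => Finset.sum_congr rfl fun i _ =>
    Finset.sum_congr rfl fun j _ => ?_
  simp only [PiLp.smul_apply, freq_apply, smul_eq_mul]
  field_simp

/-- The integrand of the flux through the sphere at frequency `k`. -/
def fluxDensity (A b : ℝ) (u : T3 → R3) (l : ℝ) (k : Z3) (n : S2) : ℝ :=
  (∑ q, ∑ i, ∑ j, (tripleCoef u k q i j).im * ((n : R3) q * kernel A b i j n)) *
        Real.sin (2 * Real.pi * inner ℝ (l • freq k) (n : R3))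

theorem abs_fluxDensity_le (A b : ℝ) (u : T3 → R3) (l : ℝ) (k : Z3) (n : S2) :
    |fluxDensity A b u l k n| ≤ kernelBound A b * ∑ q, ∑ i, ∑ j, ‖tripleCoef u k q i j‖ := by
  unfold fluxDensity
  rw [abs_mul]
  refine (mul_le_of_le_one_right (abs_nonneg _) (Real.abs_sin_le_one _)).trans ?_
  simp only [Finset.mul_sum]
  refine (Finset.abs_sum_le_sum_abs _ _).trans (Finset.sum_le_sum fun q _ =>
    (Finset.abs_sum_le_sum_abs _ _).trans (Finset.sum_le_sum fun i _ =>
    (Finset.abs_sum_le_sum_abs _ _).trans (Finset.sum_le_sum fun j _ => ?_)))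
  rw [abs_mul, abs_mul, mul_comm]
  gcongr
  · exact kernelBound_nonneg A b
  · calc |(n : R3) q| * |kernel A b i j n| ≤ 1 * kernelBound A b := by
          gcongr
          · exact abs_sphere_coord_le n q
          · exact abs_kernel_le A b i j (norm_sphere_coe n).le
      _ = _ := one_mul _
  · exact Complex.abs_im_le_norm _

theorem continuous_fluxDensity (A b : ℝ) (u : T3 → R3) (l : ℝ) (k : Z3) :
    Continuous (fluxDensity A b u l k) := by
  have := fun i j => (contDiff_kernel A b i j).continuous
  unfold fluxDensity
  fun_prop

theorem surfaceMeasure_real_univ : surfaceMeasure.real univ = 4 * Real.pi := by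
  unfold surfaceMeasure
  rw [Measure.toSphere_real_apply_univ, volume_real_unitBall]
  simp
  ring

/-- A constant for the bound of the flux terms. -/
def fluxBound (A b : ℝ) : ℝ := kernelBound A b * (4 * Real.pi)

theorem fluxBound_nonneg (A b : ℝ) : 0 ≤ fluxBound A b :=
  mul_nonneg (kernelBound_nonneg A b) (by positivity)

theorem abs_fluxTerm_le (A b : ℝ) (u : T3 → R3) {l : ℝ} (hl : 0 < l) (k : Z3) :
    |fluxTerm A b u l k| ≤ l⁻¹ * fluxBound A b * ∑ q, ∑ i, ∑ j, ‖tripleCoef u k q i j‖ := by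
  rw [fluxTerm_eq_integral A b u hl, abs_mul, abs_of_pos (inv_pos.2 hl), mul_assoc]
  gcongr
  have := norm_integral_le_of_norm_le_const (μ := surfaceMeasure) (f := fluxDensity A b u l k)
    (ae_of_all _ fun n => abs_fluxDensity_le A b u l k n)
  rw [surfaceMeasure_real_univ] at this
  refine this.trans (le_of_eq ?_)
  unfold fluxBound; ring

theorem integrable_increment_triple {u : T3 → R3} {G : T3 → Fin 3 → R3} (hu : IsSobolevField u G)
    (h : R3) (q i j : Fin 3) :
    Integrable fun x => increment h u x q * increment h u x i * increment h u x j := by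
  have m1 := fun i => memLp_coord hu.memLp i
  have m2 := fun l i => memLp_mul_coord hu l i
  have m1' := fun i => memLp_translate (m1 i) (toTorus h)
  have m2' := fun l i => memLp_translate (m2 l i) (toTorus h)
  have d : ∀ i, MemLp (fun x => increment h u x i) 2 volume := fun i => (m1' i).sub (m1 i)
  have d2 : MemLp (fun x => increment h u x q * increment h u x i) 2 volume := by
    refine (((m2' q q).add (m2 q q)).add ((m2' i i).add (m2 i i))).of_le
      ((d q).1.mul (d i).1) (ae_of_all _ fun x => ?_)
    simp only [increment, PiLp.sub_apply, Pi.add_apply, Real.norm_eq_abs]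
    refine le_trans ?_ (le_abs_self _)
    rw [abs_le]
    constructor <;> nlinarith [sq_nonneg (u (x + toTorus h) q + u x q),
      sq_nonneg (u (x + toTorus h) i + u x i),
      sq_nonneg (u (x + toTorus h) q - u x q + (u (x + toTorus h) i - u x i)),
      sq_nonneg (u (x + toTorus h) q - u x q - (u (x + toTorus h) i - u x i))]
  exact d2.integrable_mul (d j)

/-- The flux through the sphere of radius `l` is the sum of its Fourier contributions. -/
theorem hasSum_fluxTerm (A b : ℝ) {u : T3 → R3} {G : T3 → Fin 3 → R3} (hu : IsSobolevField u G)
    {l : ℝ} (hl : 0 < l) :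
    HasSum (fluxTerm A b u l) (2 * Real.pi * (structGen A b u l / l)) := by
  have hS : Summable fun k => kernelBound A b * ∑ q, ∑ i, ∑ j, ‖tripleCoef u k q i j‖ :=
    (summable_sum fun q _ => summable_sum fun i _ => summable_sum fun j _ =>
      summable_tripleCoef hu q i j).mul_left _
  have hsum : HasSum (fun k => ∫ n : S2, fluxDensity A b u l k n ∂surfaceMeasure)
      (∫ n : S2, ∑' k, fluxDensity A b u l k n ∂surfaceMeasure) := by
    -- The triple correlations are absolutely summable with a bound independent of the direction n,
    -- so the sum over frequencies commutes with the surface integral.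
    refine hasSum_integral_of_summable_integral_norm (fun k =>
      (continuous_fluxDensity A b u l k).integrable_of_hasCompactSupport
        (HasCompactSupport.of_compactSpace _)) ?_
    refine (hS.mul_right (4 * Real.pi)).of_nonneg_of_le
      (fun k => integral_nonneg fun _ => norm_nonneg _) fun k => ?_
    have := norm_integral_le_of_norm_le_const (μ := surfaceMeasure)
      (f := fun n => ‖fluxDensity A b u l k n‖)
      (ae_of_all _ fun n => (by rw [norm_norm]; exact abs_fluxDensity_le A b u l k n))
    rw [surfaceMeasure_real_univ] at this
    exact (le_abs_self _).trans this
  have hpt : ∀ n : S2, ∑' k, fluxDensity A b u l k n = 1 / 2 * ∫ x : T3,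
    ((A - b) * (‖increment (l • (n : R3)) u x‖ ^ 2 * inner ℝ (increment (l • (n : R3)) u x) (n : R3))
      + b * (inner ℝ (increment (l • (n : R3)) u x) (n : R3)) ^ 3) := by
    intro n
    have h1 : HasSum (fun k => ∑ q, ∑ i, ∑ j, (n : R3) q * kernel A b i j n *
        (2 * Real.sin (2 * Real.pi * inner ℝ (freq k) (l • (n : R3))) * (tripleCoef u k q i j).im))
        (∑ q, ∑ i, ∑ j, (n : R3) q * kernel A b i j n *
          ∫ x, increment (l • (n : R3)) u x q * increment (l • (n : R3)) u x i *
            increment (l • (n : R3)) u x j) :=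
      hasSum_sum fun q _ => hasSum_sum fun i _ => hasSum_sum fun j _ =>
        (hasSum_increment hu q i j (l • (n : R3))).mul_left _
    have ii := integrable_increment_triple hu (l • (n : R3))
    have h2 : (∑ q, ∑ i, ∑ j, (n : R3) q * kernel A b i j n *
          ∫ x, increment (l • (n : R3)) u x q * increment (l • (n : R3)) u x i *
            increment (l • (n : R3)) u x j) = ∫ x : T3,
    ((A - b) * (‖increment (l • (n : R3)) u x‖ ^ 2 * inner ℝ (increment (l • (n : R3)) u x) (n : R3))
      + b * (inner ℝ (increment (l • (n : R3)) u x) (n : R3)) ^ 3) := by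
      simp only [← kernel_contract]
      rw [integral_finsetSum _ fun q _ => integrable_finsetSum _ fun i _ =>
        integrable_finsetSum _ fun j _ => (ii q i j).const_mul _]
      refine Finset.sum_congr rfl fun q _ => ?_
      rw [integral_finsetSum _ fun i _ => integrable_finsetSum _ fun j _ => (ii q i j).const_mul _]
      refine Finset.sum_congr rfl fun i _ => ?_
      rw [integral_finsetSum _ fun j _ => (ii q i j).const_mul _]
      refine Finset.sum_congr rfl fun j _ => ?_
      rw [integral_const_mul]
    rw [← h2]
    refine HasSum.tsum_eq ((h1.mul_left (1 / 2)).congr_fun fun k => ?_)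
    unfold fluxDensity
    rw [real_inner_smul_left, real_inner_smul_right]
    simp only [Finset.mul_sum, Finset.sum_mul]
    refine Finset.sum_congr rfl fun q _ => Finset.sum_congr rfl fun i _ =>
      Finset.sum_congr rfl fun j _ => ?_
    ring
  simp only [hpt, integral_const_mul] at hsum
  have := hsum.mul_left l⁻¹
  have e : ∀ I : ℝ, 2 * Real.pi * (1 / (4 * Real.pi) * I / l) = l⁻¹ * (1 / 2 * I) := fun I => by
    field_simp
    ring
  rw [structGen, e]
  exact this.congr_fun fun k => fluxTerm_eq_integral A b u hl k

/-- The nonlinear term of the equation tested against the kernel at frequency `k`. -/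
theorem fluxTerm_eq_convection (A b : ℝ) {u : T3 → R3} {G : T3 → Fin 3 → R3}
    (hu : IsSobolevField u G) (l : ℝ) (k : Z3) :
    fluxTerm A b u l k = -2 * ∑ i, ∑ j, symbol A b i j (l • freq k) *
      (coef (fun x => ∑ q, u x q * G x q i) k * conj (vhat u k j)).re := by
  have hd := sum_vhat_eq_zero hu.memLp hu.divFree k
  -- Of the three terms of `tripleCoef`, the one in which k meets the velocity coefficient vanishes
  -- by incompressibility; the other two agree by symmetry of the symbol, hence the factor 2.
  have hd' : ∀ z : ℂ, ∑ q, (k q : ℝ) * (z * conj (vhat u k q)).im = 0 := by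
    intro z
    have h1 : ∑ q, (k q : ℝ) * (z * conj (vhat u k q)).im =
        (z * conj (∑ q, (k q : ℂ) * vhat u k q)).im := by
      rw [map_sum, Finset.mul_sum, Complex.im_sum]
      refine Finset.sum_congr rfl fun q _ => ?_
      simp [Complex.mul_im]
      ring
    rw [h1, hd]; simp
  have e1 : fluxTerm A b u l k =
      (∑ i, ∑ j, symbol A b i j (l • freq k) * (2 * Real.pi * ∑ q, (k q : ℝ) *
        (coef (fun x => u x q * u x i) k * conj (vhat u k j)).im)) +
      (∑ i, ∑ j, symbol A b i j (l • freq k) * (2 * Real.pi * ∑ q, (k q : ℝ) *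
        (coef (fun x => u x q * u x j) k * conj (vhat u k i)).im)) +
      (∑ i, ∑ j, symbol A b i j (l • freq k) * (2 * Real.pi * ∑ q, (k q : ℝ) *
        (coef (fun x => u x i * u x j) k * conj (vhat u k q)).im)) := by
    unfold fluxTerm tripleCoef
    rw [Finset.sum_comm]
    simp only [← Finset.sum_add_distrib]
    refine Finset.sum_congr rfl fun i _ => ?_
    rw [Finset.sum_comm]
    refine Finset.sum_congr rfl fun j _ => ?_
    simp only [← mul_add, ← Finset.sum_add_distrib, Complex.add_im, Finset.mul_sum]
    refine Finset.sum_congr rfl fun q _ => ?_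
    ring
  have e2 : (∑ i, ∑ j, symbol A b i j (l • freq k) * (2 * Real.pi * ∑ q, (k q : ℝ) *
        (coef (fun x => u x q * u x j) k * conj (vhat u k i)).im)) =
      ∑ i, ∑ j, symbol A b i j (l • freq k) * (2 * Real.pi * ∑ q, (k q : ℝ) *
        (coef (fun x => u x q * u x i) k * conj (vhat u k j)).im) := by
    rw [Finset.sum_comm]
    refine Finset.sum_congr rfl fun i _ => Finset.sum_congr rfl fun j _ => ?_
    rw [symbol_comm]
  rw [e1, e2]
  simp only [hd', mul_zero, Finset.sum_const_zero, add_zero]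
  rw [← two_mul, neg_mul, ← mul_neg, ← Finset.sum_neg_distrib]
  congr 1
  refine Finset.sum_congr rfl fun i _ => ?_
  rw [← Finset.sum_neg_distrib]
  refine Finset.sum_congr rfl fun j _ => ?_
  rw [← mul_neg, coef_convection hu]
  congr 1
  simp only [Finset.mul_sum, Finset.sum_mul, Complex.re_sum]
  rw [← Finset.sum_neg_distrib]
  refine Finset.sum_congr rfl fun q _ => ?_
  generalize coef (fun x => u x q * u x i) k = z
  generalize vhat u k j = w
  simp [Complex.mul_re, Complex.mul_im]
  ring

/-- Summability of the flux terms, with a bound uniform in the field. -/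
theorem tsum_fluxTerm_le (A b : ℝ) {u : T3 → R3} {G : T3 → Fin 3 → R3} (hu : IsSobolevField u G)
    {l : ℝ} (hl : 0 < l) :
    ∑' k, ‖fluxTerm A b u l k‖ₑ ≤ ENNReal.ofReal (l⁻¹ * fluxBound A b) *
      (81 * ((4 * latticeSum) ^ (1 / 2 : ℝ) * fieldSobolevSq u *
        (∫⁻ x, ‖u x‖ₑ ^ 2) ^ (1 / 2 : ℝ))) := by
  have half : ∀ x y : ℝ≥0∞, x ^ 2 ≤ y → x ≤ y ^ (1 / 2 : ℝ) := fun x y h => by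
    have := ENNReal.rpow_le_rpow h (z := 1 / 2) (by norm_num)
    rwa [← ENNReal.rpow_natCast, ← ENNReal.rpow_mul, show ((2 : ℕ) : ℝ) * (1 / 2) = 1 by norm_num,
      ENNReal.rpow_one] at this
  set X := (4 * latticeSum) ^ (1 / 2 : ℝ) * fieldSobolevSq u *
        (∫⁻ x, ‖u x‖ₑ ^ 2) ^ (1 / 2 : ℝ) with hX
  have h1 : ∀ q i j, ∑' k, ‖coef (fun x => u x q * u x i) k‖ₑ * ‖vhat u k j‖ₑ ≤ X := by
    intro q i j
    have e : X = ((4 * latticeSum) * fieldSobolevSq u ^ 2 * ∫⁻ x, ‖u x‖ₑ ^ 2) ^ (1 / 2 : ℝ) := by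
      rw [ENNReal.mul_rpow_of_nonneg _ _ (by norm_num), ENNReal.mul_rpow_of_nonneg _ _ (by norm_num),
        ← ENNReal.rpow_natCast _ 2, ← ENNReal.rpow_mul, show ((2 : ℕ) : ℝ) * (1 / 2) = 1 by norm_num,
        ENNReal.rpow_one]
    rw [e]
    refine half _ _ ((tsum_mul_sq_le _ _).trans ?_)
    refine mul_le_mul' ((tsum_coef_mul_sq_le (memLp_coord hu.memLp q) (memLp_coord hu.memLp i)).trans
      ?_) ?_
    · rw [mul_assoc, sq]
      gcongr
      · exact sobolevSq_coord_le u q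
      · exact sobolevSq_coord_le u i
    · unfold vhat
      rw [tsum_enorm_coef_sq (memLp_coord hu.memLp j), lintegral_enorm_sq_eq_sum hu.memLp.1]
      exact Finset.single_le_sum (f := fun j => ∫⁻ x, ‖u x j‖ₑ ^ 2) (fun _ _ => zero_le)
        (Finset.mem_univ j)
  have h2 : ∀ q i j, ∑' k, ‖tripleCoef u k q i j‖ₑ ≤ 3 * X := by
    intro q i j
    calc ∑' k, ‖tripleCoef u k q i j‖ₑ ≤ ∑' k,
          (‖coef (fun x => u x q * u x i) k‖ₑ * ‖vhat u k j‖ₑ +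
          ‖coef (fun x => u x q * u x j) k‖ₑ * ‖vhat u k i‖ₑ +
          ‖coef (fun x => u x i * u x j) k‖ₑ * ‖vhat u k q‖ₑ) := by
          refine ENNReal.tsum_le_tsum fun k => ?_
          unfold tripleCoef
          have e : ∀ z w : ℂ, ‖z * conj w‖ₑ = ‖z‖ₑ * ‖w‖ₑ := fun z w => by
            rw [enorm_mul, ← ofReal_norm (conj w), RCLike.norm_conj, ofReal_norm]
          simp only [← e]
          exact (enorm_add_le _ _).trans (by gcongr; exact enorm_add_le _ _)
      _ ≤ X + X + X := by
          rw [ENNReal.tsum_add, ENNReal.tsum_add]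
          gcongr <;> exact h1 _ _ _
      _ = 3 * X := by ring
  calc ∑' k, ‖fluxTerm A b u l k‖ₑ
      ≤ ∑' k, ENNReal.ofReal (l⁻¹ * fluxBound A b) * ∑ q, ∑ i, ∑ j, ‖tripleCoef u k q i j‖ₑ := by
        refine ENNReal.tsum_le_tsum fun k => ?_
        have e : ∑ q, ∑ i, ∑ j, ‖tripleCoef u k q i j‖ₑ =
            ENNReal.ofReal (∑ q, ∑ i, ∑ j, ‖tripleCoef u k q i j‖) := by
          rw [ENNReal.ofReal_sum_of_nonneg fun _ _ => by positivity]
          refine Finset.sum_congr rfl fun q _ => ?_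
          rw [ENNReal.ofReal_sum_of_nonneg fun _ _ => by positivity]
          refine Finset.sum_congr rfl fun i _ => ?_
          rw [ENNReal.ofReal_sum_of_nonneg fun _ _ => by positivity]
          simp only [ofReal_norm]
        rw [e, ← ENNReal.ofReal_mul (mul_nonneg (inv_pos.2 hl).le (fluxBound_nonneg A b)),
          ← ofReal_norm]
        exact ENNReal.ofReal_le_ofReal (abs_fluxTerm_le A b u hl k)
    _ = ENNReal.ofReal (l⁻¹ * fluxBound A b) * ∑ q, ∑ i, ∑ j, ∑' k, ‖tripleCoef u k q i j‖ₑ := by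
        rw [ENNReal.tsum_mul_left]
        simp only [Summable.tsum_finsetSum fun _ _ => ENNReal.summable]
    -- There are 27 index triples with three terms each, whence 81.
    _ ≤ ENNReal.ofReal (l⁻¹ * fluxBound A b) * ∑ q : Fin 3, ∑ i : Fin 3, ∑ j : Fin 3, 3 * X := by
        gcongr with q _ i _ j _
        exact h2 q i j
    _ = _ := by
        simp
        ring

/-! ### Functions of time -/

instance : IsFiniteMeasure timeMeasure := by unfold timeMeasure; infer_instance

theorem restrict_Ioc_le {t : ℝ} (ht : t ≤ 1) : volume.restrict (Ioc 0 t) ≤ timeMeasure :=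
  Measure.restrict_mono_set _ fun _ hr => ⟨hr.1.le, hr.2.trans ht⟩

theorem intervalIntegrable_of_mem {E : Type*} [NormedAddCommGroup E] {g : ℝ → E}
    (hg : Integrable g timeMeasure) {t : ℝ} (ht : t ∈ Icc (0 : ℝ) 1) :
    IntervalIntegrable g volume 0 t := by
  rw [intervalIntegrable_iff_integrableOn_Ioc_of_le ht.1]
  exact hg.mono_measure (restrict_Ioc_le ht.2)

theorem intervalIntegral_congr_timeMeasure {E : Type*} [NormedAddCommGroup E] [NormedSpace ℝ E]
    {g h : ℝ → E} (hgh : g =ᵐ[timeMeasure] h) {t : ℝ} (ht : t ∈ Icc (0 : ℝ) 1) :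
    ∫ r in (0 : ℝ)..t, g r = ∫ r in (0 : ℝ)..t, h r := by
  rw [intervalIntegral.integral_of_le ht.1, intervalIntegral.integral_of_le ht.1]
  exact integral_congr_ae ((Measure.absolutelyContinuous_of_le (restrict_Ioc_le ht.2)).ae_le hgh)

theorem enorm_intervalIntegral_le {E : Type*} [NormedAddCommGroup E] [NormedSpace ℝ E]
    (g : ℝ → E) {t : ℝ} (ht : t ∈ Icc (0 : ℝ) 1) :
    ‖∫ r in (0 : ℝ)..t, g r‖ₑ ≤ ∫⁻ r, ‖g r‖ₑ ∂timeMeasure := by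
  rw [intervalIntegral.integral_of_le ht.1]
  exact (enorm_integral_le_lintegral_enorm _).trans
    (lintegral_mono' (restrict_Ioc_le ht.2) le_rfl)

/-- Fubini for a series and a time integral, through which the balances of the single modes are
added up. -/
theorem hasSum_intervalIntegral {ι : Type*} [Countable ι] {g : ι → ℝ → ℝ} {s : ℝ → ℝ}
    (hg : ∀ i, AEStronglyMeasurable (g i) timeMeasure)
    (hfin : ∑' i, ∫⁻ r, ‖g i r‖ₑ ∂timeMeasure ≠ ⊤)
    (hs : ∀ᵐ r ∂timeMeasure, HasSum (fun i => g i r) (s r)) {t : ℝ} (ht : t ∈ Icc (0 : ℝ) 1) :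
    HasSum (fun i => ∫ r in (0 : ℝ)..t, g i r) (∫ r in (0 : ℝ)..t, s r) := by
  simp only [intervalIntegral.integral_of_le ht.1]
  have hle := restrict_Ioc_le ht.2
  have hac := (Measure.absolutelyContinuous_of_le hle)
  have hfin' : ∑' i, ∫⁻ r, ‖g i r‖ₑ ∂(volume.restrict (Ioc 0 t)) ≠ ⊤ :=
    ne_top_of_le_ne_top hfin (ENNReal.tsum_le_tsum fun i => lintegral_mono' hle le_rfl)
  have e : ∫ r in Ioc 0 t, s r = ∑' i, ∫ r in Ioc 0 t, g i r := by
    rw [← integral_tsum (fun i => (hg i).mono_measure hle) hfin']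
    exact integral_congr_ae (hac.ae_le (hs.mono fun r hr => hr.tsum_eq.symm))
  rw [e]
  refine (Summable.of_norm ?_).hasSum
  have hne : ∀ i, ‖∫ r in Ioc 0 t, g i r‖ₑ ≤ ∫⁻ r, ‖g i r‖ₑ ∂(volume.restrict (Ioc 0 t)) :=
    fun i => enorm_integral_le_lintegral_enorm _
  have : ∑' i, ‖∫ r in Ioc 0 t, g i r‖ₑ ≠ ⊤ := ne_top_of_le_ne_top hfin' (ENNReal.tsum_le_tsum hne)
  have := ENNReal.summable_toReal this
  simpa using this

/-- The product rule for primitives of integrable functions. -/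
theorem mul_sub_mul_eq_integral {a c g h : ℝ → ℝ} (hg : Integrable g timeMeasure)
    (hh : Integrable h timeMeasure) (ha : ∀ t ∈ Icc (0 : ℝ) 1, a t = a 0 + ∫ r in (0 : ℝ)..t, g r)
    (hc : ∀ t ∈ Icc (0 : ℝ) 1, c t = c 0 + ∫ r in (0 : ℝ)..t, h r) {t : ℝ}
    (ht : t ∈ Icc (0 : ℝ) 1) :
    a t * c t - a 0 * c 0 = ∫ r in (0 : ℝ)..t, (g r * c r + a r * h r) := by
  have ig := intervalIntegrable_of_mem hg ht
  have ih := intervalIntegrable_of_mem hh ht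
  have h0 : (0 : ℝ) ∈ uIcc 0 t := left_mem_uIcc
  -- The functions a and c are primitives only on [0,1]; derivatives are taken of A and B, which are
  -- defined on the whole line and agree with them there.
  set A := fun s => a 0 + ∫ r in (0 : ℝ)..s, g r with hA
  set B := fun s => c 0 + ∫ r in (0 : ℝ)..s, h r with hB
  have hconst : ∀ y : ℝ, AbsolutelyContinuousOnInterval (fun _ : ℝ => y) 0 t := fun y =>
    (LipschitzWith.const y).lipschitzOnWith.absolutelyContinuousOnInterval
  have hAc : AbsolutelyContinuousOnInterval A 0 t :=
    (hconst (a 0)).add (ig.absolutelyContinuousOnInterval_intervalIntegral h0)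
  have hBc : AbsolutelyContinuousOnInterval B 0 t :=
    (hconst (c 0)).add (ih.absolutelyContinuousOnInterval_intervalIntegral h0)
  have key := hAc.integral_deriv_mul_eq_sub hBc
  have eA : A t = a t := (ha t ht).symm
  have eB : B t = c t := (hc t ht).symm
  have eA0 : A 0 = a 0 := by simp [hA]
  have eB0 : B 0 = c 0 := by simp [hB]
  rw [← eA, ← eB, ← eA0, ← eB0, ← key]
  refine intervalIntegral.integral_congr_ae ?_
  filter_upwards [ig.ae_hasDerivAt_integral, ih.ae_hasDerivAt_integral] with r h1 h2 hr
  have hr' : r ∈ uIcc 0 t := uIoc_subset_uIcc hr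
  have d1 : deriv A r = g r := ((h1 hr' 0 h0).const_add (a 0)).deriv
  have d2 : deriv B r = h r := ((h2 hr' 0 h0).const_add (c 0)).deriv
  have hr1 : r ∈ Icc (0 : ℝ) 1 := by
    rw [uIcc_of_le ht.1] at hr'
    exact ⟨hr'.1, hr'.2.trans ht.2⟩
  rw [d1, d2, ha r hr1, hc r hr1]

theorem integral_re_intervalIntegral {g : ℝ → ℂ} (hg : Integrable g timeMeasure) {t : ℝ}
    (ht : t ∈ Icc (0 : ℝ) 1) : (∫ r in (0 : ℝ)..t, g r).re = ∫ r in (0 : ℝ)..t, (g r).re :=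
  (Complex.reCLM.intervalIntegral_comp_comm (intervalIntegrable_of_mem hg ht)).symm

theorem integral_im_intervalIntegral {g : ℝ → ℂ} (hg : Integrable g timeMeasure) {t : ℝ}
    (ht : t ∈ Icc (0 : ℝ) 1) : (∫ r in (0 : ℝ)..t, g r).im = ∫ r in (0 : ℝ)..t, (g r).im :=
  (Complex.imCLM.intervalIntegral_comp_comm (intervalIntegrable_of_mem hg ht)).symm

theorem continuousOn_of_primitive {a g : ℝ → ℝ} (hg : Integrable g timeMeasure)
    (ha : ∀ t ∈ Icc (0 : ℝ) 1, a t = a 0 + ∫ r in (0 : ℝ)..t, g r) : ContinuousOn a (Icc 0 1) := by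
  have ig := intervalIntegrable_of_mem hg (t := 1) ⟨zero_le_one, le_rfl⟩
  have := intervalIntegral.continuousOn_primitive_interval' ig left_mem_uIcc
  rw [uIcc_of_le zero_le_one] at this
  exact (continuousOn_const.add this).congr ha

theorem integrable_mul_of_continuousOn {a g : ℝ → ℝ} (hg : Integrable g timeMeasure)
    (ha : ContinuousOn a (Icc 0 1)) : Integrable (fun r => a r * g r) timeMeasure := by
  obtain ⟨C, hC⟩ := isCompact_Icc.exists_bound_of_continuousOn ha
  exact hg.bdd_mul (c := C) (ha.aestronglyMeasurable measurableSet_Icc)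
    ((ae_restrict_iff' measurableSet_Icc).2 (ae_of_all _ hC))

/-- The evolution of a symmetric quadratic form along a curve with integrable derivative. -/
theorem quadratic_sub_eq_integral {z g : Fin 3 → ℝ → ℂ} (m : Fin 3 → Fin 3 → ℝ)
    (hm : ∀ i j, m i j = m j i) (hg : ∀ i, Integrable (g i) timeMeasure)
    (hz : ∀ i, ∀ t ∈ Icc (0 : ℝ) 1, z i t = z i 0 + ∫ r in (0 : ℝ)..t, g i r) {t : ℝ}
    (ht : t ∈ Icc (0 : ℝ) 1) :
    (∑ i, ∑ j, m i j * (z i t * conj (z j t)).re) - ∑ i, ∑ j, m i j * (z i 0 * conj (z j 0)).re =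
      ∫ r in (0 : ℝ)..t, 2 * ∑ i, ∑ j, m i j * (g i r * conj (z j r)).re := by
  have hre : ∀ i, ∀ t ∈ Icc (0 : ℝ) 1, (z i t).re = (z i 0).re + ∫ r in (0 : ℝ)..t, (g i r).re :=
    fun i t ht => by rw [← integral_re_intervalIntegral (hg i) ht, ← Complex.add_re, ← hz i t ht]
  have him : ∀ i, ∀ t ∈ Icc (0 : ℝ) 1, (z i t).im = (z i 0).im + ∫ r in (0 : ℝ)..t, (g i r).im :=
    fun i t ht => by rw [← integral_im_intervalIntegral (hg i) ht, ← Complex.add_im, ← hz i t ht]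
  have gre : ∀ i, Integrable (fun r => (g i r).re) timeMeasure := fun i => (hg i).re
  have gim : ∀ i, Integrable (fun r => (g i r).im) timeMeasure := fun i => (hg i).im
  have cre := fun i => continuousOn_of_primitive (gre i) (hre i)
  have cim := fun i => continuousOn_of_primitive (gim i) (him i)
  have hI : ∀ i j, Integrable (fun r => m i j * (((g i r).re * (z j r).re + (z i r).re * (g j r).re) +
      ((g i r).im * (z j r).im + (z i r).im * (g j r).im))) timeMeasure := fun i j => by
    refine Integrable.const_mul (((?_ : Integrable _ _).add ?_).add ((?_ : Integrable _ _).add ?_)) _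
    · simpa only [mul_comm] using integrable_mul_of_continuousOn (gre i) (cre j)
    · exact integrable_mul_of_continuousOn (gre j) (cre i)
    · simpa only [mul_comm] using integrable_mul_of_continuousOn (gim i) (cim j)
    · exact integrable_mul_of_continuousOn (gim j) (cim i)
  have hE : ∀ i j, m i j * (z i t * conj (z j t)).re - m i j * (z i 0 * conj (z j 0)).re =
      ∫ r in (0 : ℝ)..t, m i j * (((g i r).re * (z j r).re + (z i r).re * (g j r).re) +
      ((g i r).im * (z j r).im + (z i r).im * (g j r).im)) := fun i j => by
    rw [intervalIntegral.integral_const_mul, intervalIntegral.integral_add,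
      ← mul_sub_mul_eq_integral (gre i) (gre j) (hre i) (hre j) ht,
      ← mul_sub_mul_eq_integral (gim i) (gim j) (him i) (him j) ht]
    · simp only [Complex.mul_re, Complex.conj_re, Complex.conj_im]; ring
    · refine intervalIntegrable_of_mem ((?_ : Integrable _ _).add ?_) ht
      · simpa only [mul_comm] using integrable_mul_of_continuousOn (gre i) (cre j)
      · exact integrable_mul_of_continuousOn (gre j) (cre i)
    · refine intervalIntegrable_of_mem ((?_ : Integrable _ _).add ?_) ht
      · simpa only [mul_comm] using integrable_mul_of_continuousOn (gim i) (cim j)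
      · exact integrable_mul_of_continuousOn (gim j) (cim i)
  rw [← Finset.sum_sub_distrib]
  simp only [← Finset.sum_sub_distrib, hE]
  have hsum : ∀ i, ∑ j, ∫ r in (0 : ℝ)..t, m i j * (((g i r).re * (z j r).re +
      (z i r).re * (g j r).re) + ((g i r).im * (z j r).im + (z i r).im * (g j r).im)) =
      ∫ r in (0 : ℝ)..t, ∑ j, m i j * (((g i r).re * (z j r).re +
      (z i r).re * (g j r).re) + ((g i r).im * (z j r).im + (z i r).im * (g j r).im)) := fun i =>
    (intervalIntegral.integral_finsetSum fun j _ => intervalIntegrable_of_mem (hI i j) ht).symm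
  simp only [hsum]
  rw [← intervalIntegral.integral_finsetSum fun i _ =>
    intervalIntegrable_of_mem (integrable_finsetSum _ fun j _ => hI i j) ht]
  congr 1
  funext r
  -- Symmetry of m identifies the two halves of the product rule and produces the factor 2.
  have e : ∑ i, ∑ j, m i j * ((z i r).re * (g j r).re + (z i r).im * (g j r).im) =
      ∑ i, ∑ j, m i j * ((g i r).re * (z j r).re + (g i r).im * (z j r).im) := by
    rw [Finset.sum_comm]
    refine Finset.sum_congr rfl fun i _ => Finset.sum_congr rfl fun j _ => ?_
    rw [hm j i]; ring
  have e2 : ∑ i, ∑ j, m i j * (((g i r).re * (z j r).re + (z i r).re * (g j r).re) +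
      ((g i r).im * (z j r).im + (z i r).im * (g j r).im)) =
      (∑ i, ∑ j, m i j * ((g i r).re * (z j r).re + (g i r).im * (z j r).im)) +
      ∑ i, ∑ j, m i j * ((z i r).re * (g j r).re + (z i r).im * (g j r).im) := by
    simp only [← Finset.sum_add_distrib]
    refine Finset.sum_congr rfl fun i _ => Finset.sum_congr rfl fun j _ => ?_
    ring
  rw [e2, e, ← two_mul]
  congr 1
  refine Finset.sum_congr rfl fun i _ => Finset.sum_congr rfl fun j _ => ?_
  simp only [Complex.mul_re, Complex.conj_re, Complex.conj_im]; ring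

/-! ### Evolution of the Fourier coefficients -/

/-- The weak form of the equation, together with the regularity it requires. -/
structure IsWeakSolution (ν : ℝ) (f v : ℝ → T3 → R3) (G : ℝ → T3 → Fin 3 → R3)
    (p : ℝ → T3 → ℝ) : Prop where
  aesm : AEStronglyMeasurable (Function.uncurry v) (timeMeasure.prod volume)
  aesm_force : AEStronglyMeasurable (Function.uncurry f) (timeMeasure.prod volume)
  aesm_grad : AEStronglyMeasurable (Function.uncurry G) (timeMeasure.prod volume)
  memLp : ∀ t ∈ Icc (0 : ℝ) 1, MemLp (v t) 2 volume
  sobolev : ∀ᵐ r ∂timeMeasure, IsSobolevField (v r) (G r)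
  memLp_force : ∀ᵐ r ∂timeMeasure, MemLp (f r) 2 volume
  bound : eLpNorm (fun t => eLpNorm (v t) 2 volume) ⊤ timeMeasure < ⊤
  force_bound : ∫⁻ t, eLpNorm (f t) 2 volume ∂timeMeasure < ⊤
  grad_bound : ∫⁻ r, (∫⁻ x, ∑ j : Fin 3, ‖G r x j‖ₑ ^ 2) ∂timeMeasure < ⊤
  pressure : Integrable (Function.uncurry p) (timeMeasure.prod volume)
  eqn : ∀ t ∈ Icc (0 : ℝ) 1, ∀ ψ : T3 → R3, IsSmooth ψ →
      (∫ x, inner ℝ (v t x) (ψ x)) - ∫ x, inner ℝ (v 0 x) (ψ x) =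
        ν * (∫ r in (0 : ℝ)..t, ∫ x, inner ℝ (v r x) (laplace ψ x))
        - (∫ r in (0 : ℝ)..t, ∫ x, inner ℝ (∑ j : Fin 3, v r x j • G r x j) (ψ x))
        + (∫ r in (0 : ℝ)..t, ∫ x, inner ℝ (f r x) (ψ x))
        + ∫ r in (0 : ℝ)..t, ∫ x, p r x * divergence ψ x

theorem aesm_coord {α : Type*} [MeasurableSpace α] {μ : Measure α} {u : α → R3}
    (hu : AEStronglyMeasurable u μ) (i : Fin 3) : AEStronglyMeasurable (fun x => u x i) μ :=
  (EuclideanSpace.proj (𝕜 := ℝ) i).continuous.comp_aestronglyMeasurable hu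

theorem aesm_coef {a : ℝ → T3 → ℝ}
    (ha : AEStronglyMeasurable (Function.uncurry a) (timeMeasure.prod volume)) (k : Z3) :
    AEStronglyMeasurable (fun r => coef (a r) k) timeMeasure := by
  simp only [coef_eq]
  exact AEStronglyMeasurable.integral_prod_right'
    (f := fun z : ℝ × T3 => mFourier (-k) z.2 * (a z.1 z.2 : ℂ))
    (((mFourier (-k)).continuous.comp continuous_snd).aestronglyMeasurable.mul
      (Complex.continuous_ofReal.comp_aestronglyMeasurable ha))

theorem integrable_coef {a : ℝ → T3 → ℝ}
    (ha : Integrable (Function.uncurry a) (timeMeasure.prod volume)) (k : Z3) :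
    Integrable (fun r => coef (a r) k) timeMeasure :=
  ha.norm.integral_prod_left.mono' (aesm_coef ha.1 k) (ae_of_all _ fun _ => norm_coef_le k)

theorem integrable_uncurry_of_lintegral {F : Type*} [NormedAddCommGroup F] {a : ℝ → T3 → F}
    (ha : AEStronglyMeasurable (Function.uncurry a) (timeMeasure.prod volume))
    (h : ∫⁻ r, eLpNorm (a r) 2 volume ∂timeMeasure < ⊤) :
    Integrable (Function.uncurry a) (timeMeasure.prod volume) := by
  refine ⟨ha, ?_⟩
  unfold HasFiniteIntegral
  rw [lintegral_prod _ ha.enorm]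
  refine lt_of_le_of_lt (lintegral_mono_ae ?_) h
  filter_upwards [ha.prodMk_left] with r hr
  simp only [Function.uncurry_apply_pair]
  rw [← eLpNorm_one_eq_lintegral_enorm]
  exact eLpNorm_le_eLpNorm_of_exponent_le (by norm_num) hr

theorem inner_single_right (z : R3) (i : Fin 3) (r : ℝ) :
    inner ℝ z (EuclideanSpace.single i r) = r * z i := by
  simp [EuclideanSpace.inner_single_right]

theorem ae_eLpNorm_le {v : ℝ → T3 → R3} :
    ∀ᵐ r ∂timeMeasure, eLpNorm (v r) 2 volume ≤
      eLpNorm (fun t => eLpNorm (v t) 2 volume) ⊤ timeMeasure := by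
  rw [eLpNorm_exponent_top]
  exact enorm_ae_le_eLpNormEssSup (fun t => eLpNorm (v t) 2 volume) timeMeasure

namespace IsWeakSolution

variable {ν : ℝ} {f v : ℝ → T3 → R3} {G : ℝ → T3 → Fin 3 → R3} {p : ℝ → T3 → ℝ}

theorem integrable_velocity (h : IsWeakSolution ν f v G p) :
    Integrable (Function.uncurry v) (timeMeasure.prod volume) := by
  refine integrable_uncurry_of_lintegral h.aesm ?_
  refine lt_of_le_of_lt (lintegral_mono_ae ae_eLpNorm_le) ?_
  rw [lintegral_const]
  exact ENNReal.mul_lt_top h.bound (measure_lt_top _ _)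

theorem integrable_force (h : IsWeakSolution ν f v G p) :
    Integrable (Function.uncurry f) (timeMeasure.prod volume) :=
  integrable_uncurry_of_lintegral h.aesm_force h.force_bound

theorem aesm_grad_coord (h : IsWeakSolution ν f v G p) (j i : Fin 3) :
    AEStronglyMeasurable (Function.uncurry fun r x => G r x j i) (timeMeasure.prod volume) :=
  aesm_coord ((continuous_apply j).comp_aestronglyMeasurable h.aesm_grad) i

theorem aesm_vhat (h : IsWeakSolution ν f v G p) (k : Z3) (i : Fin 3) :
    AEStronglyMeasurable (fun r => vhat (v r) k i) timeMeasure :=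
  aesm_coef (a := fun r x => v r x i) (aesm_coord h.aesm i) k

theorem aesm_vhat_force (h : IsWeakSolution ν f v G p) (k : Z3) (i : Fin 3) :
    AEStronglyMeasurable (fun r => vhat (f r) k i) timeMeasure :=
  aesm_coef (a := fun r x => f r x i) (aesm_coord h.aesm_force i) k

theorem integrable_coord {u : ℝ → T3 → R3}
    (h : Integrable (Function.uncurry u) (timeMeasure.prod volume)) (i : Fin 3) :
    Integrable (Function.uncurry fun r x => u r x i) (timeMeasure.prod volume) :=
  (EuclideanSpace.proj (𝕜 := ℝ) i).integrable_comp h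

/-- Both v and ∇v are square integrable in space-time. -/
theorem integrable_convection (h : IsWeakSolution ν f v G p) (i : Fin 3) :
    Integrable (Function.uncurry fun r x => ∑ l, v r x l * G r x l i) (timeMeasure.prod volume) := by
  refine integrable_finsetSum _ fun l _ => ?_
  have m1 : AEStronglyMeasurable (fun z : ℝ × T3 => v z.1 z.2 l) (timeMeasure.prod volume) :=
    aesm_coord h.aesm l
  have m2 : AEStronglyMeasurable (fun z : ℝ × T3 => G z.1 z.2 l i) (timeMeasure.prod volume) :=
    h.aesm_grad_coord l i
  have b1 : ∫⁻ z : ℝ × T3, ‖v z.1 z.2 l‖ₑ ^ 2 ∂(timeMeasure.prod volume) < ⊤ := by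
    rw [lintegral_prod _ (m1.enorm.pow_const 2)]
    refine lt_of_le_of_lt (lintegral_mono_ae (g := fun _ =>
      (eLpNorm (fun t => eLpNorm (v t) 2 volume) ⊤ timeMeasure) ^ 2) ?_) ?_
    · filter_upwards [ae_eLpNorm_le (v := v)] with r hr
      refine le_trans ?_ (pow_le_pow_left' hr 2)
      have e : (eLpNorm (v r) 2 volume) ^ 2 = ∫⁻ x, ‖v r x‖ₑ ^ 2 := by
        rw [eLpNorm_eq_lintegral_rpow_enorm_toReal (by norm_num) (by norm_num)]
        simp only [ENNReal.toReal_ofNat, ENNReal.rpow_ofNat]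
        rw [← ENNReal.rpow_natCast, ← ENNReal.rpow_mul]
        norm_num
      rw [e]
      refine lintegral_mono fun x => ?_
      rw [enorm_sq_eq_sum]
      exact Finset.single_le_sum (f := fun i => ‖v r x i‖ₑ ^ 2) (fun _ _ => zero_le)
        (Finset.mem_univ l)
    · rw [lintegral_const]
      exact ENNReal.mul_lt_top (ENNReal.pow_lt_top h.bound) (measure_lt_top _ _)
  have b2 : ∫⁻ z : ℝ × T3, ‖G z.1 z.2 l i‖ₑ ^ 2 ∂(timeMeasure.prod volume) < ⊤ := by
    rw [lintegral_prod _ (m2.enorm.pow_const 2)]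
    refine lt_of_le_of_lt (lintegral_mono fun r => lintegral_mono fun x => ?_) h.grad_bound
    refine le_trans ?_ (Finset.single_le_sum (f := fun l => ‖G r x l‖ₑ ^ 2) (fun _ _ => zero_le)
      (Finset.mem_univ l))
    dsimp only
    rw [enorm_sq_eq_sum]
    exact Finset.single_le_sum (f := fun i => ‖G r x l i‖ₑ ^ 2) (fun _ _ => zero_le)
      (Finset.mem_univ i)
  have L : ∀ {a : ℝ × T3 → ℝ}, AEStronglyMeasurable a (timeMeasure.prod volume) →
      ∫⁻ z, ‖a z‖ₑ ^ 2 ∂(timeMeasure.prod volume) < ⊤ → MemLp a 2 (timeMeasure.prod volume) := by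
    intro a ha hb
    refine ⟨ha, ?_⟩
    rw [eLpNorm_eq_lintegral_rpow_enorm_toReal (by norm_num) (by norm_num)]
    simp only [ENNReal.toReal_ofNat, ENNReal.rpow_ofNat]
    exact ENNReal.rpow_lt_top_of_nonneg (by norm_num) hb.ne
  exact (L m1 b1).integrable_mul (L m2 b2)

/-- The time derivative of the Fourier coefficients of the velocity. -/
def modeForce (ν : ℝ) (f v : ℝ → T3 → R3) (G : ℝ → T3 → Fin 3 → R3) (p : ℝ → T3 → ℝ) (k : Z3)
    (i : Fin 3) (r : ℝ) : ℂ :=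
  -(4 * Real.pi ^ 2 * ν * ∑ j, (k j : ℝ) ^ 2 : ℝ) * vhat (v r) k i
    - coef (fun x => ∑ l, v r x l * G r x l i) k + vhat (f r) k i
    - 2 * Real.pi * Complex.I * k i * coef (p r) k

theorem integrable_vhat (h : IsWeakSolution ν f v G p) (k : Z3) (i : Fin 3) :
    Integrable (fun r => vhat (v r) k i) timeMeasure :=
  integrable_coef (integrable_coord h.integrable_velocity i) k

theorem integrable_vhat_force (h : IsWeakSolution ν f v G p) (k : Z3) (i : Fin 3) :
    Integrable (fun r => vhat (f r) k i) timeMeasure :=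
  integrable_coef (integrable_coord h.integrable_force i) k

theorem integrable_modeForce (h : IsWeakSolution ν f v G p) (k : Z3) (i : Fin 3) :
    Integrable (modeForce ν f v G p k i) timeMeasure :=
  ((((h.integrable_vhat k i).const_mul _).sub
    (integrable_coef (h.integrable_convection i) k)).add
    (h.integrable_vhat_force k i)).sub ((integrable_coef h.pressure k).const_mul _)

theorem intervalIntegral_test {a : ℝ → T3 → ℝ} (k : Z3) (c : ℂ)
    (ha : Integrable (Function.uncurry a) (timeMeasure.prod volume)) {t : ℝ}
    (ht : t ∈ Icc (0 : ℝ) 1) :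
    ∫ r in (0 : ℝ)..t, ∫ x, trig (-k) c x * a r x =
      (c * ∫ r in (0 : ℝ)..t, coef (a r) k).re := by
  have e : (fun r => ∫ x, trig (-k) c x * a r x) =ᵐ[timeMeasure] fun r => (c * coef (a r) k).re := by
    filter_upwards [ha.prod_right_ae] with r hr
    exact integral_trig_mul hr k c
  rw [intervalIntegral_congr_timeMeasure e ht, ← intervalIntegral.integral_const_mul,
    integral_re_intervalIntegral ((integrable_coef ha k).const_mul c) ht]

/-- The weak equation is tested with Re(c e^{-2πik·x}) times a basis vector, for all complex c. The
time derivative of each mode is thus an integrable function, so quadratic expressions in a single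
mode can be differentiated. -/
theorem vhat_eq (h : IsWeakSolution ν f v G p) (k : Z3) (i : Fin 3) (t : ℝ)
    (ht : t ∈ Icc (0 : ℝ) 1) :
    vhat (v t) k i = vhat (v 0) k i + ∫ r in (0 : ℝ)..t, modeForce ν f v G p k i r := by
  have hsplit : ∫ r in (0 : ℝ)..t, modeForce ν f v G p k i r =
      -(4 * Real.pi ^ 2 * ν * ∑ j, (k j : ℝ) ^ 2 : ℝ) * (∫ r in (0 : ℝ)..t, vhat (v r) k i)
      - (∫ r in (0 : ℝ)..t, coef (fun x => ∑ l, v r x l * G r x l i) k)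
      + (∫ r in (0 : ℝ)..t, vhat (f r) k i)
      - 2 * Real.pi * Complex.I * k i * ∫ r in (0 : ℝ)..t, coef (p r) k := by
    have i1 := intervalIntegrable_of_mem ((h.integrable_vhat k i).const_mul
      (-(4 * Real.pi ^ 2 * ν * ∑ j, (k j : ℝ) ^ 2 : ℝ) : ℂ)) ht
    have i2 := intervalIntegrable_of_mem (integrable_coef (h.integrable_convection i) k) ht
    have i3 := intervalIntegrable_of_mem (h.integrable_vhat_force k i) ht
    have i4 := intervalIntegrable_of_mem ((integrable_coef h.pressure k).const_mul
      (2 * Real.pi * Complex.I * k i : ℂ)) ht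
    unfold modeForce
    rw [intervalIntegral.integral_sub ((i1.sub i2).add i3) i4,
      intervalIntegral.integral_add (i1.sub i2) i3, intervalIntegral.integral_sub i1 i2,
      intervalIntegral.integral_const_mul, intervalIntegral.integral_const_mul]
  rw [← sub_eq_iff_eq_add', hsplit]
  refine eq_of_forall_re_mul fun c => ?_
  have E := h.eqn t ht _ (isSmooth_trig_single (-k) c i)
  rw [laplace_trig_single, divergence_trig_single] at E
  simp only [inner_single_right] at E
  have hL2 : ∀ s ∈ Icc (0 : ℝ) 1, ∫ x, trig (-k) c x * v s x i = (c * vhat (v s) k i).re :=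
    fun s hs => integral_trig_mul (integrable_of_memLp_two (memLp_coord (h.memLp s hs) i)) k c
  rw [hL2 t ht, hL2 0 ⟨le_rfl, zero_le_one⟩,
    intervalIntegral_test k _ (integrable_coord h.integrable_velocity i) ht,
    intervalIntegral_test k _ (integrable_coord h.integrable_force i) ht] at E
  have e1 : ∀ r x, (∑ j, v r x j • G r x j) i = ∑ l, v r x l * G r x l i := fun r x => by
    simp [WithLp.ofLp_sum, Finset.sum_apply]
  simp only [e1, mul_comm (p _ _)] at E
  rw [intervalIntegral_test k _ (h.integrable_convection i) ht,
    intervalIntegral_test k _ h.pressure ht, ← Complex.re_ofReal_mul, ← Complex.sub_re,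
    ← Complex.sub_re, ← Complex.add_re, ← Complex.add_re] at E
  rw [mul_sub, E]
  congr 1
  simp only [Pi.neg_apply, Int.cast_neg, vhat]
  push_cast
  simp only [neg_sq]
  ring

end IsWeakSolution

/-! ### Quadratic forms at a fixed frequency -/

/-- The size of the Fourier coefficient of a vector field. -/
def amp (u : T3 → R3) (k : Z3) : ℝ≥0∞ := ∑ i, ‖vhat u k i‖ₑ

/-- The quadratic form `m` evaluated on Fourier coefficients. -/
def quadMode (m : Fin 3 → Fin 3 → ℝ) (u w : T3 → R3) (k : Z3) : ℝ :=
  ∑ i, ∑ j, m i j * (vhat u k i * conj (vhat w k j)).re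

theorem amp_sq_le (u : T3 → R3) (k : Z3) : amp u k ^ 2 ≤ 3 * ∑ i, ‖vhat u k i‖ₑ ^ 2 := by
  have := ENNReal.rpow_sum_le_const_mul_sum_rpow Finset.univ (fun i => ‖vhat u k i‖ₑ)
    (p := 2) (by norm_num)
  norm_num at this
  exact this

theorem tsum_vhat_sq {u : T3 → R3} (hu : MemLp u 2 volume) :
    ∑' k, ∑ i, ‖vhat u k i‖ₑ ^ 2 = ∫⁻ x, ‖u x‖ₑ ^ 2 := by
  rw [Summable.tsum_finsetSum fun _ _ => ENNReal.summable, lintegral_enorm_sq_eq_sum hu.1]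
  exact Finset.sum_congr rfl fun i _ => tsum_enorm_coef_sq (memLp_coord hu i)

theorem tsum_amp_sq_le {u : T3 → R3} (hu : MemLp u 2 volume) :
    ∑' k, amp u k ^ 2 ≤ 3 * ∫⁻ x, ‖u x‖ₑ ^ 2 := by
  rw [← tsum_vhat_sq hu, ← ENNReal.tsum_mul_left]
  exact ENNReal.tsum_le_tsum fun k => amp_sq_le u k

theorem enorm_quadMode_le {m : Fin 3 → Fin 3 → ℝ} {c : ℝ} (hm : ∀ i j, |m i j| ≤ c)
    (u w : T3 → R3) (k : Z3) :
    ‖quadMode m u w k‖ₑ ≤ ENNReal.ofReal c * (amp u k * amp w k) := by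
  unfold quadMode amp
  rw [Finset.sum_mul_sum, Finset.mul_sum]
  refine (enorm_sum_le _ _).trans (Finset.sum_le_sum fun i _ => ?_)
  rw [Finset.mul_sum]
  refine (enorm_sum_le _ _).trans (Finset.sum_le_sum fun j _ => ?_)
  rw [enorm_mul]
  refine mul_le_mul' (by rw [← ofReal_norm]; exact ENNReal.ofReal_le_ofReal (hm i j)) ?_
  rw [← ofReal_norm, ← ofReal_norm, ← ofReal_norm, ← ENNReal.ofReal_mul (norm_nonneg _)]
  refine ENNReal.ofReal_le_ofReal ?_
  have := Complex.abs_re_le_norm (vhat u k i * conj (vhat w k j))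
  rwa [norm_mul, RCLike.norm_conj] at this

theorem quadMode_sub (m m' : Fin 3 → Fin 3 → ℝ) (c : ℝ) (u w : T3 → R3) (k : Z3) :
    quadMode m u w k - c * quadMode m' u w k = quadMode (fun i j => m i j - c * m' i j) u w k := by
  unfold quadMode
  rw [Finset.mul_sum, ← Finset.sum_sub_distrib]
  refine Finset.sum_congr rfl fun i _ => ?_
  rw [Finset.mul_sum, ← Finset.sum_sub_distrib]
  exact Finset.sum_congr rfl fun j _ => by ring

/-- The identity matrix. -/
def idForm (i j : Fin 3) : ℝ := if i = j then 1 else 0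

theorem abs_idForm_le (i j : Fin 3) : |idForm i j| ≤ 1 := by
  unfold idForm; split_ifs <;> simp

theorem hasSum_quadMode_id {u w : T3 → R3} (hu : MemLp u 2 volume) (hw : MemLp w 2 volume) :
    HasSum (quadMode idForm u w) (∫ x, inner ℝ (u x) (w x)) := by
  have h1 : HasSum (fun k => ∑ i, (vhat u k i * conj (vhat w k i)).re)
      (∑ i, ∫ x, u x i * w x i) := by
    refine hasSum_sum fun i _ => ?_
    have := ((Complex.hasSum_iff _ _).1 (hasSum_coef_mul_conj (memLp_coord hu i)
      (memLp_coord hw i))).1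
    rw [Complex.ofReal_re] at this
    exact this
  have e : ∫ x, inner ℝ (u x) (w x) = ∑ i, ∫ x, u x i * w x i := by
    rw [← integral_finsetSum _ (f := fun i x => u x i * w x i) fun i _ =>
      (memLp_coord hu i).integrable_mul (memLp_coord hw i)]
    refine integral_congr_ae (ae_of_all _ fun x => ?_)
    simp [PiLp.inner_apply, mul_comm]
  rw [e]
  refine h1.congr_fun fun k => ?_
  simp [quadMode, idForm]

/-- The square of the frequency. -/
def freqSq (k : Z3) : ℝ := ∑ j, (k j : ℝ) ^ 2

theorem freqSq_nonneg (k : Z3) : 0 ≤ freqSq k := Finset.sum_nonneg fun _ _ => sq_nonneg _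

/-- The part of the energy seen above the scale `l`. -/
def lowSq (l : ℝ) (u : T3 → R3) : ℝ≥0∞ :=
  ∑' k, ENNReal.ofReal (min 1 ‖l • freq k‖) * amp u k ^ 2

/-- A bound for all entries of the symbol. -/
def symbolSize (A b : ℝ) (ξ : R3) : ℝ := ∑ i, ∑ j, |symbol A b i j ξ|

theorem abs_symbol_le_size (A b : ℝ) (ξ : R3) (i j : Fin 3) :
    |symbol A b i j ξ| ≤ symbolSize A b ξ := by
  refine le_trans ?_ (Finset.single_le_sum (f := fun i => ∑ j, |symbol A b i j ξ|)
    (fun _ _ => Finset.sum_nonneg fun _ _ => abs_nonneg _) (Finset.mem_univ i))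
  exact Finset.single_le_sum (f := fun j => |symbol A b i j ξ|)
    (fun _ _ => abs_nonneg _) (Finset.mem_univ j)

/-- The pressure gradient at frequency k is parallel to k, while the real and imaginary parts of the
velocity coefficient are orthogonal to k; `symbol_orthogonal` treats each part. -/
theorem pressure_cancel (A b : ℝ) {l : ℝ} (hl : 0 < l) {u : T3 → R3} (hu : MemLp u 2 volume)
    (hd : IsDivFree u) (k : Z3) (c : ℂ) :
    ∑ i, ∑ j, symbol A b i j (l • freq k) * (c * k i * conj (vhat u k j)).re = 0 := by
  have h0 := sum_vhat_eq_zero hu hd k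
  have hre : ∑ i, (k i : ℝ) * (vhat u k i).re = 0 := by
    have := congrArg Complex.re h0
    simpa [Complex.mul_re] using this
  have him : ∑ i, (k i : ℝ) * (vhat u k i).im = 0 := by
    have := congrArg Complex.im h0
    simpa [Complex.mul_im] using this
  have H : ∀ y : Fin 3 → ℝ, ∑ i, (k i : ℝ) * y i = 0 →
      ∑ i, ∑ j, symbol A b i j (l • freq k) * (k i * y j) = 0 := by
    intro y hy
    have := symbol_orthogonal A b (l • freq k) (WithLp.toLp 2 y) (by
      simp only [PiLp.smul_apply, freq_apply, smul_eq_mul, mul_assoc, ← Finset.mul_sum, hy, mul_zero])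
    simp only [PiLp.smul_apply, freq_apply, smul_eq_mul] at this
    have e : ∑ i, ∑ j, symbol A b i j (l • freq k) * (l * k i * y j) =
        l * ∑ i, ∑ j, symbol A b i j (l • freq k) * (k i * y j) := by
      simp only [Finset.mul_sum]
      exact Finset.sum_congr rfl fun i _ => Finset.sum_congr rfl fun j _ => by ring
    rw [e] at this
    exact (mul_eq_zero.1 this).resolve_left hl.ne'
  have e : ∑ i, ∑ j, symbol A b i j (l • freq k) * (c * k i * conj (vhat u k j)).re =
      c.re * (∑ i, ∑ j, symbol A b i j (l • freq k) * (k i * (vhat u k j).re)) +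
      c.im * (∑ i, ∑ j, symbol A b i j (l • freq k) * (k i * (vhat u k j).im)) := by
    simp only [Finset.mul_sum, ← Finset.sum_add_distrib]
    refine Finset.sum_congr rfl fun i _ => Finset.sum_congr rfl fun j _ => ?_
    simp [Complex.mul_re, Complex.mul_im]
    ring
  rw [e, H _ hre, H _ him]
  simp

namespace IsWeakSolution

variable {ν : ℝ} {f v : ℝ → T3 → R3} {G : ℝ → T3 → Fin 3 → R3} {p : ℝ → T3 → ℝ}

theorem aemeasurable_amp (h : IsWeakSolution ν f v G p) (k : Z3) :
    AEMeasurable (fun r => amp (v r) k) timeMeasure :=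
  Finset.aemeasurable_fun_sum _ fun i _ => (h.aesm_vhat k i).enorm

theorem aemeasurable_amp_force (h : IsWeakSolution ν f v G p) (k : Z3) :
    AEMeasurable (fun r => amp (f r) k) timeMeasure :=
  Finset.aemeasurable_fun_sum _ fun i _ => (h.aesm_vhat_force k i).enorm

theorem aesm_quadMode {u w : ℝ → T3 → R3} (m : Fin 3 → Fin 3 → ℝ) (k : Z3)
    (hu : ∀ i, AEStronglyMeasurable (fun r => vhat (u r) k i) timeMeasure)
    (hw : ∀ i, AEStronglyMeasurable (fun r => vhat (w r) k i) timeMeasure) :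
    AEStronglyMeasurable (fun r => quadMode m (u r) (w r) k) timeMeasure :=
  Finset.aestronglyMeasurable_fun_sum _ fun i _ => Finset.aestronglyMeasurable_fun_sum _ fun j _ =>
    (Complex.continuous_re.comp_aestronglyMeasurable ((hu i).mul
      (Complex.continuous_conj.comp_aestronglyMeasurable (hw j)))).const_mul _

theorem eLpNorm_two_sq (u : T3 → R3) : (eLpNorm u 2 volume) ^ 2 = ∫⁻ x, ‖u x‖ₑ ^ 2 := by
  rw [eLpNorm_eq_lintegral_rpow_enorm_toReal (by norm_num) (by norm_num)]
  simp only [ENNReal.toReal_ofNat, ENNReal.rpow_ofNat]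
  rw [← ENNReal.rpow_natCast, ← ENNReal.rpow_mul]
  norm_num

theorem le_of_sq_le_sq {x y : ℝ≥0∞} (h : x ^ 2 ≤ y ^ 2) : x ≤ y :=
  (ENNReal.pow_le_pow_left_iff two_ne_zero).1 h

theorem tsum_amp_mul_le {u w : T3 → R3} (hu : MemLp u 2 volume) (hw : MemLp w 2 volume) :
    ∑' k, amp u k * amp w k ≤ 3 * (eLpNorm u 2 volume * eLpNorm w 2 volume) := by
  refine le_of_sq_le_sq ((tsum_mul_sq_le _ _).trans ?_)
  rw [mul_pow, mul_pow, eLpNorm_two_sq, eLpNorm_two_sq]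
  refine (mul_le_mul' (tsum_amp_sq_le hu) (tsum_amp_sq_le hw)).trans (le_of_eq ?_)
  ring

theorem lintegral_amp_mul_lt_top (h : IsWeakSolution ν f v G p) :
    ∫⁻ r, ∑' k, amp (f r) k * amp (v r) k ∂timeMeasure < ⊤ := by
  set C := eLpNorm (fun t => eLpNorm (v t) 2 volume) ⊤ timeMeasure
  have : ∫⁻ r, ∑' k, amp (f r) k * amp (v r) k ∂timeMeasure ≤
      ∫⁻ r, (3 * C) * eLpNorm (f r) 2 volume ∂timeMeasure := by
    refine lintegral_mono_ae ?_
    filter_upwards [h.sobolev, h.memLp_force, ae_eLpNorm_le (v := v)] with r h1 h2 h3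
    refine (tsum_amp_mul_le h2 h1.memLp).trans ?_
    rw [mul_assoc, mul_comm (eLpNorm _ _ _)]
    gcongr
  refine this.trans_lt ?_
  rw [lintegral_const_mul' _ _ (ENNReal.mul_ne_top (by norm_num) h.bound.ne)]
  exact ENNReal.mul_lt_top (ENNReal.mul_lt_top (by norm_num) h.bound) h.force_bound

theorem lintegral_amp_sq_lt_top (h : IsWeakSolution ν f v G p) :
    ∫⁻ r, ∑' k, amp (v r) k * amp (v r) k ∂timeMeasure < ⊤ := by
  set C := eLpNorm (fun t => eLpNorm (v t) 2 volume) ⊤ timeMeasure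
  have : ∫⁻ r, ∑' k, amp (v r) k * amp (v r) k ∂timeMeasure ≤
      ∫⁻ r, 3 * (C * C) ∂timeMeasure := by
    refine lintegral_mono_ae ?_
    filter_upwards [h.sobolev, ae_eLpNorm_le (v := v)] with r h1 h3
    refine (tsum_amp_mul_le h1.memLp h1.memLp).trans ?_
    gcongr
  refine this.trans_lt ?_
  rw [lintegral_const]
  exact ENNReal.mul_lt_top (ENNReal.mul_lt_top (by norm_num) (ENNReal.mul_lt_top h.bound h.bound))
    (measure_lt_top _ _)

theorem integrable_quadMode_of {u w : ℝ → T3 → R3} {m : Fin 3 → Fin 3 → ℝ} {c : ℝ}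
    (hm : ∀ i j, |m i j| ≤ c) (k : Z3)
    (hu : ∀ i, AEStronglyMeasurable (fun r => vhat (u r) k i) timeMeasure)
    (hw : ∀ i, AEStronglyMeasurable (fun r => vhat (w r) k i) timeMeasure)
    (hfin : ∫⁻ r, ∑' k, amp (u r) k * amp (w r) k ∂timeMeasure < ⊤) :
    Integrable (fun r => quadMode m (u r) (w r) k) timeMeasure := by
  refine ⟨aesm_quadMode m k hu hw, ?_⟩
  refine lt_of_le_of_lt (lintegral_mono fun r => (enorm_quadMode_le hm (u r) (w r) k).trans
    (mul_le_mul' le_rfl (ENNReal.le_tsum (f := fun k => amp (u r) k * amp (w r) k) k))) ?_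
  rw [lintegral_const_mul' _ _ ENNReal.ofReal_ne_top]
  exact ENNReal.mul_lt_top ENNReal.ofReal_lt_top hfin

theorem aesm_fluxTerm (h : IsWeakSolution ν f v G p) (A b l : ℝ) (k : Z3) :
    AEStronglyMeasurable (fun r => fluxTerm A b (v r) l k) timeMeasure := by
  have : AEStronglyMeasurable (fun r => -2 * ∑ i, ∑ j, symbol A b i j (l • freq k) *
      (coef (fun x => ∑ q, v r x q * G r x q i) k * conj (vhat (v r) k j)).re) timeMeasure := by
    refine AEStronglyMeasurable.const_mul (Finset.aestronglyMeasurable_fun_sum _ fun i _ =>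
      Finset.aestronglyMeasurable_fun_sum _ fun j _ =>
        (Complex.continuous_re.comp_aestronglyMeasurable ((integrable_coef
          (h.integrable_convection i) k).1.mul
      (Complex.continuous_conj.comp_aestronglyMeasurable (h.aesm_vhat k j)))).const_mul _) _
  refine this.congr ?_
  filter_upwards [h.sobolev] with r hr
  exact (fluxTerm_eq_convection A b hr l k).symm

/-- A qualitative statement: it rests on the H¹ bound at the given ν and is used only for
integrability and for exchanging sum and time integral, never for a rate. -/
theorem tsum_lintegral_fluxTerm (h : IsWeakSolution ν f v G p) (A b : ℝ) {l : ℝ} (hl : 0 < l) :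
    ∑' k, ∫⁻ r, ‖fluxTerm A b (v r) l k‖ₑ ∂timeMeasure < ⊤ := by
  rw [← lintegral_tsum fun k => (h.aesm_fluxTerm A b l k).enorm]
  set C := eLpNorm (fun t => eLpNorm (v t) 2 volume) ⊤ timeMeasure
  set B := ENNReal.ofReal (l⁻¹ * fluxBound A b) * (81 * ((4 * latticeSum) ^ (1 / 2 : ℝ) * C))
  have hB : B < ⊤ := ENNReal.mul_lt_top ENNReal.ofReal_lt_top (ENNReal.mul_lt_top (by norm_num)
    (ENNReal.mul_lt_top (ENNReal.rpow_lt_top_of_nonneg (by norm_num)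
      (ENNReal.mul_lt_top (by norm_num) latticeSum_lt_top).ne) h.bound))
  have : ∫⁻ r, ∑' k, ‖fluxTerm A b (v r) l k‖ₑ ∂timeMeasure ≤
      ∫⁻ r, B * (C ^ 2 + ∫⁻ x, ∑ j : Fin 3, ‖G r x j‖ₑ ^ 2) ∂timeMeasure := by
    refine lintegral_mono_ae ?_
    filter_upwards [h.sobolev, ae_eLpNorm_le (v := v)] with r h1 h3
    refine (tsum_fluxTerm_le A b h1 hl).trans ?_
    have e1 : (∫⁻ x, ‖v r x‖ₑ ^ 2) ^ (1 / 2 : ℝ) ≤ C := by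
      rw [← eLpNorm_two_sq, ← ENNReal.rpow_natCast, ← ENNReal.rpow_mul]
      norm_num
      exact h3
    have e2 : fieldSobolevSq (v r) ≤ C ^ 2 + ∫⁻ x, ∑ j : Fin 3, ‖G r x j‖ₑ ^ 2 := by
      refine (fieldSobolevSq_le h1).trans ?_
      rw [← eLpNorm_two_sq]
      gcongr
    calc _ ≤ ENNReal.ofReal (l⁻¹ * fluxBound A b) * (81 * ((4 * latticeSum) ^ (1 / 2 : ℝ) *
          (C ^ 2 + ∫⁻ x, ∑ j : Fin 3, ‖G r x j‖ₑ ^ 2) * C)) := by gcongr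
      _ = _ := by ring
  refine this.trans_lt ?_
  rw [lintegral_const_mul' _ _ hB.ne, lintegral_add_left measurable_const, lintegral_const]
  exact ENNReal.mul_lt_top hB (ENNReal.add_lt_top.2
    ⟨ENNReal.mul_lt_top (ENNReal.pow_lt_top h.bound) (measure_lt_top _ _), h.grad_bound⟩)

/-- The energy balance filtered by the symbol at the frequency `k`. -/
theorem integral_fluxTerm (h : IsWeakSolution ν f v G p) (A b : ℝ) {l : ℝ} (hl : 0 < l) (k : Z3)
    {t : ℝ} (ht : t ∈ Icc (0 : ℝ) 1) :
    ∫ r in (0 : ℝ)..t, fluxTerm A b (v r) l k =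
      quadMode (fun i j => symbol A b i j (l • freq k)) (v t) (v t) k -
      quadMode (fun i j => symbol A b i j (l • freq k)) (v 0) (v 0) k +
      8 * Real.pi ^ 2 * ν * freqSq k * (∫ r in (0 : ℝ)..t,
        quadMode (fun i j => symbol A b i j (l • freq k)) (v r) (v r) k) -
      2 * ∫ r in (0 : ℝ)..t, quadMode (fun i j => symbol A b i j (l • freq k)) (f r) (v r) k := by
  set m := fun i j => symbol A b i j (l • freq k) with hm
  have hmb : ∀ i j, |m i j| ≤ symbolBound A b := fun i j => abs_symbol_le A b i j _
  have Q := quadratic_sub_eq_integral (z := fun i r => vhat (v r) k i)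
    (g := fun i => modeForce ν f v G p k i) m (fun i j => symbol_comm A b i j _)
    (fun i => h.integrable_modeForce k i) (fun i t ht => h.vhat_eq k i t ht) ht
  have iv := integrable_quadMode_of hmb k (h.aesm_vhat k) (h.aesm_vhat k) h.lintegral_amp_sq_lt_top
  have jf := integrable_quadMode_of hmb k (h.aesm_vhat_force k) (h.aesm_vhat k)
    h.lintegral_amp_mul_lt_top
  have fl : Integrable (fun r => fluxTerm A b (v r) l k) timeMeasure :=
    ⟨h.aesm_fluxTerm A b l k, (ENNReal.le_tsum k).trans_lt (h.tsum_lintegral_fluxTerm A b hl)⟩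
  -- In the derivative of the quadratic form, convection gives the flux, diffusion the multiple
  -- -8π²ν|k|², and the pressure cancels.
  have e : (fun r => 2 * ∑ i, ∑ j, m i j * (modeForce ν f v G p k i r * conj (vhat (v r) k j)).re)
      =ᵐ[timeMeasure] fun r => fluxTerm A b (v r) l k - 8 * Real.pi ^ 2 * ν * freqSq k *
        quadMode m (v r) (v r) k + 2 * quadMode m (f r) (v r) k := by
    filter_upwards [h.sobolev] with r hr
    rw [fluxTerm_eq_convection A b hr l k]
    have pc := pressure_cancel A b hl hr.memLp hr.divFree k
      (2 * Real.pi * Complex.I * coef (p r) k)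
    have ex : ∑ i, ∑ j, m i j * (modeForce ν f v G p k i r * conj (vhat (v r) k j)).re =
        -(4 * Real.pi ^ 2 * ν * freqSq k) * quadMode m (v r) (v r) k -
        (∑ i, ∑ j, m i j * (coef (fun x => ∑ q, v r x q * G r x q i) k *
          conj (vhat (v r) k j)).re) + quadMode m (f r) (v r) k -
        ∑ i, ∑ j, m i j * (2 * Real.pi * Complex.I * coef (p r) k * k i *
          conj (vhat (v r) k j)).re := by
      unfold quadMode
      simp only [Finset.mul_sum, ← Finset.sum_add_distrib, ← Finset.sum_sub_distrib]
      refine Finset.sum_congr rfl fun i _ => Finset.sum_congr rfl fun j _ => ?_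
      have : modeForce ν f v G p k i r * conj (vhat (v r) k j) =
          ((-(4 * Real.pi ^ 2 * ν * freqSq k) : ℝ) : ℂ) * (vhat (v r) k i * conj (vhat (v r) k j)) -
          coef (fun x => ∑ q, v r x q * G r x q i) k * conj (vhat (v r) k j) +
          vhat (f r) k i * conj (vhat (v r) k j) -
          2 * Real.pi * Complex.I * coef (p r) k * k i * conj (vhat (v r) k j) := by
        unfold modeForce freqSq
        push_cast
        ring
      rw [this, Complex.sub_re, Complex.add_re, Complex.sub_re, Complex.re_ofReal_mul]
      ring
    rw [ex, pc]
    ring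
  rw [intervalIntegral_congr_timeMeasure e ht, intervalIntegral.integral_add,
    intervalIntegral.integral_sub, intervalIntegral.integral_const_mul,
    intervalIntegral.integral_const_mul] at Q
  · unfold quadMode at *
    linarith
  · exact intervalIntegrable_of_mem fl ht
  · exact intervalIntegrable_of_mem (iv.const_mul _) ht
  · exact intervalIntegrable_of_mem (fl.sub (iv.const_mul _)) ht
  · exact intervalIntegrable_of_mem (jf.const_mul _) ht

theorem hasSum_force (h : IsWeakSolution ν f v G p) {t : ℝ} (ht : t ∈ Icc (0 : ℝ) 1) :
    HasSum (fun k => ∫ r in (0 : ℝ)..t, quadMode idForm (f r) (v r) k)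
      (∫ r in (0 : ℝ)..t, ∫ x, inner ℝ (f r x) (v r x)) := by
  refine hasSum_intervalIntegral (fun k => aesm_quadMode _ k (h.aesm_vhat_force k) (h.aesm_vhat k))
    ?_ ?_ ht
  · have hle := ENNReal.tsum_le_tsum fun k => lintegral_mono (μ := timeMeasure) fun r =>
      enorm_quadMode_le abs_idForm_le (f r) (v r) k
    refine ne_top_of_le_ne_top ?_ hle
    simp only [ENNReal.ofReal_one, one_mul]
    rw [← lintegral_tsum (f := fun k r => amp (f r) k * amp (v r) k) fun k =>
      (h.aemeasurable_amp_force k).mul (h.aemeasurable_amp k)]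
    exact h.lintegral_amp_mul_lt_top.ne
  · filter_upwards [h.sobolev, h.memLp_force] with r h1 h2
    exact hasSum_quadMode_id h2 h1.memLp

theorem hasSum_flux (h : IsWeakSolution ν f v G p) (A b : ℝ) {l : ℝ} (hl : 0 < l) {t : ℝ}
    (ht : t ∈ Icc (0 : ℝ) 1) :
    HasSum (fun k => ∫ r in (0 : ℝ)..t, fluxTerm A b (v r) l k)
      (2 * Real.pi * ∫ r in (0 : ℝ)..t, structGen A b (v r) l / l) := by
  rw [← intervalIntegral.integral_const_mul]
  refine hasSum_intervalIntegral (fun k => h.aesm_fluxTerm A b l k)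
    (h.tsum_lintegral_fluxTerm A b hl).ne ?_ ht
  filter_upwards [h.sobolev] with r h1
  exact hasSum_fluxTerm A b h1 hl

/-- The defect in the averaged law is controlled by the energy, the viscous term and the work of
the force at scales below `l`. -/
theorem enorm_defect_le (h : IsWeakSolution ν f v G p) (hν : 0 ≤ ν) (A b : ℝ) {l : ℝ} (hl : 0 < l)
    {t : ℝ} (ht : t ∈ Icc (0 : ℝ) 1) :
    ‖2 * Real.pi * (∫ r in (0 : ℝ)..t, structGen A b (v r) l / l) +
        2 * symbolMass A b * dissipation f v t‖ₑ ≤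
      ENNReal.ofReal (symbolBound A b) * (lowSq l (v t) + lowSq l (v 0)) +
      ENNReal.ofReal (8 * Real.pi ^ 2 * ν) * (∫⁻ r, ∑' k, ENNReal.ofReal (freqSq k) *
        (ENNReal.ofReal (symbolSize A b (l • freq k)) * amp (v r) k ^ 2) ∂timeMeasure) +
      2 * ENNReal.ofReal (symbolBound A b) * (∫⁻ r, ∑' k, ENNReal.ofReal (min 1 ‖l • freq k‖) *
        (amp (f r) k * amp (v r) k) ∂timeMeasure) := by
  set Z := symbolMass A b with hZ
  set m := fun (k : Z3) i j => symbol A b i j (l • freq k) with hm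
  -- The multiplier minus its value at the origin is what gains a factor min(1, ℓ|k|).
  set d := fun (k : Z3) i j => m k i j - Z * idForm i j with hd
  have hdb : ∀ k i j, |d k i j| ≤ symbolBound A b * min 1 ‖l • freq k‖ := fun k i j => by
    have := abs_symbol_sub_zero_le A b i j (l • freq k)
    simpa [hd, hm, idForm] using this
  have hmb : ∀ k i j, |m k i j| ≤ symbolBound A b := fun k i j => abs_symbol_le A b i j _
  have hCs : 0 ≤ symbolBound A b := (abs_nonneg _).trans (abs_symbol_le A b 0 0 0)
  have ev : ∀ s ∈ Icc (0 : ℝ) 1, HasSum (fun k => quadMode idForm (v s) (v s) k)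
      (∫ x, ‖v s x‖ ^ 2) := fun s hs => by
    have := hasSum_quadMode_id (h.memLp s hs) (h.memLp s hs)
    simpa only [real_inner_self_eq_norm_sq] using this
  -- The flux series and Parseval's identity for the two energies and the work of the force assemble
  -- the whole defect into one series, to be estimated term by term.
  have H := (((h.hasSum_flux A b hl ht).sub ((ev t ht).mul_left Z)).add
    ((ev 0 ⟨le_rfl, zero_le_one⟩).mul_left Z)).add ((h.hasSum_force ht).mul_left (2 * Z))
  have e : 2 * Real.pi * (∫ r in (0 : ℝ)..t, structGen A b (v r) l / l) + 2 * Z * dissipation f v t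
      = 2 * Real.pi * (∫ r in (0 : ℝ)..t, structGen A b (v r) l / l) - Z * (∫ x, ‖v t x‖ ^ 2) +
        Z * (∫ x, ‖v 0 x‖ ^ 2) + 2 * Z * ∫ r in (0 : ℝ)..t, ∫ x, inner ℝ (f r x) (v r x) := by
    unfold dissipation; ring
  rw [e, ← H.tsum_eq]
  refine enorm_tsum_le_tsum_enorm.trans ?_
  -- Only the viscous term keeps the full symbol m: the quantity ε has no viscous part from which Z
  -- could be subtracted.
  have hterm : ∀ k, (∫ r in (0 : ℝ)..t, fluxTerm A b (v r) l k) - Z * quadMode idForm (v t) (v t) k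
      + Z * quadMode idForm (v 0) (v 0) k +
        2 * Z * (∫ r in (0 : ℝ)..t, quadMode idForm (f r) (v r) k) =
      quadMode (d k) (v t) (v t) k - quadMode (d k) (v 0) (v 0) k +
      8 * Real.pi ^ 2 * ν * freqSq k * (∫ r in (0 : ℝ)..t, quadMode (m k) (v r) (v r) k) -
      2 * ∫ r in (0 : ℝ)..t, quadMode (d k) (f r) (v r) k := fun k => by
    rw [h.integral_fluxTerm A b hl k ht]
    have e1 : ∫ r in (0 : ℝ)..t, quadMode (d k) (f r) (v r) k =
        (∫ r in (0 : ℝ)..t, quadMode (m k) (f r) (v r) k) -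
        Z * ∫ r in (0 : ℝ)..t, quadMode idForm (f r) (v r) k := by
      simp only [hd, ← quadMode_sub]
      rw [intervalIntegral.integral_sub, intervalIntegral.integral_const_mul]
      · exact intervalIntegrable_of_mem (integrable_quadMode_of (hmb k) k (h.aesm_vhat_force k)
          (h.aesm_vhat k) h.lintegral_amp_mul_lt_top) ht
      · exact intervalIntegrable_of_mem ((integrable_quadMode_of abs_idForm_le k
          (h.aesm_vhat_force k) (h.aesm_vhat k) h.lintegral_amp_mul_lt_top).const_mul _) ht
    rw [e1]
    simp only [hd, ← quadMode_sub]
    ring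
  have hb : ∀ k, ‖quadMode (d k) (v t) (v t) k - quadMode (d k) (v 0) (v 0) k +
      8 * Real.pi ^ 2 * ν * freqSq k * (∫ r in (0 : ℝ)..t, quadMode (m k) (v r) (v r) k) -
      2 * ∫ r in (0 : ℝ)..t, quadMode (d k) (f r) (v r) k‖ₑ ≤
      ENNReal.ofReal (symbolBound A b) * (ENNReal.ofReal (min 1 ‖l • freq k‖) * amp (v t) k ^ 2) +
      ENNReal.ofReal (symbolBound A b) * (ENNReal.ofReal (min 1 ‖l • freq k‖) * amp (v 0) k ^ 2) +
      ENNReal.ofReal (8 * Real.pi ^ 2 * ν) * (∫⁻ r, ENNReal.ofReal (freqSq k) *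
        (ENNReal.ofReal (symbolSize A b (l • freq k)) * amp (v r) k ^ 2) ∂timeMeasure) +
      2 * ENNReal.ofReal (symbolBound A b) * (∫⁻ r, ENNReal.ofReal (min 1 ‖l • freq k‖) *
        (amp (f r) k * amp (v r) k) ∂timeMeasure) := fun k => by
    refine (enorm_sub_le).trans (add_le_add ((enorm_add_le _ _).trans (add_le_add
      (enorm_sub_le.trans (add_le_add ?_ ?_)) ?_)) ?_)
    · refine (enorm_quadMode_le (hdb k) _ _ k).trans (le_of_eq ?_)
      rw [ENNReal.ofReal_mul hCs, sq, mul_assoc]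
    · refine (enorm_quadMode_le (hdb k) _ _ k).trans (le_of_eq ?_)
      rw [ENNReal.ofReal_mul hCs, sq, mul_assoc]
    · rw [enorm_mul, lintegral_const_mul' _ _ ENNReal.ofReal_ne_top, ← mul_assoc,
        ← ENNReal.ofReal_mul (by positivity), Real.enorm_of_nonneg
          (mul_nonneg (by positivity) (freqSq_nonneg k))]
      refine mul_le_mul' le_rfl ((enorm_intervalIntegral_le _ ht).trans (lintegral_mono fun r => ?_))
      rw [sq]
      exact enorm_quadMode_le (fun i j => abs_symbol_le_size A b _ i j) _ _ k
    · rw [enorm_mul, mul_assoc]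
      refine mul_le_mul' (le_of_eq (by simp [enorm_eq_nnnorm])) ?_
      rw [← lintegral_const_mul' _ _ ENNReal.ofReal_ne_top]
      refine (enorm_intervalIntegral_le _ ht).trans (lintegral_mono fun r => ?_)
      refine (enorm_quadMode_le (hdb k) _ _ k).trans (le_of_eq ?_)
      rw [ENNReal.ofReal_mul hCs, mul_assoc]
  refine (ENNReal.tsum_le_tsum fun k => ((congrArg _ (hterm k)).le.trans (hb k))).trans
    (le_of_eq ?_)
  rw [lintegral_tsum fun k => ((h.aemeasurable_amp k).pow_const 2).const_mul _ |>.const_mul _,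
    lintegral_tsum (f := fun k r => ENNReal.ofReal (min 1 ‖l • freq k‖) * (amp (f r) k * amp (v r) k))
      fun k => ((h.aemeasurable_amp_force k).mul (h.aemeasurable_amp k)).const_mul _,
    ENNReal.tsum_add, ENNReal.tsum_add, ENNReal.tsum_add, ENNReal.tsum_mul_left,
    ENNReal.tsum_mul_left, ENNReal.tsum_mul_left, ENNReal.tsum_mul_left, mul_add]
  rfl

end IsWeakSolution

/-! ### Bounds at a fixed time -/

theorem min_one_le_rpow {x s : ℝ} (hx : 0 ≤ x) (hs : 0 ≤ s) (hs1 : s ≤ 1) : min 1 x ≤ x ^ s := by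
  rcases le_total x 1 with h | h
  · rw [min_eq_right h]
    rcases hx.eq_or_lt with rfl | h0
    · exact Real.rpow_nonneg le_rfl _
    · simpa using Real.rpow_le_rpow_of_exponent_ge h0 h hs1
  · rw [min_eq_left h]
    exact Real.one_le_rpow h hs

theorem norm_freq_sq (k : Z3) : ‖freq k‖ ^ 2 = freqSq k := by
  simp [EuclideanSpace.real_norm_sq_eq, freq_apply, freqSq]

theorem freqSq_le_bracket (k : Z3) : freqSq k ≤ bracket k := by
  unfold bracket freqSq; linarith

theorem norm_smul_freq {l : ℝ} (hl : 0 < l) (k : Z3) : ‖l • freq k‖ = l * ‖freq k‖ := by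
  rw [norm_smul, Real.norm_of_nonneg hl.le]

theorem norm_freq_rpow_le (k : Z3) {s : ℝ} (hs : 0 ≤ s) : ‖freq k‖ ^ (2 * s) ≤ bracket k ^ s := by
  rw [Real.rpow_mul (norm_nonneg _), Real.rpow_two, norm_freq_sq]
  exact Real.rpow_le_rpow (freqSq_nonneg k) (freqSq_le_bracket k) hs

theorem norm_freq_le_bracket (k : Z3) : ‖freq k‖ ≤ bracket k := by
  refine (sq_le_sq₀ (norm_nonneg _) (bracket_pos k).le).1 ?_
  rw [norm_freq_sq]
  nlinarith [freqSq_le_bracket k, one_le_bracket k]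

/-- The weighted energy with weight `(1 + |k|²)^s`. -/
def fracSq (s : ℝ) (u : T3 → R3) : ℝ≥0∞ := ∑' k, ENNReal.ofReal (bracket k ^ s) * amp u k ^ 2

/-- The crude bound |k| ≤ 1 + |k|² suffices, since any positive power of ℓ will do. -/
theorem lowSq_le_fracSq {s l : ℝ} (hs : 0 ≤ s) (hs1 : s ≤ 1) (hl : 0 < l) (u : T3 → R3) :
    lowSq l u ≤ ENNReal.ofReal (l ^ s) * fracSq s u := by
  unfold lowSq fracSq
  rw [← ENNReal.tsum_mul_left]
  refine ENNReal.tsum_le_tsum fun k => ?_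
  rw [← mul_assoc, ← ENNReal.ofReal_mul (by positivity)]
  refine mul_le_mul' (ENNReal.ofReal_le_ofReal ?_) le_rfl
  refine (min_one_le_rpow (norm_nonneg _) hs hs1).trans ?_
  rw [norm_smul_freq hl, Real.mul_rpow hl.le (norm_nonneg _)]
  gcongr
  exact norm_freq_le_bracket k

theorem lowSq_le_tsum (l : ℝ) (u : T3 → R3) : lowSq l u ≤ ∑' k, amp u k ^ 2 := by
  refine ENNReal.tsum_le_tsum fun k => mul_le_of_le_one_left zero_le ?_
  rw [← ENNReal.ofReal_one]
  exact ENNReal.ofReal_le_ofReal (min_le_left _ _)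

theorem lowSq_le (l : ℝ) {u : T3 → R3} (hu : MemLp u 2 volume) :
    lowSq l u ≤ 3 * eLpNorm u 2 volume ^ 2 := by
  rw [IsWeakSolution.eLpNorm_two_sq]
  exact (lowSq_le_tsum l u).trans (tsum_amp_sq_le hu)

theorem tsum_rpow_mul_rpow_le {ι : Type*} (x y : ι → ℝ≥0∞) {p q : ℝ} (hp : 0 ≤ p) (hq : 0 ≤ q)
    (hpq : p + q = 1) : ∑' i, x i ^ p * y i ^ q ≤ (∑' i, x i) ^ p * (∑' i, y i) ^ q := by
  let _ : MeasurableSpace ι := ⊤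
  have h := ENNReal.lintegral_mul_norm_pow_le (μ := Measure.count) (f := x) (g := y)
    measurable_from_top.aemeasurable measurable_from_top.aemeasurable hp hq hpq
  simpa only [lintegral_count] using h

/-- Interpolation between `L²` and `H^α`. -/
theorem fracSq_le_interpolation {α q : ℝ} (hq : 0 ≤ q) (hq2 : q ≤ 2) {u : T3 → R3}
    (hu : MemLp u 2 volume) :
    fracSq (α * q / 2) u ≤ 3 * (sobolevNorm α u ^ q * eLpNorm u 2 volume ^ (2 - q)) := by
  set c := fun k : Z3 => ∑ i, ‖vhat u k i‖ₑ ^ 2 with hc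
  set W := fun k : Z3 => ENNReal.ofReal (bracket k ^ α) with hW
  -- The weighted term is written as (⟨k⟩^{2α}|û|²)^{q/2} (|û|²)^{1-q/2}, where ⟨k⟩² = 1 + |k|², and
  -- Hölder's inequality for sums follows.
  have h1 : fracSq (α * q / 2) u ≤ 3 * ∑' k, (W k * c k) ^ (q / 2) * c k ^ (1 - q / 2) := by
    unfold fracSq
    rw [← ENNReal.tsum_mul_left]
    refine ENNReal.tsum_le_tsum fun k => ?_
    have e : (W k * c k) ^ (q / 2) * c k ^ (1 - q / 2) =
        ENNReal.ofReal (bracket k ^ (α * q / 2)) * c k := by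
      rw [ENNReal.mul_rpow_of_nonneg _ _ (by positivity), mul_assoc,
        ← ENNReal.rpow_add_of_nonneg _ _ (by positivity) (by linarith), hW,
        ENNReal.ofReal_rpow_of_nonneg (Real.rpow_nonneg (bracket_pos k).le _) (by positivity),
        ← Real.rpow_mul (bracket_pos k).le]
      have e1 : q / 2 + (1 - q / 2) = 1 := by ring
      rw [e1, ENNReal.rpow_one, mul_div_assoc]
    rw [e, mul_left_comm]
    gcongr
    exact amp_sq_le u k
  refine h1.trans (mul_le_mul' le_rfl ?_)
  refine (tsum_rpow_mul_rpow_le _ _ (by positivity) (by linarith) (by ring)).trans (le_of_eq ?_)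
  have e1 : (∑' k, W k * c k) ^ (q / 2) = sobolevNorm α u ^ q := by
    unfold sobolevNorm
    rw [← ENNReal.rpow_mul]
    congr 1
    ring
  have e2 : (∑' k, c k) ^ (1 - q / 2) = eLpNorm u 2 volume ^ (2 - q) := by
    rw [hc, tsum_vhat_sq hu, ← IsWeakSolution.eLpNorm_two_sq, ← ENNReal.rpow_natCast,
      ← ENNReal.rpow_mul]
    congr 1
    push_cast
    ring
  rw [e1, e2]

theorem tsum_freqSq_le (u : T3 → R3) :
    ∑' k, ENNReal.ofReal (freqSq k) * amp u k ^ 2 ≤ 3 * fieldSobolevSq u := by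
  unfold fieldSobolevSq sobolevSq
  rw [← Summable.tsum_finsetSum fun _ _ => ENNReal.summable, ← ENNReal.tsum_mul_left]
  refine ENNReal.tsum_le_tsum fun k => ?_
  rw [← Finset.mul_sum, mul_left_comm]
  exact mul_le_mul' (ENNReal.ofReal_le_ofReal (freqSq_le_bracket k)) (amp_sq_le u k)

theorem symbolBound_nonneg (A b : ℝ) : 0 ≤ symbolBound A b :=
  (abs_nonneg _).trans (abs_symbol_le A b 0 0 0)

theorem symbolSize_nonneg (A b : ℝ) (ξ : R3) : 0 ≤ symbolSize A b ξ :=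
  Finset.sum_nonneg fun _ _ => Finset.sum_nonneg fun _ _ => abs_nonneg _

theorem symbolSize_le (A b : ℝ) (ξ : R3) : symbolSize A b ξ ≤ 9 * symbolBound A b := by
  unfold symbolSize
  refine (Finset.sum_le_sum fun i _ => Finset.sum_le_sum fun j _ =>
    abs_symbol_le A b i j ξ).trans (le_of_eq ?_)
  simp
  ring

theorem tendsto_symbolSize (A b : ℝ) : Tendsto (symbolSize A b) (cocompact R3) (𝓝 0) := by
  have : Tendsto (fun ξ => ∑ i : Fin 3, ∑ j : Fin 3, |symbol A b i j ξ|) (cocompact R3)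
      (𝓝 (∑ i : Fin 3, ∑ j : Fin 3, |(0 : ℝ)|)) :=
    tendsto_finsetSum _ fun i _ => tendsto_finsetSum _ fun j _ => (tendsto_symbol A b i j).abs
  simp only [abs_zero, Finset.sum_const_zero] at this
  exact this

theorem exists_symbolSize_le (A b : ℝ) {η : ℝ} (hη : 0 < η) :
    ∃ R : ℝ, 0 < R ∧ ∀ ξ : R3, R ≤ ‖ξ‖ → symbolSize A b ξ ≤ η := by
  have h := (tendsto_symbolSize A b).eventually (gt_mem_nhds hη)
  rw [← Metric.cobounded_eq_cocompact, ← comap_norm_atTop, eventually_comap] at h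
  obtain ⟨R, hR⟩ := eventually_atTop.1 h
  exact ⟨max R 1, lt_max_of_lt_right one_pos, fun ξ hξ =>
    (hR ‖ξ‖ ((le_max_left _ _).trans hξ) ξ rfl).le⟩

/-- Frequencies are split at ℓ|k| = R. Above, the smallness η of the symbol is paired with the full
H¹ norm. Below, |k|² = |k|^{2s} |k|^{2-2s} with |k| ≤ R/ℓ trades the missing derivatives for a
negative power of ℓ. -/
theorem tsum_viscous_le (A b : ℝ) {η R s l : ℝ} (hR : 0 < R)
    (hη : ∀ ξ : R3, R ≤ ‖ξ‖ → symbolSize A b ξ ≤ η) (hs : 0 ≤ s) (hs1 : s ≤ 1) (hl : 0 < l)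
    (u : T3 → R3) :
    ∑' k, ENNReal.ofReal (freqSq k) *
      (ENNReal.ofReal (symbolSize A b (l • freq k)) * amp u k ^ 2) ≤
      ENNReal.ofReal η * (3 * fieldSobolevSq u) +
      ENNReal.ofReal (9 * symbolBound A b * (R / l) ^ (2 - 2 * s)) * fracSq s u := by
  refine le_trans ?_ (add_le_add (mul_le_mul' le_rfl (tsum_freqSq_le u)) le_rfl)
  unfold fracSq
  rw [← ENNReal.tsum_mul_left, ← ENNReal.tsum_mul_left, ← ENNReal.tsum_add]
  refine ENNReal.tsum_le_tsum fun k => ?_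
  rcases le_or_gt R ‖l • freq k‖ with h | h
  · refine le_trans ?_ le_self_add
    rw [mul_left_comm]
    gcongr
    exact hη _ h
  · refine le_trans ?_ le_add_self
    rw [← mul_assoc, ← mul_assoc, ← ENNReal.ofReal_mul (freqSq_nonneg k), ← ENNReal.ofReal_mul
      (mul_nonneg (mul_nonneg (by norm_num) (symbolBound_nonneg A b)) (by positivity))]
    refine mul_le_mul' (ENNReal.ofReal_le_ofReal ?_) le_rfl
    rw [norm_smul_freq hl] at h
    have h' : ‖freq k‖ ≤ R / l := by
      rw [le_div_iff₀ hl, mul_comm]; exact h.le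
    have e : freqSq k = ‖freq k‖ ^ (2 * s) * ‖freq k‖ ^ (2 - 2 * s) := by
      rw [← Real.rpow_add_of_nonneg (norm_nonneg _) (by linarith) (by linarith), ← norm_freq_sq,
        ← Real.rpow_two]
      congr 1
      ring
    have h2 : freqSq k ≤ bracket k ^ s * (R / l) ^ (2 - 2 * s) := by
      rw [e]
      refine mul_le_mul (norm_freq_rpow_le k hs) (Real.rpow_le_rpow (norm_nonneg _) h' (by linarith))
        (Real.rpow_nonneg (norm_nonneg _) _) (Real.rpow_nonneg (bracket_pos k).le _)
    calc freqSq k * symbolSize A b (l • freq k)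
        ≤ (bracket k ^ s * (R / l) ^ (2 - 2 * s)) * (9 * symbolBound A b) :=
          mul_le_mul h2 (symbolSize_le A b _) (symbolSize_nonneg A b _)
            ((freqSq_nonneg k).trans h2)
      _ = _ := by ring

/-- Cauchy–Schwarz over frequencies, with the whole weight put on the velocity, where smallness is
known. The square of the weight is at most the weight, and 3 ≤ 2² gives the constant. -/
theorem tsum_force_le (l : ℝ) {g u : T3 → R3} (hg : MemLp g 2 volume) :
    ∑' k, ENNReal.ofReal (min 1 ‖l • freq k‖) * (amp g k * amp u k) ≤
      2 * (eLpNorm g 2 volume * lowSq l u ^ (1 / 2 : ℝ)) := by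
  have e : ∀ k, ENNReal.ofReal (min 1 ‖l • freq k‖) * (amp g k * amp u k) =
      amp g k * (ENNReal.ofReal (min 1 ‖l • freq k‖) * amp u k) := fun k => by ring
  simp only [e]
  refine IsWeakSolution.le_of_sq_le_sq ((tsum_mul_sq_le _ _).trans ?_)
  have h1 : ∑' k, (ENNReal.ofReal (min 1 ‖l • freq k‖) * amp u k) ^ 2 ≤ lowSq l u := by
    refine ENNReal.tsum_le_tsum fun k => ?_
    rw [mul_pow]
    refine mul_le_mul' ?_ le_rfl
    rw [sq]
    refine mul_le_of_le_one_left zero_le ?_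
    rw [← ENNReal.ofReal_one]
    exact ENNReal.ofReal_le_ofReal (min_le_left _ _)
  have h2 : (lowSq l u ^ (1 / 2 : ℝ)) ^ 2 = lowSq l u := by
    rw [← ENNReal.rpow_natCast, ← ENNReal.rpow_mul]
    norm_num
  rw [mul_pow, mul_pow, h2, IsWeakSolution.eLpNorm_two_sq]
  calc _ ≤ (3 * ∫⁻ x, ‖g x‖ₑ ^ 2) * lowSq l u := mul_le_mul' (tsum_amp_sq_le hg) h1
    _ ≤ (2 ^ 2 * ∫⁻ x, ‖g x‖ₑ ^ 2) * lowSq l u := by gcongr; norm_num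
    _ = _ := by ring

/-- A threshold inequality. -/
theorem le_add_rpow {c : ℝ≥0∞} (h0 : c ≠ 0) (ht : c ≠ ⊤) {σ : ℝ} (hσ : 0 ≤ σ) (x : ℝ≥0∞) :
    x ≤ c + c ^ (-σ) * x ^ (1 + σ) := by
  rcases le_total x c with h | h
  · exact h.trans le_self_add
  · refine le_trans ?_ le_add_self
    rw [ENNReal.rpow_add_of_nonneg _ _ zero_le_one hσ, ENNReal.rpow_one]
    calc x = c ^ (-σ) * (x * c ^ σ) := by
          rw [mul_left_comm, ENNReal.rpow_neg, ENNReal.inv_mul_cancel, mul_one]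
          · simp [ENNReal.rpow_eq_zero_iff, h0, ht]
          · exact ENNReal.rpow_ne_top_of_nonneg hσ ht
      _ ≤ _ := by gcongr

/-- Dominated convergence over frequencies. It yields no rate, which is harmless because it will be
applied to the single initial datum shared by all ν. -/
theorem tendsto_lowSq_zero {u : T3 → R3} (hu : MemLp u 2 volume) :
    Tendsto (fun l => lowSq l u) (𝓝[>] 0) (𝓝 0) := by
  have hfin : ∑' k, amp u k ^ 2 ≠ ⊤ :=
    ne_top_of_le_ne_top (ENNReal.mul_lt_top (by norm_num) (lintegral_enorm_sq_lt_top hu)).ne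
      (tsum_amp_sq_le hu)
  let _ : MeasurableSpace Z3 := ⊤
  have e : (fun l => lowSq l u) = fun l : ℝ => ∫⁻ k : Z3, ENNReal.ofReal (min 1 ‖l • freq k‖) *
      amp u k ^ 2 ∂Measure.count := by
    funext l
    rw [lintegral_count]
    rfl
  have e0 : (0 : ℝ≥0∞) = ∫⁻ k : Z3, 0 ∂Measure.count := by simp
  rw [e, e0]
  refine tendsto_lintegral_filter_of_dominated_convergence (fun k => amp u k ^ 2)
    (Eventually.of_forall fun _ => measurable_from_top) ?_ (by rwa [lintegral_count]) ?_
  · refine Eventually.of_forall fun l => ae_of_all _ fun k => mul_le_of_le_one_left zero_le ?_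
    rw [← ENNReal.ofReal_one]
    exact ENNReal.ofReal_le_ofReal (min_le_left _ _)
  · refine ae_of_all _ fun k => ?_
    have h1 : Tendsto (fun l : ℝ => min 1 ‖l • freq k‖) (𝓝[>] 0) (𝓝 0) := by
      have : Continuous fun l : ℝ => min 1 ‖l • freq k‖ := by fun_prop
      have h := this.tendsto 0
      simp only [zero_smul, norm_zero] at h
      rw [min_eq_right zero_le_one] at h
      exact h.mono_left nhdsWithin_le_nhds
    have h2 : Tendsto (fun l : ℝ => ENNReal.ofReal (min 1 ‖l • freq k‖)) (𝓝[>] 0) (𝓝 0) := by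
      simpa using ENNReal.tendsto_ofReal h1
    have h3 := ENNReal.Tendsto.mul_const h2
      (Or.inr (ne_top_of_le_ne_top hfin (ENNReal.le_tsum (f := fun k => amp u k ^ 2) k)))
    simpa using h3

/-! ### Bounds integrated in time -/

theorem timeMeasure_univ : timeMeasure univ = 1 := by simp [timeMeasure]

/-- A solution and its force are bounded by `B` in the spaces of the uniform bound. -/
structure IsBoundedBy (B : ℝ≥0∞) (σ α q : ℝ) (f v : ℝ → T3 → R3) : Prop where
  velocity : ∀ᵐ r ∂timeMeasure, eLpNorm (v r) 2 volume ≤ B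
  sobolev : ∫⁻ r, sobolevNorm α (v r) ^ q ∂timeMeasure ≤ B ^ q
  force : ∫⁻ r, eLpNorm (f r) 2 volume ^ (1 + σ) ∂timeMeasure ≤ B ^ (1 + σ)

theorem aemeasurable_eLpNorm {F : Type*} [NormedAddCommGroup F] {a : ℝ → T3 → F}
    (ha : AEStronglyMeasurable (Function.uncurry a) (timeMeasure.prod volume)) :
    AEMeasurable (fun r => eLpNorm (a r) 2 volume) timeMeasure := by
  have e : (fun r => eLpNorm (a r) 2 volume) = fun r => (∫⁻ x, ‖a r x‖ₑ ^ (2 : ℝ)) ^ (1 / 2 : ℝ) := by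
    funext r
    rw [eLpNorm_eq_lintegral_rpow_enorm_toReal (by norm_num) (by norm_num)]
    simp
  rw [e]
  exact (AEMeasurable.lintegral_prod_right' (ha.enorm.pow_const 2)).pow_const _

namespace IsWeakSolution

variable {ν : ℝ} {f v : ℝ → T3 → R3} {G : ℝ → T3 → Fin 3 → R3} {p : ℝ → T3 → ℝ}
  {B : ℝ≥0∞} {σ α q : ℝ}

theorem aemeasurable_lowSq (h : IsWeakSolution ν f v G p) (l : ℝ) :
    AEMeasurable (fun r => lowSq l (v r)) timeMeasure :=
  AEMeasurable.tsum fun k => ((h.aemeasurable_amp k).pow_const 2).const_mul _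

theorem ae_memLp (h : IsWeakSolution ν f v G p) : ∀ᵐ r ∂timeMeasure, MemLp (v r) 2 volume :=
  h.sobolev.mono fun _ hr => hr.memLp

/-- With s = αq/2 the exponents in time match: q powers of the H^α norm are integrable and the
remaining 2 - q fall on the bounded L² norm. -/
theorem lintegral_fracSq_le (h : IsWeakSolution ν f v G p) (hb : IsBoundedBy B σ α q f v)
    (hB : B ≠ ⊤) (hq : 1 ≤ q) (hq2 : q ≤ 2) :
    ∫⁻ r, fracSq (α * q / 2) (v r) ∂timeMeasure ≤ 3 * B ^ 2 := by
  have h1 : ∫⁻ r, fracSq (α * q / 2) (v r) ∂timeMeasure ≤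
      ∫⁻ r, (3 * B ^ (2 - q)) * sobolevNorm α (v r) ^ q ∂timeMeasure := by
    refine lintegral_mono_ae ?_
    filter_upwards [h.ae_memLp, hb.velocity] with r h1 h2
    refine (fracSq_le_interpolation (by linarith) hq2 h1).trans ?_
    rw [mul_assoc, mul_comm (B ^ _)]
    gcongr
  refine h1.trans ?_
  rw [lintegral_const_mul' _ _ (ENNReal.mul_ne_top (by norm_num)
    (ENNReal.rpow_ne_top_of_nonneg (by linarith) hB)), mul_assoc]
  refine mul_le_mul' le_rfl ((mul_le_mul' le_rfl hb.sobolev).trans (le_of_eq ?_))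
  rw [← ENNReal.rpow_add_of_nonneg _ _ (by linarith) (by linarith), ← ENNReal.rpow_two]
  congr 1
  ring

theorem lintegral_lowSq_le (h : IsWeakSolution ν f v G p) (hb : IsBoundedBy B σ α q f v)
    (hB : B ≠ ⊤) (hα : 0 ≤ α) (hα1 : α ≤ 1) (hq : 1 ≤ q) (hq2 : q ≤ 2) {l : ℝ} (hl : 0 < l) :
    ∫⁻ r, lowSq l (v r) ∂timeMeasure ≤ ENNReal.ofReal (l ^ (α * q / 2)) * (3 * B ^ 2) := by
  refine (lintegral_mono fun r => lowSq_le_fracSq (s := α * q / 2) (by positivity) (by nlinarith)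
    hl (v r)).trans ?_
  rw [lintegral_const_mul' _ _ ENNReal.ofReal_ne_top]
  exact mul_le_mul' le_rfl (h.lintegral_fracSq_le hb hB hq hq2)

theorem ae_lowSq_le (h : IsWeakSolution ν f v G p) (hb : IsBoundedBy B σ α q f v) (l : ℝ) :
    ∀ᵐ r ∂timeMeasure, lowSq l (v r) ≤ 3 * B ^ 2 := by
  filter_upwards [h.ae_memLp, hb.velocity] with r h1 h2
  refine (lowSq_le l h1).trans ?_
  gcongr

/-- The force is split at height c by `le_add_rpow`. The part of size c meets the small time
integral of the weighted velocity, and the excess is small for large c through its moment of order 1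
+ σ. -/
theorem lintegral_force_le (h : IsWeakSolution ν f v G p) (hb : IsBoundedBy B σ α q f v)
    (hB : B ≠ ⊤) (hσ : 0 ≤ σ) (hα : 0 ≤ α) (hα1 : α ≤ 1) (hq : 1 ≤ q) (hq2 : q ≤ 2) {l : ℝ}
    (hl : 0 < l) {c : ℝ≥0∞} (hc : c ≠ 0) (hc' : c ≠ ⊤) :
    ∫⁻ r, ∑' k, ENNReal.ofReal (min 1 ‖l • freq k‖) * (amp (f r) k * amp (v r) k) ∂timeMeasure ≤
      2 * (c * (ENNReal.ofReal (l ^ (α * q / 2)) * (3 * B ^ 2)) ^ (1 / 2 : ℝ) +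
        c ^ (-σ) * (3 * B ^ 2) ^ (1 / 2 : ℝ) * B ^ (1 + σ)) := by
  have hB2 : (3 * B ^ 2) ^ (1 / 2 : ℝ) ≠ ⊤ := ENNReal.rpow_ne_top_of_nonneg (by norm_num)
    (ENNReal.mul_ne_top (by norm_num) (ENNReal.pow_ne_top hB))
  have hcσ : c ^ (-σ) ≠ ⊤ := by
    simp [ENNReal.rpow_eq_top_iff, hc, hc']
  have h1 : ∫⁻ r, ∑' k, ENNReal.ofReal (min 1 ‖l • freq k‖) *
      (amp (f r) k * amp (v r) k) ∂timeMeasure ≤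
      ∫⁻ r, 2 * (c * lowSq l (v r) ^ (1 / 2 : ℝ) +
        (c ^ (-σ) * (3 * B ^ 2) ^ (1 / 2 : ℝ)) * eLpNorm (f r) 2 volume ^ (1 + σ)) ∂timeMeasure := by
    refine lintegral_mono_ae ?_
    filter_upwards [h.memLp_force, h.ae_lowSq_le hb l] with r h1 h2
    refine (tsum_force_le l h1).trans (mul_le_mul' le_rfl ?_)
    calc _ ≤ (c + c ^ (-σ) * eLpNorm (f r) 2 volume ^ (1 + σ)) * lowSq l (v r) ^ (1 / 2 : ℝ) :=
          mul_le_mul' (le_add_rpow hc hc' hσ _) le_rfl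
      _ = c * lowSq l (v r) ^ (1 / 2 : ℝ) +
          c ^ (-σ) * lowSq l (v r) ^ (1 / 2 : ℝ) * eLpNorm (f r) 2 volume ^ (1 + σ) := by ring
      _ ≤ _ := by gcongr
  refine h1.trans ?_
  rw [lintegral_const_mul' _ _ (by norm_num), lintegral_add_left'
    (((h.aemeasurable_lowSq l).pow_const _).const_mul _), lintegral_const_mul' _ _ hc',
    lintegral_const_mul' _ _ (ENNReal.mul_ne_top hcσ hB2)]
  have h2 := ENNReal.lintegral_mul_norm_pow_le (μ := timeMeasure) (h.aemeasurable_lowSq l)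
    (g := fun _ => 1) aemeasurable_const (p := 1 / 2) (q := 1 / 2) (by norm_num) (by norm_num)
    (by norm_num)
  simp only [ENNReal.one_rpow, mul_one, lintegral_const, timeMeasure_univ] at h2
  gcongr
  · refine h2.trans ?_
    gcongr
    exact h.lintegral_lowSq_le hb hB hα hα1 hq hq2 hl
  · exact hb.force

theorem lintegral_viscous_le (h : IsWeakSolution ν f v G p) (hb : IsBoundedBy B σ α q f v)
    (hB : B ≠ ⊤) (hα : 0 ≤ α) (hα1 : α ≤ 1) (hq : 1 ≤ q) (hq2 : q ≤ 2) (A b : ℝ) {η R l : ℝ}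
    (hl : 0 < l) (hν : 0 ≤ ν) (hR : 0 < R)
    (hη : ∀ ξ : R3, R ≤ ‖ξ‖ → symbolSize A b ξ ≤ η) {E : ℝ≥0∞}
    (hE : ENNReal.ofReal ν * ∫⁻ r, (∫⁻ x, ∑ j : Fin 3, ‖G r x j‖ₑ ^ 2) ∂timeMeasure ≤ E) :
    ENNReal.ofReal ν * ∫⁻ r, ∑' k, ENNReal.ofReal (freqSq k) *
        (ENNReal.ofReal (symbolSize A b (l • freq k)) * amp (v r) k ^ 2) ∂timeMeasure ≤
      ENNReal.ofReal η * (3 * (ENNReal.ofReal ν * B ^ 2 + E)) +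
      ENNReal.ofReal (9 * symbolBound A b * (ν * (R / l) ^ (2 - α * q))) * (3 * B ^ 2) := by
  set s := α * q / 2 with hs
  have hs0 : 0 ≤ s := by positivity
  have hs1 : s ≤ 1 := by rw [hs]; nlinarith
  have h1 : ∫⁻ r, ∑' k, ENNReal.ofReal (freqSq k) *
        (ENNReal.ofReal (symbolSize A b (l • freq k)) * amp (v r) k ^ 2) ∂timeMeasure ≤
      ∫⁻ r, (ENNReal.ofReal η * 3 * (B ^ 2 + ∫⁻ x, ∑ j : Fin 3, ‖G r x j‖ₑ ^ 2) +
        ENNReal.ofReal (9 * symbolBound A b * (R / l) ^ (2 - 2 * s)) *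
          fracSq s (v r)) ∂timeMeasure := by
    refine lintegral_mono_ae ?_
    filter_upwards [h.sobolev, hb.velocity] with r h1 h2
    refine (tsum_viscous_le A b hR hη hs0 hs1 hl (v r)).trans ?_
    refine add_le_add ?_ le_rfl
    rw [mul_assoc]
    refine mul_le_mul' le_rfl (mul_le_mul' le_rfl ((fieldSobolevSq_le h1).trans ?_))
    rw [← eLpNorm_two_sq]
    gcongr
  have hm : AEMeasurable (fun r => fracSq s (v r)) timeMeasure :=
    AEMeasurable.tsum fun k => ((h.aemeasurable_amp k).pow_const 2).const_mul _
  have e2 : 2 - 2 * s = 2 - α * q := by rw [hs]; ring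
  have h9 : 0 ≤ 9 * symbolBound A b * (R / l) ^ (2 - 2 * s) :=
    mul_nonneg (mul_nonneg (by norm_num) (symbolBound_nonneg A b)) (by positivity)
  rw [lintegral_add_right' _ (hm.const_mul _), lintegral_const_mul' _ _ (ENNReal.mul_ne_top
    ENNReal.ofReal_ne_top (by norm_num)), lintegral_const_mul' _ _ ENNReal.ofReal_ne_top,
    lintegral_add_left measurable_const, lintegral_const, timeMeasure_univ, mul_one] at h1
  calc _ ≤ ENNReal.ofReal ν * _ := mul_le_mul' le_rfl h1
    _ = ENNReal.ofReal η * (3 * (ENNReal.ofReal ν * B ^ 2 + ENNReal.ofReal ν *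
          ∫⁻ r, (∫⁻ x, ∑ j : Fin 3, ‖G r x j‖ₑ ^ 2) ∂timeMeasure)) +
        ENNReal.ofReal (9 * symbolBound A b * (ν * (R / l) ^ (2 - α * q))) *
          ∫⁻ r, fracSq s (v r) ∂timeMeasure := by
        have : 9 * symbolBound A b * (ν * (R / l) ^ (2 - α * q)) =
            ν * (9 * symbolBound A b * (R / l) ^ (2 - 2 * s)) := by rw [e2]; ring
        rw [this, ENNReal.ofReal_mul hν]
        ring
    _ ≤ _ := by
        gcongr
        exact h.lintegral_fracSq_le hb hB hq hq2

end IsWeakSolution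

/-! ### Consequences of the definition of a Leray–Hopf solution -/

theorem lintegral_eLpNorm_le {B : ℝ≥0∞} {σ : ℝ} (hσ : 0 ≤ σ) {f : ℝ → T3 → R3}
    (hf : ∫⁻ r, eLpNorm (f r) 2 volume ^ (1 + σ) ∂timeMeasure ≤ B ^ (1 + σ)) :
    ∫⁻ r, eLpNorm (f r) 2 volume ∂timeMeasure ≤ 1 + B ^ (1 + σ) := by
  refine (lintegral_mono fun r => le_add_rpow one_ne_zero ENNReal.one_ne_top hσ _).trans ?_
  simp only [ENNReal.one_rpow, one_mul]
  rw [lintegral_add_left measurable_const, lintegral_const, timeMeasure_univ, mul_one]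
  gcongr

theorem enorm_integral_inner_le {g u : T3 → R3} (hg : MemLp g 2 volume) (hu : MemLp u 2 volume) :
    ‖∫ x, inner ℝ (g x) (u x)‖ₑ ≤ eLpNorm g 2 volume * eLpNorm u 2 volume := by
  refine (enorm_integral_le_lintegral_enorm _).trans
    (IsWeakSolution.le_of_sq_le_sq (le_trans (pow_le_pow_left' (lintegral_mono fun x =>
      (?_ : _ ≤ ‖g x‖ₑ * ‖u x‖ₑ)) 2) ((lintegral_mul_sq_le hg.1.enorm hu.1.enorm).trans ?_)))
  · rw [← ofReal_norm, ← ofReal_norm, ← ofReal_norm, ← ENNReal.ofReal_mul (norm_nonneg _)]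
    exact ENNReal.ofReal_le_ofReal (norm_inner_le_norm _ _)
  · rw [mul_pow, IsWeakSolution.eLpNorm_two_sq, IsWeakSolution.eLpNorm_two_sq]

theorem IsLerayHopf.exists_weakSolution {ν : ℝ} {vin : T3 → R3} {f v : ℝ → T3 → R3}
    (h : IsLerayHopf ν vin f v) : ∃ G p, IsWeakSolution ν f v G p ∧
      (∫ x, ‖v 1 x‖ ^ 2) + 2 * ν * (∫ r in (0 : ℝ)..1, ∫ x, ∑ j : Fin 3, ‖G r x j‖ ^ 2) ≤
        (∫ x, ‖vin x‖ ^ 2) + 2 * ∫ r in (0 : ℝ)..1, ∫ x, inner ℝ (f r x) (v r x) := by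
  obtain ⟨G, p, hG, hw, hg, hp, he, hE⟩ := h.exists_gradient_pressure
  have hGj : ∀ j, AEStronglyMeasurable (fun z : ℝ × T3 => G z.1 z.2 j) (timeMeasure.prod volume) :=
    fun j => (continuous_apply j).comp_aestronglyMeasurable hG
  have hGm : AEMeasurable (fun z : ℝ × T3 => ∑ j : Fin 3, ‖G z.1 z.2 j‖ₑ ^ 2)
      (timeMeasure.prod volume) :=
    Finset.aemeasurable_fun_sum _ fun j _ => (hGj j).enorm.pow_const 2
  have hforce : ∫⁻ t, eLpNorm (f t) 2 volume ∂timeMeasure < ⊤ := by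
    have := h.force_bound
    rw [eLpNorm_one_eq_lintegral_enorm] at this
    simpa only [enorm_eq_self] using this
  have hmem : ∀ᵐ r ∂timeMeasure, r ∈ Icc (0 : ℝ) 1 := ae_restrict_mem measurableSet_Icc
  refine ⟨G, p, ⟨h.aesm, h.force_aesm, hG, h.memLp, ?_, ?_, h.bound, hforce, hg, hp, he⟩,
    hE 1 ⟨one_pos, le_rfl⟩⟩
  · have hfin : ∀ᵐ r ∂timeMeasure, ∫⁻ x, ∑ j : Fin 3, ‖G r x j‖ₑ ^ 2 < ⊤ :=
      ae_lt_top' (AEMeasurable.lintegral_prod_right' hGm) hg.ne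
    have hms : ∀ᵐ r ∂timeMeasure, ∀ j, AEStronglyMeasurable (fun x => G r x j) volume :=
      ae_all_iff.2 fun j => (hGj j).prodMk_left
    filter_upwards [hw, hfin, hms, hmem] with r h1 h2 h3 h4
    refine ⟨h.memLp r h4, fun j => ⟨h3 j, ?_⟩, h1, h.divFree r h4⟩
    have h5 : eLpNorm (fun x => G r x j) 2 volume ^ 2 < ⊤ := by
      rw [IsWeakSolution.eLpNorm_two_sq]
      exact lt_of_le_of_lt (lintegral_mono fun x => Finset.single_le_sum
        (f := fun j => ‖G r x j‖ₑ ^ 2) (fun _ _ => zero_le) (Finset.mem_univ j)) h2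
    rw [lt_top_iff_ne_top]
    intro h6
    rw [h6] at h5
    simp at h5
  · filter_upwards [ae_lt_top' (aemeasurable_eLpNorm h.force_aesm) hforce.ne,
      h.force_aesm.prodMk_left] with r h1 h2
    exact ⟨h2, h1⟩

/-- The energy inequality at the final time gives a bound on ν∫‖∇v‖² in which ν no longer appears.
-/
theorem IsLerayHopf.viscous_le {ν : ℝ} {vin : T3 → R3} {f v : ℝ → T3 → R3}
    {G : ℝ → T3 → Fin 3 → R3} {p : ℝ → T3 → ℝ} (hν : 0 ≤ ν) (hvin : MemLp vin 2 volume)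
    (h : IsWeakSolution ν f v G p)
    (hE : (∫ x, ‖v 1 x‖ ^ 2) + 2 * ν * (∫ r in (0 : ℝ)..1, ∫ x, ∑ j : Fin 3, ‖G r x j‖ ^ 2) ≤
        (∫ x, ‖vin x‖ ^ 2) + 2 * ∫ r in (0 : ℝ)..1, ∫ x, inner ℝ (f r x) (v r x))
    {B : ℝ≥0∞} {σ α q : ℝ} (hσ : 0 ≤ σ) (hB : B ≠ ⊤) (hb : IsBoundedBy B σ α q f v) :
    ENNReal.ofReal ν * ∫⁻ r, (∫⁻ x, ∑ j : Fin 3, ‖G r x j‖ₑ ^ 2) ∂timeMeasure ≤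
      eLpNorm vin 2 volume ^ 2 + 2 * (B * (1 + B ^ (1 + σ))) := by
  set W := ∫ r in (0 : ℝ)..1, ∫ x, inner ℝ (f r x) (v r x) with hW
  have hWb : ‖W‖ₑ ≤ B * (1 + B ^ (1 + σ)) := by
    refine (enorm_intervalIntegral_le _ ⟨zero_le_one, le_rfl⟩).trans ?_
    calc _ ≤ ∫⁻ r, B * eLpNorm (f r) 2 volume ∂timeMeasure := by
          refine lintegral_mono_ae ?_
          filter_upwards [h.memLp_force, h.ae_memLp, hb.velocity] with r h1 h2 h3
          refine (enorm_integral_inner_le h1 h2).trans ?_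
          rw [mul_comm]
          gcongr
      _ ≤ _ := by
          rw [lintegral_const_mul' _ _ hB]
          gcongr
          exact lintegral_eLpNorm_le hσ hb.force
  have hGj : ∀ j, AEStronglyMeasurable (fun z : ℝ × T3 => G z.1 z.2 j) (timeMeasure.prod volume) :=
    fun j => (continuous_apply j).comp_aestronglyMeasurable h.aesm_grad
  have hs : ∀ r x, ‖∑ j : Fin 3, ‖G r x j‖ ^ 2‖ₑ = ∑ j : Fin 3, ‖G r x j‖ₑ ^ 2 := fun r x => by
    rw [Real.enorm_of_nonneg (Finset.sum_nonneg fun _ _ => sq_nonneg _),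
      ENNReal.ofReal_sum_of_nonneg fun _ _ => sq_nonneg _]
    simp only [ENNReal.ofReal_pow (norm_nonneg _), ofReal_norm]
  have hm : AEStronglyMeasurable (fun z : ℝ × T3 => ∑ j : Fin 3, ‖G z.1 z.2 j‖ ^ 2)
      (timeMeasure.prod volume) :=
    Finset.aestronglyMeasurable_fun_sum _ fun j _ => (hGj j).norm.pow 2
  have hint : Integrable (fun z : ℝ × T3 => ∑ j : Fin 3, ‖G z.1 z.2 j‖ ^ 2)
      (timeMeasure.prod volume) := by
    refine ⟨hm, ?_⟩
    unfold HasFiniteIntegral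
    rw [lintegral_prod _ hm.enorm]
    simp only [hs]
    exact h.grad_bound
  have e1 : ∫ r in (0 : ℝ)..1, ∫ x, ∑ j : Fin 3, ‖G r x j‖ ^ 2 =
      ∫ z : ℝ × T3, ∑ j : Fin 3, ‖G z.1 z.2 j‖ ^ 2 ∂(timeMeasure.prod volume) := by
    rw [integral_prod _ hint, intervalIntegral.integral_of_le zero_le_one,
      ← integral_Icc_eq_integral_Ioc]
    rfl
  have e2 : ∫⁻ r, (∫⁻ x, ∑ j : Fin 3, ‖G r x j‖ₑ ^ 2) ∂timeMeasure =
      ENNReal.ofReal (∫ r in (0 : ℝ)..1, ∫ x, ∑ j : Fin 3, ‖G r x j‖ ^ 2) := by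
    rw [e1, ofReal_integral_eq_lintegral_ofReal hint (ae_of_all _ fun z =>
      Finset.sum_nonneg fun _ _ => sq_nonneg _), lintegral_prod _ hm.aemeasurable.ennreal_ofReal]
    refine lintegral_congr fun r => lintegral_congr fun x => ?_
    rw [← hs, Real.enorm_of_nonneg (Finset.sum_nonneg fun _ _ => sq_nonneg _)]
  rw [e2, ← ENNReal.ofReal_mul hν]
  set D := ∫ r in (0 : ℝ)..1, ∫ x, ∑ j : Fin 3, ‖G r x j‖ ^ 2 with hD
  have hD0 : 0 ≤ D := by
    rw [e1]; exact integral_nonneg fun z => Finset.sum_nonneg fun _ _ => sq_nonneg _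
  have h1 : 0 ≤ ∫ x, ‖v 1 x‖ ^ 2 := integral_nonneg fun _ => sq_nonneg _
  have hν0 := mul_nonneg hν hD0
  have h2 : ν * D ≤ (∫ x, ‖vin x‖ ^ 2) + 2 * |W| := by
    nlinarith [le_abs_self W]
  refine (ENNReal.ofReal_le_ofReal h2).trans ?_
  rw [ENNReal.ofReal_add (integral_nonneg fun _ => sq_nonneg _) (by positivity),
    ENNReal.ofReal_mul (by norm_num), ENNReal.ofReal_ofNat]
  refine add_le_add (le_of_eq ?_) (mul_le_mul' le_rfl ?_)
  · rw [IsWeakSolution.eLpNorm_two_sq, ofReal_integral_eq_lintegral_ofReal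
      hvin.integrable_norm_pow' (ae_of_all _ fun _ => by positivity)]
    refine lintegral_congr fun x => ?_
    rw [ENNReal.ofReal_pow (norm_nonneg _), ofReal_norm]
  · rwa [← Real.norm_eq_abs, ofReal_norm]

theorem UniformBound.exists_isBoundedBy {σ α q : ℝ} {f v : ℝ → ℝ → T3 → R3} (hσ : 0 ≤ σ)
    (hq : 0 < q) (h : UniformBound σ α q f v) :
    ∃ B : ℝ≥0∞, B ≠ ⊤ ∧ ∀ ν ∈ Ioo (0 : ℝ) 1, IsBoundedBy B σ α q (f ν) (v ν) := by
  refine ⟨_, h.ne, fun ν hν => ?_⟩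
  have key := le_iSup₂ (f := fun (ν : ℝ) (_ : ν ∈ Ioo (0 : ℝ) 1) =>
    (eLpNorm (fun t => eLpNorm (v ν t) 2 volume) ⊤ timeMeasure
      + eLpNorm (fun t => sobolevNorm α (v ν t)) (ENNReal.ofReal q) timeMeasure
      + eLpNorm (fun t => eLpNorm (f ν t) 2 volume) (ENNReal.ofReal (1 + σ)) timeMeasure)) ν hν
  set B := ⨆ ν ∈ Ioo (0 : ℝ) 1,
    (eLpNorm (fun t => eLpNorm (v ν t) 2 volume) ⊤ timeMeasure
      + eLpNorm (fun t => sobolevNorm α (v ν t)) (ENNReal.ofReal q) timeMeasure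
      + eLpNorm (fun t => eLpNorm (f ν t) 2 volume) (ENNReal.ofReal (1 + σ)) timeMeasure)
  have hpow : ∀ {g : ℝ → ℝ≥0∞} {s : ℝ}, 0 < s → eLpNorm g (ENNReal.ofReal s) timeMeasure ≤ B →
      ∫⁻ r, g r ^ s ∂timeMeasure ≤ B ^ s := by
    intro g s hs hg
    rw [eLpNorm_eq_lintegral_rpow_enorm_toReal (by simpa using hs) ENNReal.ofReal_ne_top,
      ENNReal.toReal_ofReal hs.le] at hg
    simp only [enorm_eq_self] at hg
    have := ENNReal.rpow_le_rpow hg hs.le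
    rwa [← ENNReal.rpow_mul, one_div_mul_cancel hs.ne', ENNReal.rpow_one] at this
  refine ⟨?_, hpow hq (le_trans (le_add_self.trans le_self_add) key),
    hpow (by linarith) (le_add_self.trans key)⟩
  filter_upwards [ae_eLpNorm_le (v := v ν)] with r hr
  exact hr.trans ((le_self_add.trans le_self_add).trans key)

/-! ### Random times -/

theorem exists_rpow_neg_mul_le {σ : ℝ} (hσ : 0 < σ) {C δ : ℝ≥0∞} (hC : C ≠ ⊤) (hδ : δ ≠ 0)
    (hδ' : δ ≠ ⊤) : ∃ c : ℝ≥0∞, c ≠ 0 ∧ c ≠ ⊤ ∧ c ^ (-σ) * C ≤ δ := by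
  have hx : C / δ + 1 ≠ ⊤ := ENNReal.add_ne_top.2 ⟨ENNReal.div_ne_top hC hδ, ENNReal.one_ne_top⟩
  have hx0 : C / δ + 1 ≠ 0 := by simp
  -- With this choice c^{-σ} = (C/δ + 1)⁻¹; the added 1 keeps c nonzero when C = 0.
  refine ⟨(C / δ + 1) ^ (1 / σ), ?_, ENNReal.rpow_ne_top_of_nonneg (by positivity) hx, ?_⟩
  · simp [ENNReal.rpow_eq_zero_iff, hx]
  · rw [← ENNReal.rpow_mul, show 1 / σ * -σ = -1 by field_simp, ENNReal.rpow_neg_one, mul_comm,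
      ← div_eq_mul_inv]
    refine ENNReal.div_le_of_le_mul ?_
    rw [mul_add, ENNReal.mul_div_cancel hδ hδ']
    exact le_self_add

theorem eventually_mul_le {ι : Type*} {L : Filter ι} {g : ι → ℝ≥0∞} (hg : Tendsto g L (𝓝 0))
    {C δ : ℝ≥0∞} (hC : C ≠ ⊤) (hδ : δ ≠ 0) : ∀ᶠ i in L, C * g i ≤ δ := by
  have h := ENNReal.Tendsto.const_mul hg (Or.inr hC)
  rw [mul_zero] at h
  exact h.eventually (eventually_le_nhds (pos_iff_ne_zero.2 hδ))

theorem tendsto_ofReal_rpow {e : ℝ} (he : 0 < e) :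
    Tendsto (fun l : ℝ => ENNReal.ofReal (l ^ e)) (𝓝[>] 0) (𝓝 0) := by
  have h1 : Tendsto (fun l : ℝ => l ^ e) (𝓝 0) (𝓝 0) := by
    have := (Real.continuousAt_rpow_const 0 e (Or.inr he.le)).tendsto
    rwa [Real.zero_rpow he.ne'] at this
  have := ENNReal.tendsto_ofReal (h1.mono_left (nhdsWithin_le_nhds (s := Ioi 0)))
  simpa using this

namespace RandomTime

/-- The density is split at height c, ψ ≤ c + c^{-κ} ψ^{1+κ}: the first part compares the law with
Lebesgue measure, the second uses only the essential bound b of g. The random time enters through κ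
and M alone, hence the uniformity over all of them. -/
theorem lintegral_time_le {κ M : ℝ} (hκ : 0 < κ) (τ : RandomTime κ M) {g : ℝ → ℝ≥0∞}
    (hg : AEMeasurable g timeMeasure) {b c : ℝ≥0∞} (hgb : ∀ᵐ r ∂timeMeasure, g r ≤ b)
    (hb : b ≠ ⊤) (hc : c ≠ 0) (hc' : c ≠ ⊤) :
    letI := τ.mΩ
    ∫⁻ w, g (τ.time w) ∂τ.P ≤
      c * (∫⁻ r, g r ∂timeMeasure) + c ^ (-κ) * (b * ENNReal.ofReal M ^ (1 + κ)) := by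
  let _ := τ.mΩ
  obtain ⟨ψ, hψ, hlaw, hbd⟩ := τ.exists_density
  have hcκ : c ^ (-κ) ≠ ⊤ := by
    simp [ENNReal.rpow_eq_top_iff, hc, hc']
  have hψb : ∫⁻ r, ψ r ^ (1 + κ) ∂timeMeasure ≤ ENNReal.ofReal M ^ (1 + κ) := by
    have hs : 0 < 1 + κ := by linarith
    rw [eLpNorm_eq_lintegral_rpow_enorm_toReal (by simpa using hs) ENNReal.ofReal_ne_top,
      ENNReal.toReal_ofReal hs.le] at hbd
    simp only [enorm_eq_self] at hbd
    have := ENNReal.rpow_le_rpow hbd hs.le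
    rwa [← ENNReal.rpow_mul, one_div_mul_cancel hs.ne', ENNReal.rpow_one] at this
  have hgm : AEMeasurable g (τ.P.map τ.time) := by
    rw [hlaw]
    exact hg.mono_ac (withDensity_absolutelyContinuous _ _)
  rw [← lintegral_map' hgm τ.measurable_time.aemeasurable, hlaw,
    lintegral_withDensity_eq_lintegral_mul₀ hψ.aemeasurable hg]
  calc ∫⁻ r, (ψ * g) r ∂timeMeasure
      ≤ ∫⁻ r, (c * g r + (c ^ (-κ) * b) * ψ r ^ (1 + κ)) ∂timeMeasure := by
        refine lintegral_mono_ae ?_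
        filter_upwards [hgb] with r hr
        calc ψ r * g r ≤ (c + c ^ (-κ) * ψ r ^ (1 + κ)) * g r :=
              mul_le_mul' (le_add_rpow hc hc' hκ.le _) le_rfl
          _ = c * g r + c ^ (-κ) * g r * ψ r ^ (1 + κ) := by ring
          _ ≤ _ := by gcongr
    _ = c * (∫⁻ r, g r ∂timeMeasure) + c ^ (-κ) * b * ∫⁻ r, ψ r ^ (1 + κ) ∂timeMeasure := by
        rw [lintegral_add_left' (hg.const_mul _), lintegral_const_mul' _ _ hc',
          lintegral_const_mul' _ _ (ENNReal.mul_ne_top hcκ hb)]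
    _ ≤ _ := by
        rw [← mul_assoc]
        gcongr

/-- Convexity separates the part depending on the random time from the deterministic remainder. Only
an upper bound for F is used, so F need not be measurable. -/
theorem average_le {κ M : ℝ} (τ : RandomTime κ M) {p : ℝ} (hp : 1 ≤ p) {F : ℝ → ℝ}
    {X : ℝ → ℝ≥0∞} {D : ℝ≥0∞} (hF : ∀ t ∈ Icc (0 : ℝ) 1, ‖F t‖ₑ ≤ X t + D) :
    letI := τ.mΩ
    τ.average p F ≤ 2 ^ (p - 1) * ((∫⁻ w, X (τ.time w) ^ p ∂τ.P) + D ^ p) := by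
  let _ := τ.mΩ
  have := τ.isProb
  unfold average
  have h2 : (2 : ℝ≥0∞) ^ (p - 1) ≠ ⊤ := ENNReal.rpow_ne_top_of_nonneg (by linarith) (by norm_num)
  calc ∫⁻ w, ENNReal.ofReal (|F (τ.time w)| ^ p) ∂τ.P
      ≤ ∫⁻ w, 2 ^ (p - 1) * (X (τ.time w) ^ p + D ^ p) ∂τ.P := by
        refine lintegral_mono fun w => ?_
        rw [← ENNReal.ofReal_rpow_of_nonneg (abs_nonneg _) (by linarith), ← Real.norm_eq_abs,
          ofReal_norm]
        exact (ENNReal.rpow_le_rpow (hF _ (τ.time_mem w)) (by linarith)).trans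
          (ENNReal.rpow_add_le_mul_rpow_add_rpow _ _ hp)
    _ = _ := by
        rw [lintegral_const_mul' _ _ h2, lintegral_add_right _ measurable_const, lintegral_const,
          measure_univ, mul_one]

end RandomTime

/-! ### Smallness of the error terms -/

section Smallness

variable {f v : ℝ → ℝ → T3 → R3} {G : ℝ → ℝ → T3 → Fin 3 → R3}
  {P : ℝ → ℝ → T3 → ℝ} {B : ℝ≥0∞} {σ α q : ℝ}

/-- The height c is fixed first to make the excess of the force small; ℓ is then taken small
depending on c but not on ν. -/
theorem eventually_force_le (h : ∀ ν ∈ Ioo (0 : ℝ) 1, IsWeakSolution ν (f ν) (v ν) (G ν) (P ν))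
    (hb : ∀ ν ∈ Ioo (0 : ℝ) 1, IsBoundedBy B σ α q (f ν) (v ν)) (hB : B ≠ ⊤) (hσ : 0 < σ)
    (hα : α ∈ Ioo (0 : ℝ) 1) (hq : q ∈ Icc (1 : ℝ) 2) {C δ : ℝ≥0∞} (hC : C ≠ ⊤) (hδ : δ ≠ 0)
    (hδ' : δ ≠ ⊤) :
    ∀ᶠ l in 𝓝[>] (0 : ℝ), ∀ ν ∈ Ioo (0 : ℝ) 1, C * (∫⁻ r, ∑' k, ENNReal.ofReal
      (min 1 ‖l • freq k‖) * (amp (f ν r) k * amp (v ν r) k) ∂timeMeasure) ≤ δ := by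
  have hδ2 : δ / 2 ≠ 0 := by simpa using hδ
  have hδ2' : δ / 2 ≠ ⊤ := ENNReal.div_ne_top hδ' (by norm_num)
  have hX : 3 * B ^ 2 ≠ ⊤ := ENNReal.mul_ne_top (by norm_num) (ENNReal.pow_ne_top hB)
  obtain ⟨c, hc, hc', hcδ⟩ := exists_rpow_neg_mul_le hσ
    (C := C * 2 * ((3 * B ^ 2) ^ (1 / 2 : ℝ) * B ^ (1 + σ)))
    (ENNReal.mul_ne_top (ENNReal.mul_ne_top hC (by norm_num)) (ENNReal.mul_ne_top
      (ENNReal.rpow_ne_top_of_nonneg (by norm_num) hX)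
      (ENNReal.rpow_ne_top_of_nonneg (by linarith) hB))) hδ2 hδ2'
  have hs : 0 < α * q / 2 * (1 / 2) := by
    have := mul_pos hα.1 (lt_of_lt_of_le one_pos hq.1)
    positivity
  have ev := eventually_mul_le (tendsto_ofReal_rpow hs)
    (C := C * 2 * (c * (3 * B ^ 2) ^ (1 / 2 : ℝ)))
    (ENNReal.mul_ne_top (ENNReal.mul_ne_top hC (by norm_num)) (ENNReal.mul_ne_top hc'
      (ENNReal.rpow_ne_top_of_nonneg (by norm_num) hX))) hδ2
  filter_upwards [ev, self_mem_nhdsWithin] with l hl hl0 ν hν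
  have hl0 : (0 : ℝ) < l := hl0
  refine (mul_le_mul' le_rfl ((h ν hν).lintegral_force_le (hb ν hν) hB hσ.le hα.1.le hα.2.le hq.1
    hq.2 hl0 hc hc')).trans ?_
  rw [ENNReal.mul_rpow_of_nonneg _ _ (by norm_num),
    ENNReal.ofReal_rpow_of_nonneg (by positivity) (by norm_num), ← Real.rpow_mul hl0.le]
  calc _ = C * 2 * (c * (3 * B ^ 2) ^ (1 / 2 : ℝ)) * ENNReal.ofReal (l ^ (α * q / 2 * (1 / 2))) +
        c ^ (-σ) * (C * 2 * ((3 * B ^ 2) ^ (1 / 2 : ℝ) * B ^ (1 + σ))) := by ring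
    _ ≤ δ / 2 + δ / 2 := add_le_add hl hcδ
    _ = δ := ENNReal.add_halves δ

/-- First η is chosen, then R = R(η), and only then does ν tend to 0. For ℓ ≥ ν^K the low
frequencies contribute a power ν^{1-K(2-αq)}, whose exponent is positive by the condition on K. -/
theorem eventually_viscous_le (h : ∀ ν ∈ Ioo (0 : ℝ) 1, IsWeakSolution ν (f ν) (v ν) (G ν) (P ν))
    (hb : ∀ ν ∈ Ioo (0 : ℝ) 1, IsBoundedBy B σ α q (f ν) (v ν)) (hB : B ≠ ⊤)
    (hα : α ∈ Ioo (0 : ℝ) 1) (hq : q ∈ Icc (1 : ℝ) 2) {E : ℝ≥0∞} (hEt : E ≠ ⊤)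
    (hE : ∀ ν ∈ Ioo (0 : ℝ) 1, ENNReal.ofReal ν *
      ∫⁻ r, (∫⁻ x, ∑ j : Fin 3, ‖G ν r x j‖ₑ ^ 2) ∂timeMeasure ≤ E) (A b : ℝ) {K : ℝ}
    (hK : K * (2 - α * q) < 1) {C δ : ℝ≥0∞} (hC : C ≠ ⊤) (hδ : δ ≠ 0) :
    ∀ᶠ ν in 𝓝[>] (0 : ℝ), ∀ l : ℝ, ν ^ K ≤ l → C * (ENNReal.ofReal ν *
      ∫⁻ r, ∑' k, ENNReal.ofReal (freqSq k) * (ENNReal.ofReal (symbolSize A b (l • freq k)) *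
        amp (v ν r) k ^ 2) ∂timeMeasure) ≤ δ := by
  have hδ2 : δ / 2 ≠ 0 := by simpa using hδ
  have hB2 : B ^ 2 ≠ ⊤ := ENNReal.pow_ne_top hB
  have hαq : α * q < 2 := by nlinarith [hα.1, hα.2, hq.1, hq.2]
  have ev1 := eventually_mul_le (tendsto_ofReal_rpow one_pos) (C := C * (3 * (B ^ 2 + E)))
    (ENNReal.mul_ne_top hC (ENNReal.mul_ne_top (by norm_num) (ENNReal.add_ne_top.2 ⟨hB2, hEt⟩))) hδ2
  obtain ⟨η, hη, hη0⟩ := (ev1.and self_mem_nhdsWithin).exists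
  have hη0 : (0 : ℝ) < η := hη0
  rw [Real.rpow_one] at hη
  obtain ⟨R, hR, hRη⟩ := exists_symbolSize_le A b hη0
  have he : 0 < 1 - K * (2 - α * q) := by linarith
  have ev2 := eventually_mul_le (tendsto_ofReal_rpow he)
    (C := C * (ENNReal.ofReal (9 * symbolBound A b * R ^ (2 - α * q)) * (3 * B ^ 2)))
    (ENNReal.mul_ne_top hC (ENNReal.mul_ne_top ENNReal.ofReal_ne_top
      (ENNReal.mul_ne_top (by norm_num) hB2))) hδ2
  filter_upwards [ev2, Ioo_mem_nhdsGT one_pos] with ν h2 hν l hl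
  have hνK : 0 < ν ^ K := Real.rpow_pos_of_pos hν.1 K
  have hl0 : 0 < l := hνK.trans_le hl
  have hCs := symbolBound_nonneg A b
  refine (mul_le_mul' le_rfl ((h ν hν).lintegral_viscous_le (hb ν hν) hB hα.1.le hα.2.le hq.1
    hq.2 A b hl0 hν.1.le hR hRη (hE ν hν))).trans ?_
  have hpow : ν * (R / l) ^ (2 - α * q) ≤ R ^ (2 - α * q) * ν ^ (1 - K * (2 - α * q)) := by
    calc ν * (R / l) ^ (2 - α * q) ≤ ν * (R / ν ^ K) ^ (2 - α * q) := by
          have := hν.1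
          gcongr
      _ = R ^ (2 - α * q) * ν ^ (1 - K * (2 - α * q)) := by
          rw [Real.div_rpow hR.le hνK.le, ← Real.rpow_mul hν.1.le, Real.rpow_sub hν.1,
            Real.rpow_one]
          ring
  have hν1 : ENNReal.ofReal ν ≤ 1 := by
    rw [← ENNReal.ofReal_one]; exact ENNReal.ofReal_le_ofReal hν.2.le
  calc _ ≤ C * (ENNReal.ofReal η * (3 * (1 * B ^ 2 + E)) + ENNReal.ofReal (9 * symbolBound A b *
          (R ^ (2 - α * q) * ν ^ (1 - K * (2 - α * q)))) * (3 * B ^ 2)) := by gcongr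
    _ = C * (3 * (B ^ 2 + E)) * ENNReal.ofReal η +
        C * (ENNReal.ofReal (9 * symbolBound A b * R ^ (2 - α * q)) * (3 * B ^ 2)) *
          ENNReal.ofReal (ν ^ (1 - K * (2 - α * q))) := by
        rw [← mul_assoc (9 * symbolBound A b), ENNReal.ofReal_mul (by positivity)]
        ring
    _ ≤ δ / 2 + δ / 2 := add_le_add hη h2
    _ = δ := ENNReal.add_halves δ

/-- At a prescribed time nothing makes the small-scale energy small uniformly in ν, but it is
essentially bounded and small in L¹ of time. The power p costs only p - 1 factors of the bound, and
the random time turns the time integral into an expectation. -/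
theorem eventually_average_lowSq_le
    (h : ∀ ν ∈ Ioo (0 : ℝ) 1, IsWeakSolution ν (f ν) (v ν) (G ν) (P ν))
    (hb : ∀ ν ∈ Ioo (0 : ℝ) 1, IsBoundedBy B σ α q (f ν) (v ν)) (hB : B ≠ ⊤)
    (hα : α ∈ Ioo (0 : ℝ) 1) (hq : q ∈ Icc (1 : ℝ) 2) {p κ M : ℝ} (hp : 1 ≤ p) (hκ : 0 < κ)
    {C δ : ℝ≥0∞} (hC : C ≠ ⊤) (hδ : δ ≠ 0) (hδ' : δ ≠ ⊤) :
    ∀ᶠ l in 𝓝[>] (0 : ℝ), ∀ ν ∈ Ioo (0 : ℝ) 1, ∀ τ : RandomTime κ M,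
      letI := τ.mΩ
      ∫⁻ w, (C * lowSq l (v ν (τ.time w))) ^ p ∂τ.P ≤ δ := by
  have hδ2 : δ / 2 ≠ 0 := by simpa using hδ
  have hδ2' : δ / 2 ≠ ⊤ := ENNReal.div_ne_top hδ' (by norm_num)
  have hX : C * (3 * B ^ 2) ≠ ⊤ :=
    ENNReal.mul_ne_top hC (ENNReal.mul_ne_top (by norm_num) (ENNReal.pow_ne_top hB))
  have hX1 : (C * (3 * B ^ 2)) ^ (p - 1) ≠ ⊤ := ENNReal.rpow_ne_top_of_nonneg (by linarith) hX
  have hXp : (C * (3 * B ^ 2)) ^ p ≠ ⊤ := ENNReal.rpow_ne_top_of_nonneg (by linarith) hX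
  obtain ⟨c, hc, hc', hcδ⟩ := exists_rpow_neg_mul_le hκ
    (C := (C * (3 * B ^ 2)) ^ p * ENNReal.ofReal M ^ (1 + κ))
    (ENNReal.mul_ne_top hXp
      (ENNReal.rpow_ne_top_of_nonneg (by linarith) ENNReal.ofReal_ne_top)) hδ2 hδ2'
  have hs : 0 < α * q / 2 := by
    have := mul_pos hα.1 (lt_of_lt_of_le one_pos hq.1)
    positivity
  have ev := eventually_mul_le (tendsto_ofReal_rpow hs)
    (C := c * ((C * (3 * B ^ 2)) ^ (p - 1) * (C * (3 * B ^ 2))))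
    (ENNReal.mul_ne_top hc' (ENNReal.mul_ne_top hX1 hX)) hδ2
  filter_upwards [ev, self_mem_nhdsWithin] with l hl hl0 ν hν τ
  have hl0 : (0 : ℝ) < l := hl0
  have hae := (h ν hν).ae_lowSq_le (hb ν hν) l
  refine (τ.lintegral_time_le hκ (g := fun r => (C * lowSq l (v ν r)) ^ p)
    ((((h ν hν).aemeasurable_lowSq l).const_mul C).pow_const p) (b := (C * (3 * B ^ 2)) ^ p) ?_ hXp
    hc hc').trans ?_
  · filter_upwards [hae] with r hr
    gcongr
  · have h1 : ∫⁻ r, (C * lowSq l (v ν r)) ^ p ∂timeMeasure ≤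
        ((C * (3 * B ^ 2)) ^ (p - 1) * (C * (3 * B ^ 2))) * ENNReal.ofReal (l ^ (α * q / 2)) := by
      calc ∫⁻ r, (C * lowSq l (v ν r)) ^ p ∂timeMeasure
          ≤ ∫⁻ r, ((C * (3 * B ^ 2)) ^ (p - 1) * C) * lowSq l (v ν r) ∂timeMeasure := by
            refine lintegral_mono_ae ?_
            filter_upwards [hae] with r hr
            have e : p = (p - 1) + 1 := by ring
            nth_rewrite 1 [e]
            rw [ENNReal.rpow_add_of_nonneg _ _ (by linarith) zero_le_one, ENNReal.rpow_one,
              mul_assoc]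
            gcongr
        _ ≤ ((C * (3 * B ^ 2)) ^ (p - 1) * C) *
            (ENNReal.ofReal (l ^ (α * q / 2)) * (3 * B ^ 2)) := by
            rw [lintegral_const_mul' _ _ (ENNReal.mul_ne_top hX1 hC)]
            gcongr
            exact (h ν hν).lintegral_lowSq_le (hb ν hν) hB hα.1.le hα.2.le hq.1 hq.2 hl0
        _ = _ := by ring
    calc _ ≤ c * (((C * (3 * B ^ 2)) ^ (p - 1) * (C * (3 * B ^ 2))) *
          ENNReal.ofReal (l ^ (α * q / 2))) + δ / 2 := by gcongr
      _ ≤ δ / 2 + δ / 2 := by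
          rw [← mul_assoc]
          gcongr
      _ = δ := ENNReal.add_halves δ

theorem lowSq_congr {u w : T3 → R3} (h : u =ᵐ[volume] w) (l : ℝ) : lowSq l u = lowSq l w := by
  have e : ∀ k, amp u k = amp w k := fun k => by
    unfold amp vhat
    refine Finset.sum_congr rfl fun i _ => ?_
    rw [coef_congr (b := fun x => w x i) (h.mono fun x hx => by simp only [hx])]
  unfold lowSq
  simp only [e]

end Smallness

/-! ### The averaged law. -/

/-- The averaged law for a general combination of the structure functions. -/
theorem tendsto_average_defect {vin : T3 → R3} {f v : ℝ → ℝ → T3 → R3}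
    (hv : ∀ ν ∈ Ioo (0 : ℝ) 1, IsLerayHopf ν vin (f ν) (v ν))
    {σ α q : ℝ} (hσ : 0 < σ) (hα : α ∈ Ioo (0 : ℝ) 1) (hq : q ∈ Icc (1 : ℝ) 2)
    (hH : UniformBound σ α q f v) (A b : ℝ) {K : ℝ} (hK : K < 1 / (2 - α * q)) {p κ M : ℝ}
    (hp : 1 ≤ p) (hκ : 0 < κ) :
    Tendsto (fun lI : ℝ => limsup (fun ν : ℝ => ⨆ l ∈ Icc (ν ^ K) lI, ⨆ τ : RandomTime κ M,
        τ.average p (fun t => (∫ r in (0 : ℝ)..t, structGen A b (v ν r) l / l)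
          + symbolMass A b / Real.pi * dissipation (f ν) (v ν) t)) (𝓝[>] 0)) (𝓝[>] 0) (𝓝 0) := by
  obtain ⟨B, hB, hb⟩ := hH.exists_isBoundedBy hσ.le (lt_of_lt_of_le one_pos hq.1)
  have hex : ∀ ν : ℝ, ∃ (G : ℝ → T3 → Fin 3 → R3) (P : ℝ → T3 → ℝ), ν ∈ Ioo (0 : ℝ) 1 →
      IsWeakSolution ν (f ν) (v ν) G P ∧
      (∫ x, ‖v ν 1 x‖ ^ 2) + 2 * ν * (∫ r in (0 : ℝ)..1, ∫ x, ∑ j : Fin 3, ‖G r x j‖ ^ 2) ≤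
        (∫ x, ‖vin x‖ ^ 2) + 2 * ∫ r in (0 : ℝ)..1, ∫ x, inner ℝ (f ν r x) (v ν r x) := fun ν => by
    by_cases hν : ν ∈ Ioo (0 : ℝ) 1
    · obtain ⟨G, P, h⟩ := (hv ν hν).exists_weakSolution
      exact ⟨G, P, fun _ => h⟩
    · exact ⟨fun _ _ _ => 0, fun _ _ => 0, fun h => absurd h hν⟩
  choose G P hGP using hex
  have h : ∀ ν ∈ Ioo (0 : ℝ) 1, IsWeakSolution ν (f ν) (v ν) (G ν) (P ν) := fun ν hν =>
    (hGP ν hν).1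
  have hvin : MemLp vin 2 volume :=
    (hv (1 / 2) ⟨by norm_num, by norm_num⟩).vin_memLp
  set E := eLpNorm vin 2 volume ^ 2 + 2 * (B * (1 + B ^ (1 + σ))) with hEdef
  have hEt : E ≠ ⊤ := ENNReal.add_ne_top.2 ⟨ENNReal.pow_ne_top hvin.2.ne,
    ENNReal.mul_ne_top (by norm_num) (ENNReal.mul_ne_top hB (ENNReal.add_ne_top.2
      ⟨ENNReal.one_ne_top, ENNReal.rpow_ne_top_of_nonneg (by linarith) hB⟩))⟩
  have hE : ∀ ν ∈ Ioo (0 : ℝ) 1, ENNReal.ofReal ν *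
      ∫⁻ r, (∫⁻ x, ∑ j : Fin 3, ‖G ν r x j‖ₑ ^ 2) ∂timeMeasure ≤ E := fun ν hν =>
    IsLerayHopf.viscous_le hν.1.le hvin (h ν hν) (hGP ν hν).2 hσ.le hB (hb ν hν)
  have hαq : 0 < 2 - α * q := by nlinarith [hα.1, hα.2, hq.1, hq.2]
  have hK' : K * (2 - α * q) < 1 := (lt_div_iff₀ hαq).1 hK
  rw [ENNReal.tendsto_nhds_zero]
  intro ε hε
  rcases eq_or_ne ε ⊤ with rfl | hεt
  · exact Eventually.of_forall fun _ => le_top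
  -- The budget is c2 (δ + D^p) = ε with D^p = δ. The random part takes δ, and D is shared in thirds
  -- by initial datum, viscosity and force.
  set c2 : ℝ≥0∞ := 2 ^ (p - 1) with hc2
  have hc2t : c2 ≠ ⊤ := ENNReal.rpow_ne_top_of_nonneg (by linarith) (by norm_num)
  have hc20 : c2 ≠ 0 := by
    rw [hc2]; simp
  set δ := ε / 2 / c2 with hδdef
  have hδ0 : δ ≠ 0 := by
    rw [hδdef]
    exact (ENNReal.div_pos (by simpa using hε.ne') hc2t).ne'
  have hδt : δ ≠ ⊤ := ENNReal.div_ne_top (ENNReal.div_ne_top hεt (by norm_num)) hc20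
  set D := δ ^ (1 / p) with hDdef
  have hD0 : D ≠ 0 := by
    simp [hDdef, ENNReal.rpow_eq_zero_iff, hδ0, hδt]
  have hDt : D ≠ ⊤ := ENNReal.rpow_ne_top_of_nonneg (by positivity) hδt
  have hD3 : D / 3 ≠ 0 := by simpa using hD0
  have hD3t : D / 3 ≠ ⊤ := ENNReal.div_ne_top hDt (by norm_num)
  set Cs := ENNReal.ofReal (symbolBound A b) with hCs
  have hCst : Cs ≠ ⊤ := ENNReal.ofReal_ne_top
  have ev1 := eventually_mul_le (tendsto_lowSq_zero hvin) hCst hD3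
  have ev2 := eventually_force_le h hb hB hσ hα hq (C := 2 * Cs)
    (ENNReal.mul_ne_top (by norm_num) hCst) hD3 hD3t
  have ev3 := eventually_average_lowSq_le h hb hB hα hq (M := M) hp hκ hCst hδ0 hδt
  have ev4 := eventually_viscous_le h hb hB hα hq hEt hE A b hK'
    (C := ENNReal.ofReal (8 * Real.pi ^ 2)) ENNReal.ofReal_ne_top hD3
  -- Three of the estimates ask only that ℓ be small, whatever ν is; the viscous one asks that ν be
  -- small and ℓ ≥ ν^K. This matches a limit superior in ν taken before the limit in ℓ_I.
  obtain ⟨l0, hl0, hl⟩ := mem_nhdsGT_iff_exists_Ioo_subset.1 (ev1.and (ev2.and ev3))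
  filter_upwards [Ioo_mem_nhdsGT (show (0 : ℝ) < l0 from hl0)] with lI hlI
  refine limsup_le_of_le (by isBoundedDefault) ?_
  filter_upwards [ev4, Ioo_mem_nhdsGT one_pos] with ν h4 hν
  refine iSup₂_le fun l hlm => iSup_le fun τ => ?_
  have hlp : 0 < l := (Real.rpow_pos_of_pos hν.1 K).trans_le hlm.1
  obtain ⟨h1, h2, h3⟩ := hl (show l ∈ Ioo 0 l0 from ⟨hlp, hlm.2.trans_lt hlI.2⟩)
  refine (τ.average_le hp (X := fun t => Cs * lowSq l (v ν t)) (D := D) ?_).trans ?_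
  · intro t ht
    have key := (h ν hν).enorm_defect_le hν.1.le A b hlp ht
    have e1 : 2 * Real.pi * (∫ r in (0 : ℝ)..t, structGen A b (v ν r) l / l) +
        2 * symbolMass A b * dissipation (f ν) (v ν) t =
        2 * Real.pi * ((∫ r in (0 : ℝ)..t, structGen A b (v ν r) l / l) +
        symbolMass A b / Real.pi * dissipation (f ν) (v ν) t) := by
      field_simp
    rw [e1, enorm_mul] at key
    -- The common factor 2π exceeds 1 and is discarded.
    have hpi : (1 : ℝ≥0∞) ≤ ‖2 * Real.pi‖ₑ := by
      rw [Real.enorm_of_nonneg (by positivity), ← ENNReal.ofReal_one]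
      exact ENNReal.ofReal_le_ofReal (by linarith [Real.pi_gt_three])
    refine ((le_mul_of_one_le_left zero_le hpi).trans key).trans ?_
    rw [lowSq_congr (hv ν hν).initial, ENNReal.ofReal_mul (by positivity), mul_assoc
      (ENNReal.ofReal (8 * Real.pi ^ 2)), mul_add, add_assoc, add_assoc]
    refine add_le_add le_rfl ?_
    calc _ ≤ D / 3 + (D / 3 + D / 3) :=
          add_le_add h1 (add_le_add (h4 l hlm.1) (h2 ν hν))
      _ = D := by rw [← add_assoc]; exact ENNReal.add_thirds D
  · have hDp : D ^ p = δ := by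
      rw [hDdef, ← ENNReal.rpow_mul, one_div_mul_cancel (by linarith), ENNReal.rpow_one]
    rw [hDp]
    calc _ ≤ c2 * (δ + δ) := by gcongr; exact h3 ν hν τ
      _ = ε := by
          rw [mul_add, hδdef, ENNReal.mul_div_cancel hc20 hc2t, ENNReal.add_halves]

/-! ### Third moments of increments -/

/-- The fourth power |u|⁴ is the sum of the squares of the nine products u_i u_j; nine times the
constant 4 of the product estimate is 36. -/
theorem lintegral_fourth_le {u : T3 → R3} {G : T3 → Fin 3 → R3} (h : IsSobolevField u G) :
    ∫⁻ x, (‖u x‖ₑ ^ 2) ^ 2 ≤ 36 * latticeSum * fieldSobolevSq u ^ 2 := by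
  have e : ∀ x, (‖u x‖ₑ ^ 2) ^ 2 = ∑ i, ∑ j, ‖u x i * u x j‖ₑ ^ 2 := fun x => by
    rw [enorm_sq_eq_sum, sq, Finset.sum_mul_sum]
    simp only [enorm_mul, mul_pow]
  have hm : ∀ i j, AEMeasurable (fun x => ‖u x i * u x j‖ₑ ^ 2) volume := fun i j =>
    (memLp_mul_coord h i j).1.enorm.pow_const 2
  simp only [e]
  rw [lintegral_finsetSum' _ fun i _ => Finset.aemeasurable_fun_sum _ fun j _ => hm i j]
  simp only [lintegral_finsetSum' _ fun j _ => hm _ j]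
  calc _ ≤ ∑ i : Fin 3, ∑ j : Fin 3, 4 * latticeSum * fieldSobolevSq u * fieldSobolevSq u := by
        refine Finset.sum_le_sum fun i _ => Finset.sum_le_sum fun j _ => ?_
        rw [← tsum_enorm_coef_sq (memLp_mul_coord h i j)]
        refine (tsum_coef_mul_sq_le (memLp_coord h.memLp i) (memLp_coord h.memLp j)).trans ?_
        gcongr
        · exact sobolevSq_coord_le u i
        · exact sobolevSq_coord_le u j
    _ = _ := by
        simp
        ring

/-- Cauchy–Schwarz gives ‖u‖₃³ ≤ ‖u‖₂ ‖u‖₄², and the L⁴ norm is controlled in H¹. -/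
theorem lintegral_cube_le {u : T3 → R3} {G : T3 → Fin 3 → R3} (h : IsSobolevField u G) :
    ∫⁻ x, ‖u x‖ₑ ^ 3 ≤
      eLpNorm u 2 volume * ((36 * latticeSum) ^ (1 / 2 : ℝ) * fieldSobolevSq u) := by
  refine IsWeakSolution.le_of_sq_le_sq ?_
  have e : ∀ x, ‖u x‖ₑ ^ 3 = ‖u x‖ₑ * ‖u x‖ₑ ^ 2 := fun x => by ring
  have e2 : ((36 * latticeSum) ^ (1 / 2 : ℝ)) ^ 2 = 36 * latticeSum := by
    rw [← ENNReal.rpow_natCast, ← ENNReal.rpow_mul]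
    norm_num
  simp only [e]
  refine (lintegral_mul_sq_le h.memLp.1.enorm (h.memLp.1.enorm.pow_const 2)).trans ?_
  rw [mul_pow, mul_pow, e2, IsWeakSolution.eLpNorm_two_sq]
  exact mul_le_mul' le_rfl (lintegral_fourth_le h)

theorem lintegral_increment_cube_le {u : T3 → R3} (hu : AEStronglyMeasurable u volume) (y : R3) :
    ∫⁻ x, ‖increment y u x‖ₑ ^ 3 ≤ 8 * ∫⁻ x, ‖u x‖ₑ ^ 3 := by
  have h4 : ∀ a b : ℝ≥0∞, (a + b) ^ 3 ≤ 4 * (a ^ 3 + b ^ 3) := fun a b => by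
    have := ENNReal.rpow_add_le_mul_rpow_add_rpow a b (p := 3) (by norm_num)
    norm_num at this
    exact this
  calc ∫⁻ x, ‖increment y u x‖ₑ ^ 3
      ≤ ∫⁻ x, 4 * (‖u (x + toTorus y)‖ₑ ^ 3 + ‖u x‖ₑ ^ 3) :=
        lintegral_mono fun x => (pow_le_pow_left' enorm_sub_le 3).trans (h4 _ _)
    _ = 4 * ((∫⁻ x, ‖u x‖ₑ ^ 3) + ∫⁻ x, ‖u x‖ₑ ^ 3) := by
        rw [lintegral_const_mul' _ _ (by norm_num), lintegral_add_right' _ (hu.enorm.pow_const 3),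
          lintegral_add_right_eq_self (fun x => ‖u x‖ₑ ^ 3)]
    _ = _ := by ring

instance : SFinite (surfaceMeasure.prod (volume : Measure T3)) :=
  Measure.prod.instSFinite

theorem continuous_toTorus : Continuous toTorus := by
  refine continuous_pi fun i => ?_
  exact (AddCircle.continuous_mk' 1).comp (by fun_prop)

theorem quasiMeasurePreserving_time_space : Measure.QuasiMeasurePreserving
    (fun z : ℝ × S2 × T3 => (z.1, z.2.2))
    (timeMeasure.prod (surfaceMeasure.prod volume)) (timeMeasure.prod volume) :=
  QuasiMeasurePreserving.prodMap (Measure.QuasiMeasurePreserving.id timeMeasure)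
    Measure.quasiMeasurePreserving_snd

/-- The velocity is only almost everywhere equal to a measurable function of (t, x), so joint
measurability of v(t, x + ℓn) requires that the shift pull null sets back to null sets. For each n
it is a translation, so the skew product preserves the measure. -/
theorem quasiMeasurePreserving_shift (l : ℝ) :
    Measure.QuasiMeasurePreserving
      (fun z : ℝ × S2 × T3 => (z.1, z.2.2 + toTorus (l • (z.2.1 : R3))))
      (timeMeasure.prod (surfaceMeasure.prod volume)) (timeMeasure.prod volume) := by
  have hc : Measurable fun w : S2 × T3 => w.2 + toTorus (l • (w.1 : R3)) := by
    have : Continuous fun n : S2 => toTorus (l • (n : R3)) :=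
      continuous_toTorus.comp (by fun_prop)
    exact measurable_snd.add (this.measurable.comp measurable_fst)
  have h1 : MeasurePreserving (fun w : S2 × T3 => (w.1, w.2 + toTorus (l • (w.1 : R3))))
      (surfaceMeasure.prod volume) (surfaceMeasure.prod volume) :=
    (MeasurePreserving.id surfaceMeasure).skew_product
      (g := fun n x => x + toTorus (l • (n : R3))) hc
      (ae_of_all _ fun n => (measurePreserving_translate _).map_eq)
  have h2 : MeasurePreserving
      (fun z : ℝ × S2 × T3 => (z.1, (z.2.1, z.2.2 + toTorus (l • (z.2.1 : R3)))))
      (timeMeasure.prod (surfaceMeasure.prod volume))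
      (timeMeasure.prod (surfaceMeasure.prod volume)) :=
    (MeasurePreserving.id timeMeasure).prod h1
  exact quasiMeasurePreserving_time_space.comp h2.quasiMeasurePreserving

theorem IsWeakSolution.integrable_increment_cube {ν : ℝ} {f v : ℝ → T3 → R3}
    {G : ℝ → T3 → Fin 3 → R3} {p : ℝ → T3 → ℝ} (h : IsWeakSolution ν f v G p) (l : ℝ) :
    Integrable (fun z : ℝ × S2 × T3 => ‖increment (l • (z.2.1 : R3)) (v z.1) z.2.2‖ ^ 3)
      (timeMeasure.prod (surfaceMeasure.prod volume)) := by
  have m1 : AEStronglyMeasurable (fun z : ℝ × S2 × T3 => v z.1 (z.2.2 + toTorus (l • (z.2.1 : R3))))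
      (timeMeasure.prod (surfaceMeasure.prod volume)) :=
    h.aesm.comp_quasiMeasurePreserving (quasiMeasurePreserving_shift l)
  have m2 : AEStronglyMeasurable (fun z : ℝ × S2 × T3 => v z.1 z.2.2)
      (timeMeasure.prod (surfaceMeasure.prod volume)) :=
    h.aesm.comp_quasiMeasurePreserving quasiMeasurePreserving_time_space
  have m : AEStronglyMeasurable
      (fun z : ℝ × S2 × T3 => ‖increment (l • (z.2.1 : R3)) (v z.1) z.2.2‖ ^ 3)
      (timeMeasure.prod (surfaceMeasure.prod volume)) := (m1.sub m2).norm.pow 3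
  refine ⟨m, ?_⟩
  unfold HasFiniteIntegral
  rw [lintegral_prod _ m.enorm]
  set C := eLpNorm (fun t => eLpNorm (v t) 2 volume) ⊤ timeMeasure
  set L := surfaceMeasure univ * (8 * (C * (36 * latticeSum) ^ (1 / 2 : ℝ)))
  have hL : L < ⊤ := ENNReal.mul_lt_top (measure_lt_top _ _) (ENNReal.mul_lt_top (by norm_num)
    (ENNReal.mul_lt_top h.bound (ENNReal.rpow_lt_top_of_nonneg (by norm_num)
      (ENNReal.mul_lt_top (by norm_num) latticeSum_lt_top).ne)))
  have hbd : ∫⁻ r, ∫⁻ w : S2 × T3, ‖‖increment (l • (w.1 : R3)) (v r) w.2‖ ^ 3‖ₑ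
      ∂(surfaceMeasure.prod volume) ∂timeMeasure ≤
      ∫⁻ r, L * (C ^ 2 + ∫⁻ x, ∑ j : Fin 3, ‖G r x j‖ₑ ^ 2) ∂timeMeasure := by
    refine lintegral_mono_ae ?_
    filter_upwards [h.sobolev, ae_eLpNorm_le (v := v), m.prodMk_left] with r h1 h2 h3
    rw [lintegral_prod _ h3.enorm]
    calc _ ≤ ∫⁻ n : S2, 8 * (C * ((36 * latticeSum) ^ (1 / 2 : ℝ) *
          (C ^ 2 + ∫⁻ x, ∑ j : Fin 3, ‖G r x j‖ₑ ^ 2))) ∂surfaceMeasure := by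
          refine lintegral_mono fun n => ?_
          simp only [enorm_pow, enorm_norm]
          refine (lintegral_increment_cube_le h1.memLp.1 _).trans (mul_le_mul' le_rfl
            ((lintegral_cube_le h1).trans (mul_le_mul' h2 (mul_le_mul' le_rfl
              ((fieldSobolevSq_le h1).trans (add_le_add ?_ le_rfl))))))
          rw [← eLpNorm_two_sq]
          exact pow_le_pow_left' h2 2
      _ = _ := by
          rw [lintegral_const]
          ring
  refine hbd.trans_lt ?_
  rw [lintegral_const_mul' _ _ hL.ne, lintegral_add_left measurable_const, lintegral_const]
  exact ENNReal.mul_lt_top hL (ENNReal.add_lt_top.2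
    ⟨ENNReal.mul_lt_top (ENNReal.pow_lt_top h.bound) (measure_lt_top _ _), h.grad_bound⟩)

theorem IsLerayHopf.integrable_increment_cube {ν : ℝ} {vin : T3 → R3} {f v : ℝ → T3 → R3}
    (h : IsLerayHopf ν vin f v) (l : ℝ) :
    Integrable (fun z : ℝ × S2 × T3 => ‖increment (l • (z.2.1 : R3)) (v z.1) z.2.2‖ ^ 3)
      (timeMeasure.prod (surfaceMeasure.prod volume)) := by
  obtain ⟨G, P, h, _⟩ := h.exists_weakSolution
  exact h.integrable_increment_cube l

end Kolmogorov

end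

/-! ### The two laws as instances of the general one. -/

theorem theorem1p2
    (vin : T3 → R3) (f v : ℝ → ℝ → T3 → R3)
    (hv : ∀ ν ∈ Ioo (0 : ℝ) 1, IsLerayHopf ν vin (f ν) (v ν))
    (σ α q : ℝ) (hσ : 0 < σ) (hα : α ∈ Ioo (0 : ℝ) 1) (hq : q ∈ Icc (1 : ℝ) 2)
    (hH : UniformBound σ α q f v) :
    -- the integrals defining the structure functions converge absolutely
    (∀ ν ∈ Ioo (0 : ℝ) 1, ∀ l > 0,
      Integrable (fun z : ℝ × S2 × T3 => ‖increment (l • (z.2.1 : R3)) (v ν z.1) z.2.2‖ ^ 3)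
        (timeMeasure.prod (surfaceMeasure.prod volume))) ∧
    ∀ K : ℝ, 0 < K → K < 1 / (2 - α * q) →
      ∀ p κ M : ℝ, 1 ≤ p → 0 < κ → 0 < M →
        Tendsto (fun lI : ℝ =>
            limsup (fun ν : ℝ =>
              ⨆ l ∈ Icc (ν ^ K) lI, ⨆ τ : RandomTime.{u} κ M,
                τ.average p (fun t =>
                  (∫ r in (0 : ℝ)..t, structLong (v ν r) l / l)
                    + 4 / 5 * dissipation (f ν) (v ν) t))
              (𝓝[>] 0))
          (𝓝[>] 0) (𝓝 0) ∧
        Tendsto (fun lI : ℝ =>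
            limsup (fun ν : ℝ =>
              ⨆ l ∈ Icc (ν ^ K) lI, ⨆ τ : RandomTime.{u} κ M,
                τ.average p (fun t =>
                  (∫ r in (0 : ℝ)..t, structZero (v ν r) l / l)
                    + 4 / 3 * dissipation (f ν) (v ν) t))
              (𝓝[>] 0))
          (𝓝[>] 0) (𝓝 0) := by
  refine ⟨fun ν hν l _ => ?_, fun K _ hK p κ M hp hκ _ => ⟨?_, ?_⟩⟩
  · simpa only [Nat.cast_smul_eq_nsmul] using (hv ν hν).integrable_increment_cube (l : ℝ)
  · have h := tendsto_average_defect hv hσ hα hq hH 1 1 (M := M) hK hp hκ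
    -- For A = b = 1 this is (4/3)(1 - 2/5).
    have e : symbolMass 1 1 / Real.pi = 4 / 5 := by
      unfold symbolMass
      field_simp
      ring
    simpa only [structGen_one_one, e] using h
  · have h := tendsto_average_defect hv hσ hα hq hH 1 0 (M := M) hK hp hκ
    have e : symbolMass 1 0 / Real.pi = 4 / 3 := by
      unfold symbolMass
      field_simp
      ring
    simpa only [structGen_one_zero, e] using h
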